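/- **Conventions.** Let $X=\{x_1,\dots,x_n\}$ be a set of $n$ variables. A literal is a variable or a negated variable, a term is a finite set of literals with pairwise different variables, and a DNF $D$ is a finite set of terms; $m$ denotes its number of terms. A model of $D$ is an assignment $X\to\{0,1\}$ that makes all literals of at least one term of $D$ true. $D$ is monotone if no negated literal occurs in it. The computational model is the random access machine (RAM) with registers holding natural numbers, whose instructions are assignment of constants, copying, array access $R_i\leftarrow R_{R_j+R_k}$ and $R_{R_i+R_j}\leftarrow R_k$, jumps (unconditional, or on a comparison $R_i<R_j$), the arithmetic instructions addition, (truncated) subtraction and multiplication, halting, and an instruction that outputs the contents of the consecutive registers from $R_a$ to $R_b$, where $a$ and $b$ are the contents of two given registers. Every instruction takes constant time, except that an arithmetic instruction takes time linear in the number of bits of its operands. The space used at a given step is the sum of the numbers of bits of the contents of all registers. The input, which lists $n$, $m$ and the $m$ distinct terms, in any order, each as a row of $n$ entries telling for each variable whether it occurs positively, negatively or not at all, is stored in consecutive registers; its size is its total number of bits plus its number of entries. A RAM enumerates the models of $D$ if it halts after having output each model of $D$ (as the word of its $n$ values) exactly once, and nothing else. It does so with precomputation time $P$ and average delay at most $d$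 if, after a phase of total time at most $P$ in which nothing is output, it halts within a further time of at most $d$ times the number of models of $D$. **Theorem.** There are a RAM, a constant $C$ and polynomials $p$ and $q$ such that, for every $n\ge 0$ and every monotone DNF $D$ with $m\ge 0$ terms on $n$ variables, given by an input of size $N$, the machine enumerates the models of $D$ with precomputation time at most $p(N)$ and average delay at most $C\log(mn+2)$, using space at most $q(N)$ at every step. That is, the models of a monotone DNF can be enumerated with average delay $O(\log(mn))$ and polynomial space. -/

import Mathlib

/-! ### DNF formulas -/

/-- A literal over the variables `x_0, …, x_{n-1}`: `(i, true)` is `x_i`, `(i, false)` is `¬ x_i`. -/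
abbrev Literal (n : ℕ) := Fin n × Bool

/-- A term: a finite set of literals in which any two distinct literals have different variables. -/
abbrev Term (n : ℕ) :=
  {T : Finset (Literal n) // ∀ ℓ ∈ T, ∀ ℓ' ∈ T, ℓ.1 = ℓ'.1 → ℓ = ℓ'}

/-- A formula in disjunctive normal form: a finite set of terms. -/
abbrev DNF (n : ℕ) := Finset (Term n)

/-- The value of a literal under an assignment. -/
def Literal.value {n : ℕ} (α : Fin n → Bool) (ℓ : Literal n) : Bool :=
  if ℓ.2 then α ℓ.1 else !(α ℓ.1)

/-- The assignment `α` satisfies every literal of the term `T`. -/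
def Term.Satisfied {n : ℕ} (T : Term n) (α : Fin n → Bool) : Prop :=
  ∀ ℓ ∈ T.1, Literal.value α ℓ = true

/-- The set of models of `D`. -/
def DNF.sat {n : ℕ} (D : DNF n) : Set (Fin n → Bool) :=
  {α | ∃ T ∈ D, Term.Satisfied T α}

/-- A DNF is monotone if it contains no negated literal. -/
def DNF.IsMonotone {n : ℕ} (D : DNF n) : Prop :=
  ∀ T ∈ D, ∀ ℓ ∈ T.1, ℓ.2 = true

/-! ### Random access machines -/

/-- The instructions of a random access machine whose registers `R_0, R_1, …` hold natural
numbers. Program positions are numbered from `0`. -/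
inductive Instr where
  /-- `R_i ← c` -/
  | const (i c : ℕ)
  /-- `R_i ← R_j` -/
  | copy (i j : ℕ)
  /-- array read: `R_i ← R_a` where `a = R_j + R_k` (base address and index) -/
  | load (i j k : ℕ)
  /-- array write: `R_a ← R_k` where `a = R_i + R_j` (base address and index) -/
  | store (i j k : ℕ)
  /-- `R_i ← R_j + R_k` -/
  | add (i j k : ℕ)
  /-- `R_i ← R_j - R_k`, truncated at `0` -/
  | sub (i j k : ℕ)
  /-- `R_i ← R_j * R_k` -/
  | mul (i j k : ℕ)
  /-- go to program position `l` -/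
  | jump (l : ℕ)
  /-- go to program position `l` if `R_i < R_j` -/
  | jumpLT (i j l : ℕ)
  /-- output the word `R_a, R_{a+1}, …, R_b` where `a = R_i` and `b = R_j` -/
  | output (i j : ℕ)
  /-- stop -/
  | halt

/-- A configuration: program counter, contents of the registers, list of the words output so far
(in order of output), and total cost of the instructions executed so far. -/
structure Config where
  pc : ℕ
  reg : ℕ → ℕ
  out : List (List ℕ)
  clock : ℕ

/-- The time of an instruction: constant, except for the arithmetic instructions, whose time is
linear in the number of bits of their operands. -/
def Instr.cost (R : ℕ → ℕ) : Instr → ℕ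
  | .add _ j k => 1 + (R j).size + (R k).size
  | .sub _ j k => 1 + (R j).size + (R k).size
  | .mul _ j k => 1 + (R j).size + (R k).size
  | _ => 1

/-- Contents of the registers after an instruction. -/
def Instr.nextReg (R : ℕ → ℕ) : Instr → ℕ → ℕ
  | .const i c => Function.update R i c
  | .copy i j => Function.update R i (R j)
  | .load i j k => Function.update R i (R (R j + R k))
  | .store i j k => Function.update R (R i + R j) (R k)
  | .add i j k => Function.update R i (R j + R k)
  | .sub i j k => Function.update R i (R j - R k)
  | .mul i j k => Function.update R i (R j * R k)
  | _ => R

/-- Program counter after an instruction. -/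
def Instr.nextPc (R : ℕ → ℕ) (pc : ℕ) : Instr → ℕ
  | .jump l => l
  | .jumpLT i j l => if R i < R j then l else pc + 1
  | .halt => pc
  | _ => pc + 1

/-- The words output by an instruction (at most one). -/
def Instr.emit (R : ℕ → ℕ) : Instr → List (List ℕ)
  | .output i j => [(List.range' (R i) (R j + 1 - R i)).map R]
  | _ => []

/-- A random access machine: a finite program, and the number of registers at the beginning of the
memory that are left free (and `0`) when the input is written into the memory. -/
structure RAM where
  code : List Instr
  reserved : ℕ

/-- The machine has stopped: it is at a `halt` instruction or outside its program. -/
def RAM.Halted (M : RAM) (c : Config) : Prop :=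
  M.code[c.pc]? = none ∨ M.code[c.pc]? = some Instr.halt

/-- One step of the machine; a configuration that has stopped does not change. -/
def RAM.step (M : RAM) (c : Config) : Config :=
  match M.code[c.pc]? with
  | none => c
  | some .halt => c
  | some I =>
    { pc := I.nextPc c.reg c.pc
      reg := I.nextReg c.reg
      out := c.out ++ I.emit c.reg
      clock := c.clock + I.cost c.reg }

/-- The initial configuration: the letters of the input word stand in consecutive registers after
the reserved ones, and every other register holds `0`. -/
def RAM.init (M : RAM) (w : List ℕ) : Config where
  pc := 0
  reg := fun a => if a < M.reserved then 0 else w.getD (a - M.reserved) 0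
  out := []
  clock := 0

/-- The configuration after `t` steps on input `w`. -/
def RAM.run (M : RAM) (w : List ℕ) (t : ℕ) : Config := M.step^[t] (M.init w)

/-- The space used by a configuration: the sum of the number of bits of the contents of all
registers (a supremum of finite partial sums, so no convergence convention is involved). -/
noncomputable def Config.space (c : Config) : ℕ∞ :=
  ⨆ s : Finset ℕ, ((∑ a ∈ s, (c.reg a).size : ℕ) : ℕ∞)

/-! ### Enumeration -/

/-- On input `w`, the machine stops after having output every element of `A` exactly once and
nothing else. -/
def RAM.Enumerates (M : RAM) (w : List ℕ) (A : Set (List ℕ)) : Prop :=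
  ∃ t, M.Halted (M.run w t) ∧ (M.run w t).out.Nodup ∧ {y | y ∈ (M.run w t).out} = A

/-- On input `w`, after a precomputation phase of time at most `pre`, during which nothing is
output, the machine stops within a further time of at most `d` times the number of output
words. -/
def RAM.HasAverageDelay (M : RAM) (w : List ℕ) (pre : ℕ) (d : ℝ) : Prop :=
  ∃ s t, s ≤ t ∧ (M.run w s).out = [] ∧ (M.run w s).clock ≤ pre ∧ M.Halted (M.run w t) ∧
    ((M.run w t).clock : ℝ) - ((M.run w s).clock : ℝ) ≤ d * ((M.run w t).out.length : ℝ)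

/-- On input `w`, the machine uses space at most `b` at every step. -/
def RAM.UsesSpace (M : RAM) (w : List ℕ) (b : ℕ) : Prop :=
  ∀ t, (M.run w t).space ≤ (b : ℕ∞)

/-- The size of an input word: each letter counts for its number of bits plus one. -/
def wordSize (w : List ℕ) : ℕ := (w.map fun a => a.size + 1).sum

/-- A term is written as a word of `n` letters; the letter at position `i` is `1` if `x_i` is in
the term, `2` if `¬ x_i` is in the term, and `0` otherwise. -/
def Term.encode {n : ℕ} (T : Term n) : List ℕ :=
  List.ofFn fun i : Fin n => if (i, true) ∈ T.1 then 1 else if (i, false) ∈ T.1 then 2 else 0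

/-- The input word for a DNF on `n` variables whose terms are listed (in some order) as `l`:
the numbers of variables and of terms, followed by the terms. -/
def encodeInput {n : ℕ} (l : List (Term n)) : List ℕ :=
  n :: l.length :: l.flatMap Term.encode

/-- An assignment is written as the word of its `n` values. -/
def encodeAssignment {n : ℕ} (α : Fin n → Bool) : List ℕ :=
  List.ofFn fun i : Fin n => (α i).toNat

/-! Write the terms as distinct rows of bits; a model is a word that lies above some row. If there
is a term, the all-ones word is a model, and the others are found by branching on the positions from
left to right (`Monotone.words`). A node consists of a position `i`, a word `α` that is 1 from `i`
on, and a set `A` of rows; it stands for the words other than `α` that agree with `α` before `i` and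
lie above a row of `A` from `i` on. If no row of `A` has entry 0 at `i`, the value 1 is forced.
Otherwise `α` with 0 at `i` is output, the branch with value 0 keeps the rows with entry 0 at `i`,
and the branch with value 1 keeps all rows. So every proper branching is charged to one word.

A branching must cost about the number of rows with entry 0 at `i`, not the size of `A`. Rows that
agree after `i` are merged into one representative, chosen so that a representative with entry 1 at
`i` remains one (`Rows.rep_keep`); only the rows with entry 0 are touched. Rows of `A` then have
different suffixes, hence the size of `A` is at most one more than the number of words of the node
(`Rows.card_le`). The number of rows handled is bounded in `Rows.work_le`: with it, the size of `A`
is at most (1 + number of words)(1 + log₂ of the size of `A`). If `x` rows have entry 0 and `y` rows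
entry 1, at least max(x, y) rows survive merging for value 1. The two inductive bounds therefore
fall short by at most min(x, y), and this is gained where log₂ x is replaced by log₂ (x + y) with a
factor of at least `x` (`log_gain`).

For the implementation, the rows of a node lie in buckets according to their next zero, and a
tournament tree over the positions finds the first nonempty bucket, so positions without branching
cost nothing. Next zeros, representatives and tree neighbours are tabulated in advance and row
addresses are kept in registers; hence moving a row takes a bounded number of unit-cost copies and
array accesses. Arithmetic, of cost O(log(mn)), and tree updates occur only a bounded number of
times per branching and per bucket that is opened. Each open bucket later yields a word, so the
number of open buckets serves as a potential (`wp_run`). In total there are O(log(mn)) units per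
word and O(1) per handled row, and `Rows.work_le` allows O(log(m + 1)) handled rows per word.

The machine is written in a small structured language; `simulates` carries output, time and a bound
on all register contents over to the compiled code, and the last of these gives the space bound.
Formulas without terms are treated separately. -/

/-! ### A structured language compiled to random access machines -/

namespace While

/-- Parameters of the memory layout: numbers of variables and of terms, and the input letters. -/
structure Env where
  nv : ℕ
  nt : ℕ
  inp : ℕ → ℕ

namespace Env

/-- Number of columns of an array. -/
def width (E : Env) : ℕ := 2 * (E.nv + E.nt)

/-- Number of rows of an array. -/
def rows (E : Env) : ℕ := E.nv + E.nt + 2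

/-- First register after the input. -/
def base (E : Env) : ℕ := 82 + E.nv * E.nt

/-- Bound on the addresses and on the contents of all registers. -/
def cap (E : Env) : ℕ := E.base + E.width * (12 * E.rows)

/-- Bound on the time of an arithmetic instruction. -/
def arith (E : Env) : ℕ := 1 + 2 * E.cap.size

/-- Address of the entry in row `k` and column `c` of the array `a`. -/
def addr (E : Env) (a k c : ℕ) : ℕ := E.base + E.width * (12 * k + a) + c

end Env

/-- A state: scalars, selected rows, arrays, output and clock. -/
structure St where
  v : ℕ → ℕ
  r : ℕ → ℕ
  mem : ℕ → ℕ → ℕ → ℕ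
  out : List (List ℕ)
  clock : ℕ

/-- Update of one entry of one array. -/
def upd (M : ℕ → ℕ → ℕ → ℕ) (a k c x : ℕ) : ℕ → ℕ → ℕ → ℕ :=
  fun a' k' c' => if a' = a ∧ k' = k ∧ c' = c then x else M a' k' c'

namespace St

def setv (s : St) (x n : ℕ) : St := { s with v := Function.update s.v x n }
def setr (s : St) (y n : ℕ) : St := { s with r := Function.update s.r y n }
def setm (s : St) (a k c n : ℕ) : St := { s with mem := upd s.mem a k c n }
def push (s : St) (w : List ℕ) : St := { s with out := s.out ++ [w] }
def tick (s : St) (n : ℕ) : St := { s with clock := s.clock + n }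

end St

/-- Atomic commands. -/
inductive Atom where
  | const (x c : ℕ)
  | copy (x y : ℕ)
  | add (x y z : ℕ)
  | sub (x y z : ℕ)
  /-- select row `v x` in slot `y` -/
  | row (y x : ℕ)
  /-- read array `a` at the row in slot `y` and column `v z` -/
  | load (x a y z : ℕ)
  /-- write `v x` into array `a` at the row in slot `y` and column `v z` -/
  | store (a y z x : ℕ)
  | input (x y : ℕ)
  /-- output the first `v x` entries of the row of array `0` in slot `0` -/
  | emit (x : ℕ)

/-- Commands; the tests are comparisons `v x < v y`. -/
inductive Cmd where
  | atom (A : Atom)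
  | seq (c d : Cmd)
  | ite (x y : ℕ) (c d : Cmd)
  | loop (x y : ℕ) (c : Cmd)

namespace Atom

/-- Side conditions that keep every register content at most `E.cap` and every access inside the
arrays. The constant 82 is a lower bound for every `E.cap` (`cap_ge`). -/
def ok (E : Env) (s : St) : Atom → Prop
  | const _ c => c ≤ 82
  | copy _ _ => True
  | add _ y z => s.v y + s.v z ≤ E.cap
  | sub _ _ _ => True
  | row _ x => s.v x < E.rows
  | load _ _ y z => s.r y < E.rows ∧ s.v z < E.width
  | store _ y z _ => s.r y < E.rows ∧ s.v z < E.width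
  | input _ y => s.v y < 2 + E.nv * E.nt
  | emit x => s.r 0 < E.rows ∧ s.v x ≤ E.width

/-- Loads and stores cost one unit because the addresses of the selected rows stand in registers.
Selecting a row takes one multiplication and twelve additions, hence the factor 13. -/
def next (E : Env) (s : St) : Atom → St
  | const x c => (s.setv x c).tick 1
  | copy x y => (s.setv x (s.v y)).tick 1
  | add x y z => (s.setv x (s.v y + s.v z)).tick E.arith
  | sub x y z => (s.setv x (s.v y - s.v z)).tick E.arith
  | row y x => (s.setr y (s.v x)).tick (13 * E.arith)
  | load x a y z => (s.setv x (s.mem a (s.r y) (s.v z))).tick 1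
  | store a y z x => (s.setm a (s.r y) (s.v z) (s.v x)).tick 1
  | input x y => (s.setv x (E.inp (s.v y))).tick 1
  | emit x => (s.push ((List.range (s.v x)).map (s.mem 0 (s.r 0)))).tick (3 * E.arith)

/-- There are 24 scalars, 12 arrays and 4 slots: the scalars occupy registers 8 to 31 and the row
addresses 32 to 79, so that the input can start at 80. -/
def wf : Atom → Bool
  | const x _ => x < 24
  | copy x y => x < 24 && y < 24
  | add x y z => x < 24 && y < 24 && z < 24
  | sub x y z => x < 24 && y < 24 && z < 24
  | row y x => y < 4 && x < 24
  | load x a y z => x < 24 && a < 12 && y < 4 && z < 24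
  | store a y z x => x < 24 && a < 12 && y < 4 && z < 24
  | input x y => x < 24 && y < 24
  | emit x => x < 24

/-- Register of the scalar `x`. -/
abbrev vr (x : ℕ) : ℕ := 8 + x

/-- Register of the address of the row of array `a` in slot `y`. -/
abbrev pr (a y : ℕ) : ℕ := 32 + 12 * y + a

/-- The rows with equal index of the twelve arrays are adjacent in memory. After one multiplication,
each further address arises by adding the width, which stands in register 1. -/
def code : Atom → List Instr
  | const x c => [.const (vr x) c]
  | copy x y => [.copy (vr x) (vr y)]
  | add x y z => [.add (vr x) (vr y) (vr z)]
  | sub x y z => [.sub (vr x) (vr y) (vr z)]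
  | row y x => [.mul 0 (vr x) 3, .add (pr 0 y) 2 0] ++
      (List.range 11).map fun a => .add (pr (a + 1) y) (pr a y) 1
  | load x a y z => [.load (vr x) (pr a y) (vr z)]
  | store a y z x => [.store (pr a y) (vr z) (vr x)]
  | input x y => [.load (vr x) 4 (vr y)]
  | emit x => [.add 0 (pr 0 0) (vr x), .sub 0 0 5, .output (pr 0 0) 0]

end Atom

namespace Cmd

def wf : Cmd → Bool
  | atom A => A.wf
  | seq c d => c.wf && d.wf
  | ite x y c d => x < 24 && y < 24 && c.wf && d.wf
  | loop x y c => x < 24 && y < 24 && c.wf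

def len : Cmd → ℕ
  | atom A => A.code.length
  | seq c d => c.len + d.len
  | ite _ _ c d => 1 + d.len + 1 + c.len
  | loop _ _ c => 2 + c.len + 1

/-- The code of a command placed at a program position. -/
def code : Cmd → ℕ → List Instr
  | atom A, _ => A.code
  | seq c d, o => c.code o ++ d.code (o + c.len)
  | ite x y c d, o =>
      .jumpLT (Atom.vr x) (Atom.vr y) (o + 1 + d.len + 1) ::
        (d.code (o + 1) ++ (.jump (o + 1 + d.len + 1 + c.len) :: c.code (o + 1 + d.len + 1)))
  | loop x y c, o =>
      .jumpLT (Atom.vr x) (Atom.vr y) (o + 2) :: .jump (o + 2 + c.len + 1) ::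
        (c.code (o + 2) ++ [.jump o])

theorem length_code (c : Cmd) (o : ℕ) : (c.code o).length = c.len := by
  induction c generalizing o with
  | atom A => rfl
  | seq c d hc hd => simp [code, len, hc, hd]
  | ite x y c d hc hd => simp [code, len, hc, hd]; omega
  | loop x y c hc => simp [code, len, hc]; omega

end Cmd

/-- Big-step execution. -/
inductive Exec (E : Env) : Cmd → St → St → Prop
  | atom {A s} : A.ok E s → Exec E (.atom A) s (A.next E s)
  | seq {c d s t u} : Exec E c s t → Exec E d t u → Exec E (.seq c d) s u
  -- The charge 2 pays for the conditional jump and for at most one unconditional jump.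
  | iteT {x y c d s t} : s.v x < s.v y → Exec E c (s.tick 2) t → Exec E (.ite x y c d) s t
  | iteF {x y c d s t} : ¬ s.v x < s.v y → Exec E d (s.tick 2) t → Exec E (.ite x y c d) s t
  | loopT {x y c s t u} : s.v x < s.v y → Exec E c (s.tick 2) t → Exec E (.loop x y c) t u →
      Exec E (.loop x y c) s u
  | loopF {x y c s} : ¬ s.v x < s.v y → Exec E (.loop x y c) s (s.tick 2)

/-- Weakest precondition for total correctness. -/
def wp (E : Env) (c : Cmd) (Q : St → Prop) (s : St) : Prop := ∃ t, Exec E c s t ∧ Q t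

section wp

variable {E : Env} {Q : St → Prop} {s : St}

theorem wp_atom {A : Atom} : wp E (.atom A) Q s ↔ A.ok E s ∧ Q (A.next E s) := by
  constructor
  · rintro ⟨t, h, hq⟩
    cases h with
    | atom h => exact ⟨h, hq⟩
  · rintro ⟨h, hq⟩
    exact ⟨_, .atom h, hq⟩

theorem wp_seq {c d : Cmd} : wp E (.seq c d) Q s ↔ wp E c (wp E d Q) s := by
  constructor
  · rintro ⟨t, h, hq⟩
    cases h with
    | seq h h' => exact ⟨_, h, _, h', hq⟩
  · rintro ⟨t, h, u, h', hq⟩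
    exact ⟨_, .seq h h', hq⟩

theorem wp_ite {x y : ℕ} {c d : Cmd} : wp E (.ite x y c d) Q s ↔
    if s.v x < s.v y then wp E c Q (s.tick 2) else wp E d Q (s.tick 2) := by
  split_ifs with hs
  · constructor
    · rintro ⟨t, h, hq⟩
      cases h with
      | iteT _ h => exact ⟨_, h, hq⟩
      | iteF h => exact absurd hs h
    · rintro ⟨t, h, hq⟩
      exact ⟨_, .iteT hs h, hq⟩
  · constructor
    · rintro ⟨t, h, hq⟩
      cases h with
      | iteT h => exact absurd h hs
      | iteF _ h => exact ⟨_, h, hq⟩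
    · rintro ⟨t, h, hq⟩
      exact ⟨_, .iteF hs h, hq⟩

theorem wp_loop_of_lt {x y : ℕ} {c : Cmd} (hs : s.v x < s.v y)
    (h : wp E c (wp E (.loop x y c) Q) (s.tick 2)) : wp E (.loop x y c) Q s := by
  obtain ⟨t, h, u, h', hq⟩ := h
  exact ⟨_, .loopT hs h h', hq⟩

theorem wp_loop_of_not_lt {x y : ℕ} {c : Cmd} (hs : ¬ s.v x < s.v y)
    (h : Q (s.tick 2)) : wp E (.loop x y c) Q s :=
  ⟨_, .loopF hs, h⟩

theorem wp_mono {c : Cmd} {Q' : St → Prop} (h : wp E c Q s) (hQ : ∀ t, Q t → Q' t) :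
    wp E c Q' s :=
  let ⟨t, ht, hq⟩ := h
  ⟨t, ht, hQ t hq⟩

end wp

/-! ### Simulation -/

/-- Register contents are bounded by `B`, and the registers from `B` on hold `0`. -/
def Safe (B : ℕ) (R : ℕ → ℕ) : Prop := ∀ a, R a ≤ B ∧ (B ≤ a → R a = 0)

theorem Safe.update {B : ℕ} {R : ℕ → ℕ} (h : Safe B R) {i x : ℕ} (hi : i < B) (hx : x ≤ B) :
    Safe B (Function.update R i x) := by
  intro a
  by_cases ha : a = i
  · subst ha
    simp only [Function.update_self]
    exact ⟨hx, fun h => absurd hi (by omega)⟩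
  · simp only [Function.update_of_ne ha]
    exact h a

/-- Reachability by steps through register contents that satisfy `P`. -/
def Steps (M : RAM) (P : (ℕ → ℕ) → Prop) (c c' : Config) : Prop :=
  ∃ t, M.step^[t] c = c' ∧ ∀ t' ≤ t, P (M.step^[t'] c).reg

theorem Steps.refl {M : RAM} {P : (ℕ → ℕ) → Prop} {c : Config} (h : P c.reg) : Steps M P c c :=
  ⟨0, rfl, fun t' ht => by
    obtain rfl : t' = 0 := by omega
    exact h⟩

theorem Steps.trans {M : RAM} {P : (ℕ → ℕ) → Prop} {c d e : Config} (h : Steps M P c d) (h' : Steps M P d e) :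
    Steps M P c e := by
  obtain ⟨t, rfl, ht⟩ := h
  obtain ⟨u, rfl, hu⟩ := h'
  refine ⟨u + t, Function.iterate_add_apply .., fun k hk => ?_⟩
  by_cases hkt : k ≤ t
  · exact ht k hkt
  · obtain ⟨j, rfl⟩ : ∃ j, k = j + t := ⟨k - t, by omega⟩
    rw [Function.iterate_add_apply]
    exact hu j (by omega)

theorem Steps.head {M : RAM} {P : (ℕ → ℕ) → Prop} {c e : Config} (h : P c.reg)
    (h' : Steps M P (M.step c) e) : Steps M P c e := by
  obtain ⟨u, rfl, hu⟩ := h'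
  refine ⟨u + 1, rfl, fun k hk => ?_⟩
  cases k with
  | zero => exact h
  | succ k => exact hu k (by omega)

/-- The list `L` stands in the program of `M` from position `o` on. -/
def CodeAt (M : RAM) (o : ℕ) (L : List Instr) : Prop := ∀ i < L.length, M.code[o + i]? = L[i]?

theorem CodeAt.append {M : RAM} {o : ℕ} {L L' : List Instr} (h : CodeAt M o (L ++ L')) :
    CodeAt M o L ∧ CodeAt M (o + L.length) L' := by
  constructor
  · intro i hi
    rw [h i (by simp; omega), List.getElem?_append_left hi]
  · intro i hi
    rw [add_assoc, h (L.length + i) (by simp; omega), List.getElem?_append_right (by omega)]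
    simp

theorem CodeAt.cons {M : RAM} {o : ℕ} {I : Instr} {L : List Instr} (h : CodeAt M o (I :: L)) :
    M.code[o]? = some I ∧ CodeAt M (o + 1) L := by
  refine ⟨by simpa using h 0 (by simp), ?_⟩
  exact (CodeAt.append (L := [I]) h).2

/-- An instruction that is neither a jump nor `halt`. -/
def Plain : Instr → Prop
  | .jump _ | .jumpLT _ _ _ | .halt => False
  | _ => True

theorem step_plain {M : RAM} {c : Config} {I : Instr} (hc : M.code[c.pc]? = some I)
    (hI : Plain I) : M.step c =
      ⟨c.pc + 1, I.nextReg c.reg, c.out ++ I.emit c.reg, c.clock + I.cost c.reg⟩ := by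
  cases I <;> simp_all [RAM.step, Plain, Instr.nextPc]

/-- The operands have at most `B.size` bits. For `B = E.cap` the right-hand side is `E.arith`. -/
theorem cost_le {B : ℕ} {R : ℕ → ℕ} (h : Safe B R) (I : Instr) :
    I.cost R ≤ 1 + 2 * B.size := by
  have h' : ∀ a, (R a).size ≤ B.size := fun a => Nat.size_le_size (h a).1
  cases I <;> simp only [Instr.cost] <;>
    first | omega | (rename_i i j k; have := h' j; have := h' k; omega)

/-- The registers hold the state `s`. -/
structure Sim (E : Env) (s : St) (R : ℕ → ℕ) : Prop where
  width : R 1 = E.width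
  base : R 2 = E.base
  width12 : R 3 = 12 * E.width
  inpBase : R 4 = 80
  one : R 5 = 1
  var : ∀ x < 24, R (8 + x) = s.v x
  -- Only a slot with a valid row index is tied to the registers; the index `E.rows` serves as
  -- "undefined".
  ptr : ∀ a < 12, ∀ y < 4, s.r y < E.rows → R (32 + 12 * y + a) = E.addr a (s.r y) 0
  mem : ∀ a < 12, ∀ k < E.rows, ∀ c < E.width, R (E.addr a k c) = s.mem a k c
  inp : ∀ j < 2 + E.nv * E.nt, R (80 + j) = E.inp j
  safe : Safe E.cap R

theorem addr_lt {E : Env} {a k c : ℕ} (ha : a < 12) (hk : k < E.rows) (hc : c < E.width) :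
    E.addr a k c < E.cap := by
  have : E.width * (12 * k + a + 1) ≤ E.width * (12 * E.rows) := Nat.mul_le_mul_left _ (by omega)
  simp only [Env.addr, Env.cap]
  rw [mul_add] at this
  omega

theorem addr_ge {E : Env} {a k c : ℕ} : 82 + E.nv * E.nt ≤ E.addr a k c := by
  simp only [Env.addr, Env.base]
  omega

/-- Uniqueness of mixed-radix digits: the column is below the width, and the array is below 12. -/
theorem addr_inj {E : Env} {a k c a' k' c' : ℕ} (ha : a < 12) (hc : c < E.width) (ha' : a' < 12)
    (hc' : c' < E.width) (h : E.addr a k c = E.addr a' k' c') : a = a' ∧ k = k' ∧ c = c' := by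
  simp only [Env.addr] at h
  have hg : 12 * k + a = 12 * k' + a' := by
    by_contra hne
    rcases Nat.lt_or_gt_of_ne hne with hlt | hlt
    · have := Nat.mul_le_mul_left E.width (show 12 * k + a + 1 ≤ 12 * k' + a' from hlt)
      rw [mul_add] at this
      omega
    · have := Nat.mul_le_mul_left E.width (show 12 * k' + a' + 1 ≤ 12 * k + a from hlt)
      rw [mul_add] at this
      omega
  rw [hg] at h
  omega

theorem cap_ge (E : Env) : 82 ≤ E.cap := by
  simp only [Env.cap, Env.base]
  omega

theorem row_addr_le {E : Env} {a k : ℕ} (ha : a < 12) (hk : k < E.rows) :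
    E.base + E.width * (12 * k + a) + E.width ≤ E.cap := by
  have : E.width * (12 * k + a + 1) ≤ E.width * (12 * E.rows) := Nat.mul_le_mul_left _ (by omega)
  simp only [Env.cap]
  rw [mul_add] at this
  omega

theorem Sim.setv {E : Env} {s : St} {R : ℕ → ℕ} (h : Sim E s R) {x n : ℕ} (hx : x < 24)
    (hn : n ≤ E.cap) {k : ℕ} : Sim E ((s.setv x n).tick k) (Function.update R (8 + x) n) := by
  have hc := cap_ge E
  obtain ⟨h1, h2, h3, h4, h5, h6, h7, h8, h9, h10⟩ := h
  constructor
  · rw [Function.update_of_ne (by omega)]; exact h1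
  · rw [Function.update_of_ne (by omega)]; exact h2
  · rw [Function.update_of_ne (by omega)]; exact h3
  · rw [Function.update_of_ne (by omega)]; exact h4
  · rw [Function.update_of_ne (by omega)]; exact h5
  · intro y hy
    by_cases hxy : y = x
    · subst hxy
      simp [St.setv, St.tick]
    · rw [Function.update_of_ne (by omega), h6 y hy]
      simp [St.setv, St.tick, hxy]
  · intro a ha y hy hr
    rw [Function.update_of_ne (by omega)]
    exact h7 a ha y hy hr
  · intro a ha k hk c hc
    have := addr_ge (E := E) (a := a) (k := k) (c := c)
    rw [Function.update_of_ne (by omega)]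
    exact h8 a ha k hk c hc
  · intro j hj
    rw [Function.update_of_ne (by omega)]
    exact h9 j hj
  · exact h10.update (by omega) hn

/-- Register 0 is scratch space: among the clauses of `Sim` only `safe` concerns it. -/
theorem Sim.tmp {E : Env} {s : St} {R : ℕ → ℕ} (h : Sim E s R) {n : ℕ} (hn : n ≤ E.cap) :
    Sim E s (Function.update R 0 n) := by
  have hc := cap_ge E
  obtain ⟨h1, h2, h3, h4, h5, h6, h7, h8, h9, h10⟩ := h
  constructor
  · rw [Function.update_of_ne (by omega)]; exact h1
  · rw [Function.update_of_ne (by omega)]; exact h2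
  · rw [Function.update_of_ne (by omega)]; exact h3
  · rw [Function.update_of_ne (by omega)]; exact h4
  · rw [Function.update_of_ne (by omega)]; exact h5
  · intro y hy
    rw [Function.update_of_ne (by omega)]; exact h6 y hy
  · intro a ha y hy hr
    rw [Function.update_of_ne (by omega)]
    exact h7 a ha y hy hr
  · intro a ha k hk c hc
    have := addr_ge (E := E) (a := a) (k := k) (c := c)
    rw [Function.update_of_ne (by omega)]
    exact h8 a ha k hk c hc
  · intro j hj
    rw [Function.update_of_ne (by omega)]
    exact h9 j hj
  · exact h10.update (by omega) hn

theorem Sim.setm {E : Env} {s : St} {R : ℕ → ℕ} (h : Sim E s R) {a k c n j : ℕ} (ha : a < 12)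
    (hk : k < E.rows) (hc : c < E.width) (hn : n ≤ E.cap) :
    Sim E ((s.setm a k c n).tick j) (Function.update R (E.addr a k c) n) := by
  have hg := addr_ge (E := E) (a := a) (k := k) (c := c)
  have hl := addr_lt ha hk hc
  obtain ⟨h1, h2, h3, h4, h5, h6, h7, h8, h9, h10⟩ := h
  constructor
  · rw [Function.update_of_ne (by omega)]; exact h1
  · rw [Function.update_of_ne (by omega)]; exact h2
  · rw [Function.update_of_ne (by omega)]; exact h3
  · rw [Function.update_of_ne (by omega)]; exact h4
  · rw [Function.update_of_ne (by omega)]; exact h5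
  · intro y hy
    rw [Function.update_of_ne (by omega)]; exact h6 y hy
  · intro a ha y hy hr
    rw [Function.update_of_ne (by omega)]
    exact h7 a ha y hy hr
  · intro a' ha' k' hk' c' hc'
    by_cases he : a' = a ∧ k' = k ∧ c' = c
    · obtain ⟨rfl, rfl, rfl⟩ := he
      simp [St.setm, St.tick, upd]
    · rw [Function.update_of_ne fun hh => he (addr_inj ha' hc' ha hc hh), h8 a' ha' k' hk' c' hc']
      simp only [St.setm, St.tick, upd, if_neg he]
  · intro j hj
    rw [Function.update_of_ne (by omega)]
    exact h9 j hj
  · exact h10.update hl hn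

theorem Sim.congr {E : Env} {s s' : St} {R : ℕ → ℕ} (h : Sim E s R) (hv : s'.v = s.v)
    (hr : s'.r = s.r) (hm : s'.mem = s.mem) : Sim E s' R := by
  obtain ⟨h1, h2, h3, h4, h5, h6, h7, h8, h9, h10⟩ := h
  exact ⟨h1, h2, h3, h4, h5, hv ▸ h6, hr ▸ h7, hm ▸ h8, h9, h10⟩

/-- One step at a plain instruction, seen from the registers. -/
theorem Steps.plain {M : RAM} {P : (ℕ → ℕ) → Prop} {c e : Config} {I : Instr} (hc : M.code[c.pc]? = some I)
    (hI : Plain I) (h : P c.reg)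
    (h' : Steps M P ⟨c.pc + 1, I.nextReg c.reg, c.out ++ I.emit c.reg, c.clock + I.cost c.reg⟩ e) :
    Steps M P c e := by
  rw [← step_plain hc hI] at h'
  exact h'.head h

/-- What it means for a piece of code to simulate the passage from `s` to `s'`. -/
def Simulates (E : Env) (M : RAM) (o e : ℕ) (s s' : St) : Prop :=
  ∀ c : Config, c.pc = o → Sim E s c.reg → c.out = s.out →
    ∃ c', Steps M (Safe E.cap) c c' ∧ c'.pc = e ∧ Sim E s' c'.reg ∧ c'.out = s'.out ∧
      c'.clock + s.clock ≤ c.clock + s'.clock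

/-- Rows of the arrays are selected by successive additions. -/
theorem steps_row {E : Env} {M : RAM} {s : St} {y k : ℕ} (hy : y < 4) (hk : k < E.rows)
    (j : ℕ) : ∀ (_ : j ≤ 11) (c : Config),
    CodeAt M c.pc ((List.range' (11 - j) j).map
      fun a => Instr.add (Atom.pr (a + 1) y) (Atom.pr a y) 1) →
    Sim E s c.reg →
    (∀ a ≤ 11 - j, c.reg (32 + 12 * y + a) = E.addr a k 0) →
    ¬ s.r y < E.rows →
    ∃ c', Steps M (Safe E.cap) c c' ∧ c'.pc = c.pc + j ∧ Sim E (s.setr y k) c'.reg ∧ c'.out = c.out ∧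
      c'.clock ≤ c.clock + j * E.arith := by
  induction j with
  | zero =>
    intro hj c hcode hsim hp hr
    refine ⟨c, .refl hsim.safe, rfl, ?_, rfl, by omega⟩
    obtain ⟨h1, h2, h3, h4, h5, h6, h7, h8, h9, h10⟩ := hsim
    refine ⟨h1, h2, h3, h4, h5, h6, ?_, h8, h9, h10⟩
    intro a ha y' hy' hlt
    by_cases he : y' = y
    · subst he
      simpa [St.setr] using hp a (by omega)
    · simp only [St.setr, Function.update_of_ne he] at hlt ⊢
      exact h7 a ha y' hy' hlt
  | succ j ih =>
    intro hj c hcode hS hp hr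
    rw [List.range'_succ, List.map_cons] at hcode
    obtain ⟨h0, hcode⟩ := hcode.cons
    have hval : c.reg (32 + 12 * y + (11 - (j + 1))) + c.reg 1 = E.addr (11 - j) k 0 := by
      rw [hp _ le_rfl, hS.width]
      simp only [Env.addr]
      rw [show 12 * k + (11 - j) = 12 * k + (11 - (j + 1)) + 1 by omega, mul_add _ _ 1]
      omega
    have hle : E.addr (11 - j) k 0 ≤ E.cap := by
      have := row_addr_le (E := E) (a := 11 - j) (k := k) (by omega) hk
      simp only [Env.addr]
      omega
    have hcap := cap_ge E
    obtain ⟨h1, h2, h3, h4, h5, h6, h7, h8, h9, h10⟩ := hS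
    have hsafe : Safe E.cap (Function.update c.reg (32 + 12 * y + (11 - j)) (E.addr (11 - j) k 0)) :=
      h10.update (by omega) hle
    have hsim' : Sim E s (Function.update c.reg (32 + 12 * y + (11 - j)) (E.addr (11 - j) k 0)) := by
      constructor
      · rw [Function.update_of_ne (by omega)]; exact h1
      · rw [Function.update_of_ne (by omega)]; exact h2
      · rw [Function.update_of_ne (by omega)]; exact h3
      · rw [Function.update_of_ne (by omega)]; exact h4
      · rw [Function.update_of_ne (by omega)]; exact h5
      · intro x hx
        rw [Function.update_of_ne (by omega)]; exact h6 x hx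
      · intro a ha y' hy' hlt
        have : y' ≠ y := fun he => hr (he ▸ hlt)
        rw [Function.update_of_ne (by omega)]
        exact h7 a ha y' hy' hlt
      · intro a' ha' k' hk' c' hc'
        have := addr_ge (E := E) (a := a') (k := k') (c := c')
        rw [Function.update_of_ne (by omega)]
        exact h8 a' ha' k' hk' c' hc'
      · intro j hj
        rw [Function.update_of_ne (by omega)]
        exact h9 j hj
      · exact hsafe
    have hnext : (Instr.add (Atom.pr (11 - (j + 1) + 1) y) (Atom.pr (11 - (j + 1)) y) 1).nextReg c.reg
        = Function.update c.reg (32 + 12 * y + (11 - j)) (E.addr (11 - j) k 0) := by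
      simp only [Instr.nextReg, hval, Atom.pr]
      rw [show 11 - (j + 1) + 1 = 11 - j by omega]
    have hcost := cost_le h10
      (Instr.add (Atom.pr (11 - (j + 1) + 1) y) (Atom.pr (11 - (j + 1)) y) 1)
    obtain ⟨c', hst, hpc, hsm, hout, hcl⟩ := ih (by omega)
      ⟨c.pc + 1, (Instr.add (Atom.pr (11 - (j + 1) + 1) y) (Atom.pr (11 - (j + 1)) y) 1).nextReg
        c.reg, c.out ++ [], c.clock + (Instr.add (Atom.pr (11 - (j + 1) + 1) y)
          (Atom.pr (11 - (j + 1)) y) 1).cost c.reg⟩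
      (by rwa [show 11 - (j + 1) + 1 = 11 - j by omega] at hcode)
      (by rw [hnext]; exact hsim')
      (by
        intro a ha
        rw [hnext]
        by_cases he : a = 11 - j
        · subst he
          simp
        · simp only
          rw [Function.update_of_ne (by omega)]
          exact hp a (by omega))
      hr
    refine ⟨c', Steps.plain h0 trivial h10 hst, by rw [hpc]; simp only; omega, hsm, ?_, ?_⟩
    · rw [hout]; simp
    · simp only [Env.arith] at hcl ⊢
      rw [add_mul, one_mul]
      omega

theorem simulates_plain {E : Env} {M : RAM} {o : ℕ} {I : Instr} {s s' : St}
    (hcode : CodeAt M o [I]) (hI : Plain I)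
    (h : ∀ R, Sim E s R → Sim E s' (I.nextReg R) ∧ s'.out = s.out ++ I.emit R ∧
      I.cost R + s.clock ≤ s'.clock) : Simulates E M o (o + 1) s s' := by
  intro c hpc hs hout
  subst hpc
  obtain ⟨h1, h2, h3⟩ := h _ hs
  refine ⟨_, Steps.plain hcode.cons.1 hI hs.safe (.refl h1.safe), rfl, h1, ?_, ?_⟩
  · rw [h2, hout]
  · simp only
    omega

theorem simulates_row {E : Env} {M : RAM} {o : ℕ} {s : St} {y x : ℕ} (hy : y < 4) (hx : x < 24)
    (hr : s.v x < E.rows) (hcode : CodeAt M o (Atom.row y x).code) :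
    Simulates E M o (o + 13) s ((s.setr y (s.v x)).tick (13 * E.arith)) := by
  intro c hpc hs hout
  subst hpc
  have hcap := cap_ge E
  have hb : E.base + E.width * (12 * s.v x) + E.width ≤ E.cap := by
    simpa using row_addr_le (E := E) (a := 0) (by omega) hr
  have hmul : c.reg (Atom.vr x) * c.reg 3 = E.width * (12 * s.v x) := by
    rw [hs.width12, hs.var x hx]
    ring
  obtain ⟨hc1, hcode⟩ := CodeAt.cons hcode
  obtain ⟨hc2, hcode⟩ := CodeAt.cons hcode
  have hs1 : Sim E s (Function.update c.reg 0 (E.width * (12 * s.v x))) := hs.tmp (by omega)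
  have hsum : Function.update c.reg 0 (E.width * (12 * s.v x)) 2 +
      Function.update c.reg 0 (E.width * (12 * s.v x)) 0 = E.addr 0 (s.v x) 0 := by
    rw [hs1.base]
    simp [Env.addr]
  have hle : E.addr 0 (s.v x) 0 ≤ E.cap := by
    simp only [Env.addr, add_zero]
    omega
  -- While its pointers are being rebuilt, the slot carries the undefined index `E.rows`, so that
  -- `Sim` claims nothing about it.
  have hs2 : Sim E (s.setr y E.rows) (Function.update
      (Function.update c.reg 0 (E.width * (12 * s.v x))) (32 + 12 * y + 0) (E.addr 0 (s.v x) 0)) := by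
    obtain ⟨h1, h2, h3, h4, h5, h6, h7, h8, h9, h10⟩ := hs1
    constructor
    · rw [Function.update_of_ne (by omega)]; exact h1
    · rw [Function.update_of_ne (by omega)]; exact h2
    · rw [Function.update_of_ne (by omega)]; exact h3
    · rw [Function.update_of_ne (by omega)]; exact h4
    · rw [Function.update_of_ne (by omega)]; exact h5
    · intro x hx
      rw [Function.update_of_ne (by omega)]; exact h6 x hx
    · intro a ha y' hy' hlt
      have : y' ≠ y := fun he => by simp [St.setr, he] at hlt
      simp only [St.setr, Function.update_of_ne this] at hlt ⊢
      rw [Function.update_of_ne (by omega)]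
      exact h7 a ha y' hy' hlt
    · intro a' ha' k' hk' c' hc'
      have := addr_ge (E := E) (a := a') (k := k') (c := c')
      rw [Function.update_of_ne (by omega)]
      exact h8 a' ha' k' hk' c' hc'
    · intro j hj
      rw [Function.update_of_ne (by omega)]
      exact h9 j hj
    · exact h10.update (by omega) hle
  have hk1 := cost_le hs.safe (Instr.mul 0 (Atom.vr x) 3)
  have hk2 := cost_le hs1.safe (Instr.add (Atom.pr 0 y) 2 0)
  obtain ⟨c', hst, hpc, hsm, hout', hcl⟩ := steps_row (E := E) (M := M) (s := s.setr y E.rows)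
    (k := s.v x) hy hr 11 le_rfl
    ⟨c.pc + 1 + 1, (Instr.add (Atom.pr 0 y) 2 0).nextReg
        ((Instr.mul 0 (Atom.vr x) 3).nextReg c.reg), c.out ++ [] ++ [], c.clock +
          (Instr.mul 0 (Atom.vr x) 3).cost c.reg + (Instr.add (Atom.pr 0 y) 2 0).cost
            ((Instr.mul 0 (Atom.vr x) 3).nextReg c.reg)⟩
    (by
      rw [List.range_eq_range'] at hcode
      exact hcode)
    (by
      simp only [Instr.nextReg, hmul, hsum]
      exact hs2)
    (by
      intro a ha
      obtain rfl : a = 0 := by omega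
      simp only [Instr.nextReg, hmul, hsum]
      simp [Atom.pr])
    (by simp [St.setr])
  refine ⟨c', ?_, ?_, ?_, ?_, ?_⟩
  · refine Steps.plain hc1 trivial hs.safe ?_
    refine Steps.plain hc2 trivial ?_ hst
    simp only [Instr.nextReg, hmul]
    exact hs1.safe
  · rw [hpc]
  · refine hsm.congr rfl ?_ rfl
    simp [St.setr, St.tick]
  · rw [hout']
    simp [St.tick, St.setr, hout]
  · simp only [Instr.nextReg, hmul] at hcl
    simp only [St.tick, St.setr]
    simp only [Env.arith] at hcl ⊢
    omega

theorem simulates_emit {E : Env} {M : RAM} {o : ℕ} {s : St} {x : ℕ} (hx : x < 24)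
    (hr : s.r 0 < E.rows) (hw : s.v x ≤ E.width) (hcode : CodeAt M o (Atom.emit x).code) :
    Simulates E M o (o + 3) s
      ((s.push ((List.range (s.v x)).map (s.mem 0 (s.r 0)))).tick (3 * E.arith)) := by
  intro c hpc hs hout
  subst hpc
  have hcap := cap_ge E
  have hb := row_addr_le (E := E) (a := 0) (by omega) hr
  obtain ⟨hc1, hcode⟩ := CodeAt.cons hcode
  obtain ⟨hc2, hcode⟩ := CodeAt.cons hcode
  obtain ⟨hc3, -⟩ := CodeAt.cons hcode
  have hp0 : c.reg (Atom.pr 0 0) = E.addr 0 (s.r 0) 0 := hs.ptr 0 (by omega) 0 (by omega) hr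
  have hp : c.reg (Atom.pr 0 0) + c.reg (Atom.vr x) = E.addr 0 (s.r 0) 0 + s.v x := by
    rw [hs.var x hx, hp0]
  have hle : E.addr 0 (s.r 0) 0 + s.v x ≤ E.cap := by
    simp only [Env.addr] at *
    omega
  have hs1 := hs.tmp hle
  have hs2 := hs1.tmp (n := E.addr 0 (s.r 0) 0 + s.v x - 1) (by omega)
  have hsub : Function.update c.reg 0 (E.addr 0 (s.r 0) 0 + s.v x) 0 -
      Function.update c.reg 0 (E.addr 0 (s.r 0) 0 + s.v x) 5 = E.addr 0 (s.r 0) 0 + s.v x - 1 := by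
    rw [hs1.one]
    simp
  have hk1 := cost_le hs.safe (Instr.add 0 (Atom.pr 0 0) (Atom.vr x))
  have hk2 := cost_le hs1.safe (Instr.sub 0 0 5)
  refine ⟨_, Steps.plain hc1 trivial hs.safe (Steps.plain hc2 trivial ?_
    (Steps.plain hc3 trivial ?_ (.refl ?_))), rfl, ?_, ?_, ?_⟩
  · simp only [Instr.nextReg, hp]
    exact hs1.safe
  · simp only [Instr.nextReg, hp, hsub]
    exact hs2.safe
  · simp only [Instr.nextReg, hp, hsub]
    exact hs2.safe
  · simp only [Instr.nextReg, hp, hsub]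
    exact hs2.congr rfl rfl rfl
  · simp only [Instr.nextReg, hp, hsub, Instr.emit, hout, St.push, St.tick, List.append_nil]
    have hg := addr_ge (E := E) (a := 0) (k := s.r 0) (c := 0)
    have e1 := hs2.ptr 0 (by omega) 0 (by omega) hr
    simp only [mul_zero, add_zero] at e1
    -- The output instruction includes both ends, so the last address is one less than the sum.
    -- Addresses of rows are at least 82, so nothing is truncated, even for the empty word.
    have e2 : E.addr 0 (s.r 0) 0 + s.v x - 1 + 1 - E.addr 0 (s.r 0) 0 = s.v x := by omega
    rw [show Atom.pr 0 0 = 32 from rfl, e1, Function.update_self, e2, List.range'_eq_map_range,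
      List.map_map]
    congr 2
    refine List.map_congr_left fun j hj => ?_
    rw [List.mem_range] at hj
    have := hs2.mem 0 (by omega) _ hr j (by omega)
    rw [← this]
    simp [Env.addr]
  · simp only [Instr.nextReg, hp, Env.arith, St.tick, St.push, Instr.cost] at *
    omega

theorem simulates_atom {E : Env} {M : RAM} {o : ℕ} {s : St} {A : Atom} (hA : A.ok E s)
    (hwf : A.wf) (hcode : CodeAt M o A.code) : Simulates E M o (o + A.code.length) s (A.next E s) := by
  have hcap := cap_ge E
  cases A with
  | const x c =>
    simp only [Atom.wf, decide_eq_true_eq] at hwf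
    simp only [Atom.ok] at hA
    refine simulates_plain hcode trivial fun R hs => ⟨hs.setv hwf (by omega), ?_, ?_⟩
    · simp [Atom.next, St.tick, St.setv, Instr.emit]
    · simp [Atom.next, St.tick, St.setv, Instr.cost, add_comm]
  | copy x y =>
    simp only [Atom.wf, Bool.and_eq_true, decide_eq_true_eq] at hwf
    refine simulates_plain hcode trivial fun R hs => ⟨?_, ?_, ?_⟩
    · have := hs.setv (k := 1) hwf.1 (hs.safe (Atom.vr y)).1
      rw [hs.var y hwf.2] at this
      simp only [Instr.nextReg, Atom.vr, hs.var y hwf.2] at this ⊢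
      exact this
    · simp [Atom.next, St.tick, St.setv, Instr.emit]
    · simp [Atom.next, St.tick, St.setv, Instr.cost, add_comm]
  | add x y z =>
    simp only [Atom.wf, Bool.and_eq_true, decide_eq_true_eq] at hwf
    simp only [Atom.ok] at hA
    refine simulates_plain hcode trivial fun R hs => ⟨?_, ?_, ?_⟩
    · have := hs.setv (k := E.arith) hwf.1.1 hA
      simp only [Instr.nextReg, Atom.vr, hs.var y hwf.1.2, hs.var z hwf.2] at this ⊢
      exact this
    · simp [Atom.next, St.tick, St.setv, Instr.emit]
    · have := cost_le hs.safe (.add (Atom.vr x) (Atom.vr y) (Atom.vr z))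
      simp only [Atom.next, St.tick, St.setv, Env.arith]
      omega
  | sub x y z =>
    simp only [Atom.wf, Bool.and_eq_true, decide_eq_true_eq] at hwf
    refine simulates_plain hcode trivial fun R hs => ⟨?_, ?_, ?_⟩
    · have h1 := (hs.safe (Atom.vr y)).1
      rw [hs.var y hwf.1.2] at h1
      have := hs.setv (k := E.arith) (n := s.v y - s.v z) hwf.1.1 (by omega)
      simp only [Instr.nextReg, Atom.vr, hs.var y hwf.1.2, hs.var z hwf.2] at this ⊢
      exact this
    · simp [Atom.next, St.tick, St.setv, Instr.emit]
    · have := cost_le hs.safe (.sub (Atom.vr x) (Atom.vr y) (Atom.vr z))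
      simp only [Atom.next, St.tick, St.setv, Env.arith]
      omega
  | row y x =>
    simp only [Atom.wf, Bool.and_eq_true, decide_eq_true_eq] at hwf
    exact simulates_row hwf.1 hwf.2 hA hcode
  | load x a y z =>
    simp only [Atom.wf, Bool.and_eq_true, decide_eq_true_eq] at hwf
    obtain ⟨⟨⟨hx, ha⟩, hy⟩, hz⟩ := hwf
    simp only [Atom.ok] at hA
    refine simulates_plain hcode trivial fun R hs => ⟨?_, ?_, ?_⟩
    · have e : R (R (Atom.pr a y) + R (Atom.vr z)) = s.mem a (s.r y) (s.v z) := by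
        rw [hs.ptr a ha y hy hA.1, hs.var z hz, ← hs.mem a ha _ hA.1 _ hA.2]
        simp [Env.addr]
      have := hs.setv (k := 1) hx (hs.safe (R (Atom.pr a y) + R (Atom.vr z))).1
      simp only [Instr.nextReg]
      rw [e] at this ⊢
      exact this
    · simp [Atom.next, St.tick, St.setv, Instr.emit]
    · simp [Atom.next, St.tick, St.setv, Instr.cost, add_comm]
  | store a y z x =>
    simp only [Atom.wf, Bool.and_eq_true, decide_eq_true_eq] at hwf
    obtain ⟨⟨⟨hx, ha⟩, hy⟩, hz⟩ := hwf
    simp only [Atom.ok] at hA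
    refine simulates_plain hcode trivial fun R hs => ⟨?_, ?_, ?_⟩
    · have e : R (Atom.pr a y) + R (Atom.vr z) = E.addr a (s.r y) (s.v z) := by
        rw [hs.ptr a (by omega) y (by omega) hA.1, hs.var z (by omega)]
        simp [Env.addr]
      have hn := (hs.safe (Atom.vr x)).1
      have := hs.setm (j := 1) (a := a) (by omega) hA.1 hA.2 hn
      simp only [Instr.nextReg]
      rw [e]
      rw [hs.var x (by omega)] at this ⊢
      exact this
    · simp [Atom.next, St.tick, St.setm, Instr.emit]
    · simp [Atom.next, St.tick, St.setm, Instr.cost, add_comm]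
  | input x y =>
    simp only [Atom.wf, Bool.and_eq_true, decide_eq_true_eq] at hwf
    simp only [Atom.ok] at hA
    refine simulates_plain hcode trivial fun R hs => ⟨?_, ?_, ?_⟩
    · have e : R (R 4 + R (Atom.vr y)) = E.inp (s.v y) := by
        rw [hs.inpBase, hs.var y hwf.2, hs.inp _ hA]
      have := hs.setv (k := 1) hwf.1 (hs.safe (R 4 + R (Atom.vr y))).1
      simp only [Instr.nextReg]
      rw [e] at this ⊢
      exact this
    · simp [Atom.next, St.tick, St.setv, Instr.emit]
    · simp [Atom.next, St.tick, St.setv, Instr.cost, add_comm]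
  | emit x =>
    simp only [Atom.wf, decide_eq_true_eq] at hwf
    exact simulates_emit hwf hA.1 hA.2 hcode

theorem Simulates.trans {E : Env} {M : RAM} {o p q : ℕ} {s t u : St} (h : Simulates E M o p s t)
    (h' : Simulates E M p q t u) : Simulates E M o q s u := by
  intro c hpc hs hout
  obtain ⟨d, h1, h2, h3, h4, h5⟩ := h c hpc hs hout
  obtain ⟨e, g1, g2, g3, g4, g5⟩ := h' d h2 h3 h4
  exact ⟨e, h1.trans g1, g2, g3, g4, by omega⟩

/-- A jump, possibly conditional, from position `o` to position `o'`. -/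
theorem simulates_jump {E : Env} {M : RAM} {o o' : ℕ} {I : Instr} {s : St}
    (hI : M.code[o]? = some I) (hj : ∀ R, Sim E s R → I.nextPc R o = o' ∧ I.nextReg R = R ∧
      I.emit R = [] ∧ I.cost R = 1) (hne : I ≠ .halt) : Simulates E M o o' s (s.tick 1) := by
  intro c hpc hs hout
  obtain ⟨hj1, hj2, hj3, hj4⟩ := hj _ hs
  have hstep : M.step c = ⟨o', c.reg, c.out, c.clock + 1⟩ := by
    subst hpc
    unfold RAM.step
    rw [hI]
    cases I <;> simp_all
  refine ⟨_, Steps.head hs.safe (.refl ?_), ?_⟩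
  · rw [hstep]
    exact hs.safe
  · rw [hstep]
    refine ⟨rfl, hs.congr rfl rfl rfl, hout, ?_⟩
    simp only [St.tick]
    omega

/-- Time is bounded only from above, so ticks charged in advance may be left unspent; this serves
the branch of a conditional that needs no closing jump. -/
theorem Simulates.slack {E : Env} {M : RAM} {o p : ℕ} {s t : St} {k : ℕ}
    (h : Simulates E M o p (s.tick k) t) : Simulates E M o p s t := by
  intro c hpc hs hout
  obtain ⟨d, h1, h2, h3, h4, h5⟩ := h c hpc (hs.congr rfl rfl rfl) hout
  simp only [St.tick] at h5
  exact ⟨d, h1, h2, h3, h4, by omega⟩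

/-- The tick charged in advance pays for the jump at the end. -/
theorem Simulates.then_jump {E : Env} {M : RAM} {o p q : ℕ} {s t : St}
    (h : Simulates E M o p (s.tick 1) t) (hI : M.code[p]? = some (.jump q)) :
    Simulates E M o q s t := by
  intro c hpc hs hout
  obtain ⟨d, h1, h2, h3, h4, h5⟩ := h c hpc (hs.congr rfl rfl rfl) hout
  obtain ⟨e, g1, g2, g3, g4, g5⟩ := simulates_jump hI (fun R _ => ⟨rfl, rfl, rfl, rfl⟩) (by simp)
    d h2 h3 h4
  refine ⟨e, h1.trans g1, g2, g3.congr rfl rfl rfl, g4, ?_⟩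
  simp only [St.tick] at h5 g5
  omega

/-- Induction on the execution; a further round of a loop runs the same code again. All intermediate
registers are `Safe`, so time and space bounds are transferred together. -/
theorem simulates {E : Env} {c : Cmd} {s t : St} (h : Exec E c s t) :
    ∀ (M : RAM) (o : ℕ), c.wf → CodeAt M o (c.code o) → Simulates E M o (o + c.len) s t := by
  induction h with
  | atom hA =>
    intro M o hwf hcode
    exact simulates_atom hA hwf hcode
  | seq _ _ ih ih' =>
    intro M o hwf hcode
    simp only [Cmd.wf, Bool.and_eq_true] at hwf
    obtain ⟨h1, h2⟩ := CodeAt.append hcode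
    rw [Cmd.length_code] at h2
    have := (ih M o hwf.1 h1).trans (ih' M _ hwf.2 h2)
    rwa [add_assoc] at this
  | @iteT x y c d s t hlt _ ih =>
    intro M o hwf hcode
    simp only [Cmd.wf, Bool.and_eq_true, decide_eq_true_eq] at hwf
    obtain ⟨h1, hcode⟩ := CodeAt.cons hcode
    obtain ⟨h2, hcode⟩ := CodeAt.append hcode
    obtain ⟨h3, hcode⟩ := CodeAt.cons hcode
    rw [Cmd.length_code] at hcode h3
    have := ih M _ hwf.1.2 hcode
    rw [show o + 1 + d.len + 1 + c.len = o + (1 + d.len + 1 + c.len) by omega] at this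
    refine (simulates_jump h1 (fun R hs => ⟨?_, rfl, rfl, rfl⟩) (by simp)).trans
      (Simulates.slack (k := 1) this)
    simp only [Instr.nextPc, Atom.vr]
    rw [hs.var x hwf.1.1.1, hs.var y hwf.1.1.2, if_pos hlt]
  | @iteF x y c d s t hlt _ ih =>
    intro M o hwf hcode
    simp only [Cmd.wf, Bool.and_eq_true, decide_eq_true_eq] at hwf
    obtain ⟨h1, hcode⟩ := CodeAt.cons hcode
    obtain ⟨h2, hcode⟩ := CodeAt.append hcode
    obtain ⟨h3, hcode⟩ := CodeAt.cons hcode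
    rw [Cmd.length_code] at hcode h3
    rw [show o + 1 + d.len + 1 + c.len = o + (1 + d.len + 1 + c.len) by omega] at h3
    refine (simulates_jump h1 (fun R hs => ⟨?_, rfl, rfl, rfl⟩) (by simp)).trans
      (Simulates.then_jump (s := s.tick 1) (ih M _ hwf.2 h2) h3)
    simp only [Instr.nextPc, Atom.vr]
    rw [hs.var x hwf.1.1.1, hs.var y hwf.1.1.2, if_neg hlt]
  | @loopT x y c s t u hlt _ _ ih ih' =>
    intro M o hwf hcode
    have hrest := ih' M o hwf hcode
    simp only [Cmd.wf, Bool.and_eq_true, decide_eq_true_eq] at hwf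
    obtain ⟨h1, hcode⟩ := CodeAt.cons hcode
    obtain ⟨h2, hcode⟩ := CodeAt.cons hcode
    obtain ⟨h3, hcode⟩ := CodeAt.append hcode
    rw [Cmd.length_code] at hcode
    refine ((simulates_jump h1 (fun R hs => ⟨?_, rfl, rfl, rfl⟩) (by simp)).trans
      (Simulates.then_jump (s := s.tick 1) (ih M _ hwf.2 h3) hcode.cons.1)).trans hrest
    simp only [Instr.nextPc, Atom.vr]
    rw [hs.var x hwf.1.1, hs.var y hwf.1.2, if_pos hlt]
  | @loopF x y c s hlt =>
    intro M o hwf hcode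
    simp only [Cmd.wf, Bool.and_eq_true, decide_eq_true_eq] at hwf
    obtain ⟨h1, hcode⟩ := CodeAt.cons hcode
    obtain ⟨h2, hcode⟩ := CodeAt.cons hcode
    rw [show o + 2 + c.len + 1 = o + (2 + c.len + 1) by omega] at h2
    refine (simulates_jump (o' := o + 1) h1 (fun R hs => ⟨?_, rfl, rfl, rfl⟩) (by simp)).trans
      (simulates_jump (s := s.tick 1) h2 (fun R hs => ⟨rfl, rfl, rfl, rfl⟩) (by simp))
    simp only [Instr.nextPc, Atom.vr]
    rw [hs.var x hwf.1.1, hs.var y hwf.1.2, if_neg hlt]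

end While

/-! ### Enumeration of the models of a monotone formula by suffix classes -/

namespace Monotone

/-- The rows `t` and `u` agree from position `i` on. -/
def SameFrom (n : ℕ) (b : ℕ → ℕ → ℕ) (i t u : ℕ) : Prop := ∀ j, j < n → i ≤ j → b t j = b u j

instance (n : ℕ) (b : ℕ → ℕ → ℕ) (i t u : ℕ) : Decidable (SameFrom n b i t u) :=
  inferInstanceAs (Decidable (∀ j, j < n → i ≤ j → b t j = b u j))

/-- Search among the rows `1, …, j` for a row that has a positive entry at `i` and agrees with
`t` after `i`. -/
def repAux (n : ℕ) (b : ℕ → ℕ → ℕ) (prev : ℕ → ℕ) (i t : ℕ) : ℕ → ℕ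
  | 0 => prev t
  | j + 1 => if SameFrom n b (i + 1) t (j + 1) ∧ 0 < b (j + 1) i then prev (j + 1)
      else repAux n b prev i t j

/-- Representative of the class of the rows that agree with `t` from position `i` on. -/
def rep (n m : ℕ) (b : ℕ → ℕ → ℕ) : ℕ → ℕ → ℕ
  | 0 => id
  | i + 1 => fun t => repAux n b (rep n m b i) i t m

/-- The first position from `i` on where row `t` has entry `0`, and `n` if there is none. -/
def nextZero (n : ℕ) (b : ℕ → ℕ → ℕ) (t i : ℕ) : ℕ :=
  if i < n then if b t i = 0 then i else nextZero n b t (i + 1) else n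
termination_by n - i

/-- The rows of `A` with entry `0` at position `i`. -/
def zeros (b : ℕ → ℕ → ℕ) (i : ℕ) (A : Finset ℕ) : Finset ℕ := A.filter fun t => b t i = 0

/-- Representatives after position `i` of the rows of `A` with entry `0` there. -/
def down (n m : ℕ) (b : ℕ → ℕ → ℕ) (i : ℕ) (A : Finset ℕ) : Finset ℕ :=
  (zeros b i A).image (rep n m b (i + 1))

/-- Representatives after position `i` of the rows of `A`. -/
def rest (n m : ℕ) (b : ℕ → ℕ → ℕ) (i : ℕ) (A : Finset ℕ) : Finset ℕ :=
  (A \ zeros b i A) ∪ down n m b i A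

/-- The assignments below `α` from position `i` on that differ from `α` and lie above a row
of `A`. -/
def words (n m : ℕ) (b : ℕ → ℕ → ℕ) : ℕ → ℕ → Finset ℕ → (ℕ → ℕ) → List (ℕ → ℕ)
  | 0, _, _, _ => []
  | f + 1, i, A, α =>
    if zeros b i A = ∅ then words n m b f (i + 1) A α
    else Function.update α i 0 :: (words n m b f (i + 1) (down n m b i A) (Function.update α i 0) ++
      words n m b f (i + 1) (rest n m b i A) α)

/-- Length of `words`. -/
def count (n m : ℕ) (b : ℕ → ℕ → ℕ) : ℕ → ℕ → Finset ℕ → ℕ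
  | 0, _, _ => 0
  | f + 1, i, A =>
    if zeros b i A = ∅ then count n m b f (i + 1) A
    else 1 + count n m b f (i + 1) (down n m b i A) + count n m b f (i + 1) (rest n m b i A)

/-- Number of rows handled while `words` is computed. -/
def work (n m : ℕ) (b : ℕ → ℕ → ℕ) : ℕ → ℕ → Finset ℕ → ℕ
  | 0, _, _ => 0
  | f + 1, i, A =>
    if zeros b i A = ∅ then work n m b f (i + 1) A
    else (zeros b i A).card + work n m b f (i + 1) (down n m b i A) +
      work n m b f (i + 1) (rest n m b i A)

/-- All elements of `A` represent their classes at position `i`. -/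
def Canonical (n m : ℕ) (b : ℕ → ℕ → ℕ) (i : ℕ) (A : Finset ℕ) : Prop :=
  ∀ t ∈ A, 1 ≤ t ∧ t ≤ m ∧ rep n m b i t = t

/-! ### Suffix classes and their representatives -/

variable {n m : ℕ} {b : ℕ → ℕ → ℕ}

theorem SameFrom.symm {i t u : ℕ} (h : SameFrom n b i t u) : SameFrom n b i u t :=
  fun j hj hi => (h j hj hi).symm

theorem SameFrom.trans {i t u v : ℕ} (h : SameFrom n b i t u) (h' : SameFrom n b i u v) :
    SameFrom n b i t v := fun j hj hi => (h j hj hi).trans (h' j hj hi)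

theorem SameFrom.refl {i t : ℕ} : SameFrom n b i t t := fun _ _ _ => rfl

theorem SameFrom.succ {i t u : ℕ} (h : SameFrom n b i t u) : SameFrom n b (i + 1) t u :=
  fun j hj hi => h j hj (by omega)

theorem SameFrom.of_succ {i t u : ℕ} (h : SameFrom n b (i + 1) t u) (h' : b t i = b u i) :
    SameFrom n b i t u := fun j hj hi => by
  rcases Nat.eq_or_lt_of_le hi with rfl | hlt
  · exact h'
  · exact h j hj hlt

theorem repAux_spec (prev : ℕ → ℕ) (i t j : ℕ) :
    (∃ u, 1 ≤ u ∧ u ≤ j ∧ SameFrom n b (i + 1) t u ∧ 0 < b u i ∧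
      repAux n b prev i t j = prev u) ∨
    ((∀ u, 1 ≤ u → u ≤ j → SameFrom n b (i + 1) t u → ¬ 0 < b u i) ∧
      repAux n b prev i t j = prev t) := by
  induction j with
  | zero => exact .inr ⟨fun u h1 h2 => by omega, rfl⟩
  | succ j ih =>
    by_cases h : SameFrom n b (i + 1) t (j + 1) ∧ 0 < b (j + 1) i
    · exact .inl ⟨j + 1, by omega, le_rfl, h.1, h.2, by simp only [repAux, if_pos h]⟩
    · simp only [repAux, if_neg h]
      rcases ih with ⟨u, h1, h2, h3⟩ | ⟨h1, h2⟩
      · exact .inl ⟨u, h1, by omega, h3⟩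
      · refine .inr ⟨fun u hu hu' hs => ?_, h2⟩
        rcases Nat.eq_or_lt_of_le hu' with rfl | hlt
        · exact fun h0 => h ⟨hs, h0⟩
        · exact h1 u hu (by omega) hs

theorem rep_spec (i t : ℕ) :
    (∃ u, 1 ≤ u ∧ u ≤ m ∧ SameFrom n b (i + 1) t u ∧ 0 < b u i ∧
      rep n m b (i + 1) t = rep n m b i u) ∨
    ((∀ u, 1 ≤ u → u ≤ m → SameFrom n b (i + 1) t u → ¬ 0 < b u i) ∧
      rep n m b (i + 1) t = rep n m b i t) :=
  repAux_spec _ _ _ _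

theorem rep_mem (i : ℕ) {t : ℕ} (h1 : 1 ≤ t) (hm : t ≤ m) :
    1 ≤ rep n m b i t ∧ rep n m b i t ≤ m := by
  induction i generalizing t with
  | zero => exact ⟨h1, hm⟩
  | succ i ih =>
    rcases rep_spec (n := n) (m := m) (b := b) i t with ⟨u, h1', h2', -, -, he⟩ | ⟨-, he⟩
    · rw [he]; exact ih h1' h2'
    · rw [he]; exact ih h1 hm

theorem rep_same (i t : ℕ) : SameFrom n b i (rep n m b i t) t := by
  induction i generalizing t with
  | zero => exact .refl
  | succ i ih =>
    rcases rep_spec (n := n) (m := m) (b := b) i t with ⟨u, -, -, hs, -, he⟩ | ⟨-, he⟩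
    · rw [he]; exact (ih u).succ.trans hs.symm
    · rw [he]; exact (ih t).succ

/-- The rows `1, …, m` are distinct and consist of bits. -/
structure Rows (n m : ℕ) (b : ℕ → ℕ → ℕ) : Prop where
  le_one : ∀ t j, b t j ≤ 1
  inj : ∀ t u, 1 ≤ t → t ≤ m → 1 ≤ u → u ≤ m → SameFrom n b 0 t u → t = u

/-- Rows with equal suffixes after `i` have the same candidates with entry 1 at `i`, and all
candidates agree from `i` on. If there is no candidate, both rows have entry 0 at `i`. The induction
starts from the distinctness of the rows. -/
theorem Rows.rep_congr (hR : Rows n m b) (i : ℕ) {t u : ℕ} (ht : 1 ≤ t) (htm : t ≤ m) (hu : 1 ≤ u)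
    (hum : u ≤ m) (h : SameFrom n b i t u) : rep n m b i t = rep n m b i u := by
  induction i generalizing t u with
  | zero => exact hR.inj t u ht htm hu hum h
  | succ i ih =>
    rcases rep_spec (n := n) (m := m) (b := b) i t with ⟨v, hv, hvm, hs, h0, he⟩ | ⟨hno, he⟩ <;>
    rcases rep_spec (n := n) (m := m) (b := b) i u with ⟨w, hw, hwm, hs', h0', he'⟩ | ⟨hno', he'⟩
    · rw [he, he']
      refine ih hv hvm hw hwm (.of_succ ((hs.symm.trans h).trans hs') ?_)
      have := hR.le_one v i
      have := hR.le_one w i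
      omega
    · exact absurd h0 (hno' v hv hvm (h.symm.trans hs))
    · exact absurd h0' (hno w hw hwm (h.trans hs'))
    · rw [he, he']
      refine ih ht htm hu hum (.of_succ h ?_)
      have := hno t ht htm .refl
      have := hno' u hu hum .refl
      omega

/-- This is why `repAux` prefers entry 1: the row it finds agrees with `t` from `i` on and so has
the same representative at `i`. Rows with entry 1 thus need no attention when the position advances.
-/
theorem Rows.rep_keep (hR : Rows n m b) {i t : ℕ} (ht : 1 ≤ t) (htm : t ≤ m)
    (h : rep n m b i t = t) (h0 : 0 < b t i) : rep n m b (i + 1) t = t := by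
  rcases rep_spec (n := n) (m := m) (b := b) i t with ⟨v, hv, hvm, hs, h0', he⟩ | ⟨hno, he⟩
  · rw [he, ← hR.rep_congr i ht htm hv hvm (.of_succ hs ?_), h]
    have := hR.le_one v i
    have := hR.le_one t i
    omega
  · exact absurd h0 (hno t ht htm .refl)

theorem mem_zeros {i t : ℕ} {A : Finset ℕ} : t ∈ zeros b i A ↔ t ∈ A ∧ b t i = 0 := by
  simp [zeros]

theorem mem_down {i u : ℕ} {A : Finset ℕ} :
    u ∈ down n m b i A ↔ ∃ t ∈ A, b t i = 0 ∧ rep n m b (i + 1) t = u := by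
  simp [down, mem_zeros, and_assoc]

theorem mem_rest {i u : ℕ} {A : Finset ℕ} :
    u ∈ rest n m b i A ↔ (u ∈ A ∧ b u i ≠ 0) ∨ u ∈ down n m b i A := by
  simp only [rest, Finset.mem_union, Finset.mem_sdiff, mem_zeros]
  tauto

theorem Rows.canonical_down (hR : Rows n m b) {i : ℕ} {A : Finset ℕ}
    (hA : Canonical n m b i A) : Canonical n m b (i + 1) (down n m b i A) := by
  intro u hu
  obtain ⟨t, ht, -, rfl⟩ := mem_down.1 hu
  obtain ⟨h1, h2, -⟩ := hA t ht
  have := rep_mem (n := n) (b := b) (i + 1) h1 h2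
  exact ⟨this.1, this.2, hR.rep_congr _ this.1 this.2 h1 h2 (rep_same _ _)⟩

theorem Rows.canonical_rest (hR : Rows n m b) {i : ℕ} {A : Finset ℕ}
    (hA : Canonical n m b i A) : Canonical n m b (i + 1) (rest n m b i A) := by
  intro u hu
  rcases mem_rest.1 hu with ⟨hu, h0⟩ | hu
  · obtain ⟨h1, h2, h3⟩ := hA u hu
    exact ⟨h1, h2, hR.rep_keep h1 h2 h3 (by omega)⟩
  · exact hR.canonical_down hA u hu

theorem Rows.canonical_succ (hR : Rows n m b) {i : ℕ} {A : Finset ℕ}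
    (hA : Canonical n m b i A) (h : zeros b i A = ∅) : Canonical n m b (i + 1) A := by
  intro u hu
  obtain ⟨h1, h2, h3⟩ := hA u hu
  refine ⟨h1, h2, hR.rep_keep h1 h2 h3 (Nat.pos_of_ne_zero fun h0 => ?_)⟩
  have := mem_zeros.2 ⟨hu, h0⟩
  simp [h] at this

theorem Rows.eq_of_canonical (hR : Rows n m b) {i t u : ℕ} {A : Finset ℕ}
    (hA : Canonical n m b i A) (ht : t ∈ A) (hu : u ∈ A) (h : SameFrom n b i t u) : t = u := by
  obtain ⟨h1, h2, h3⟩ := hA t ht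
  obtain ⟨g1, g2, g3⟩ := hA u hu
  rw [← h3, ← g3, hR.rep_congr i h1 h2 g1 g2 h]

/-- The suffixes from `i` on are different and both start with 0, so they differ after `i`: merging
happens only between a row with entry 0 and a row with entry 1. -/
theorem Rows.rep_injOn (hR : Rows n m b) {i t u : ℕ} {A : Finset ℕ}
    (hA : Canonical n m b i A) (ht : t ∈ zeros b i A) (hu : u ∈ zeros b i A)
    (h : rep n m b (i + 1) t = rep n m b (i + 1) u) : t = u := by
  rw [mem_zeros] at ht hu
  refine hR.eq_of_canonical hA ht.1 hu.1 (.of_succ ?_ (ht.2.trans hu.2.symm))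
  have h1 := rep_same (n := n) (m := m) (b := b) (i + 1) t
  rw [h] at h1
  exact h1.symm.trans (rep_same (i + 1) u)

theorem Rows.card_down (hR : Rows n m b) {i : ℕ} {A : Finset ℕ}
    (hA : Canonical n m b i A) : (down n m b i A).card = (zeros b i A).card :=
  Finset.card_image_of_injOn fun _ ht _ hu h => hR.rep_injOn hA ht hu h

theorem card_sdiff_zeros {i : ℕ} {A : Finset ℕ} :
    (A \ zeros b i A).card + (zeros b i A).card = A.card :=
  Finset.card_sdiff_add_card_eq_card (Finset.filter_subset _ _)

theorem Rows.card_rest_le (hR : Rows n m b) {i : ℕ} {A : Finset ℕ}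
    (hA : Canonical n m b i A) : (rest n m b i A).card ≤ A.card := by
  rw [← card_sdiff_zeros (b := b) (i := i) (A := A), ← hR.card_down hA]
  exact Finset.card_union_le _ _

theorem card_down_le_card_rest {i : ℕ} {A : Finset ℕ} :
    (down n m b i A).card ≤ (rest n m b i A).card :=
  Finset.card_le_card Finset.subset_union_right

theorem card_sdiff_le_card_rest {i : ℕ} {A : Finset ℕ} :
    (A \ zeros b i A).card ≤ (rest n m b i A).card :=
  Finset.card_le_card Finset.subset_union_left

theorem down_nonempty {i : ℕ} {A : Finset ℕ} (h : zeros b i A ≠ ∅) :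
    (down n m b i A).Nonempty :=
  (Finset.nonempty_iff_ne_empty.2 h).image _

theorem rest_nonempty {i : ℕ} {A : Finset ℕ} (h : zeros b i A ≠ ∅) :
    (rest n m b i A).Nonempty :=
  (down_nonempty h).mono Finset.subset_union_right

/-! ### Numbers of words and of handled rows -/

theorem length_words (f i : ℕ) (A : Finset ℕ) (α : ℕ → ℕ) :
    (words n m b f i A α).length = count n m b f i A := by
  induction f generalizing i A α with
  | zero => rfl
  | succ f ih =>
    simp only [words, count]
    split_ifs
    · exact ih ..
    · simp [ih]; omega

/-- The branch with value 0 receives as many rows as have entry 0, and the branch with value 1 at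
least those with entry 1. Of the two summands 1 from the induction, one is paid by the word output
here. After the last position only one suffix is left. -/
theorem Rows.card_le (hR : Rows n m b) (f : ℕ) : ∀ (i : ℕ) (A : Finset ℕ), i + f = n →
    Canonical n m b i A → A.card ≤ count n m b f i A + 1 := by
  induction f with
  | zero =>
    intro i A hi hA
    refine Finset.card_le_one.2 fun t ht u hu => hR.eq_of_canonical hA ht hu fun j hj hij => ?_
    omega
  | succ f ih =>
    intro i A hi hA
    simp only [count]
    split_ifs with h
    · exact ih _ _ (by omega) (hR.canonical_succ hA h)
    · have h1 := ih (i + 1) _ (by omega) (hR.canonical_down hA)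
      have h2 := ih (i + 1) _ (by omega) (hR.canonical_rest hA)
      have := hR.card_down hA
      have := card_sdiff_zeros (b := b) (i := i) (A := A)
      have := card_sdiff_le_card_rest (n := n) (m := m) (b := b) (i := i) (A := A)
      omega

/-- Bernoulli's inequality for exponents in [0, 1], in the form 2 ^ x ≤ 1 + x. -/
theorem le_logb_add_one {x : ℝ} (h0 : 0 ≤ x) (h1 : x ≤ 1) : x ≤ Real.logb 2 (1 + x) := by
  rw [Real.le_logb_iff_rpow_le (by norm_num) (by linarith)]
  have := rpow_one_add_le_one_add_mul_self (s := 1) (by norm_num) h0 h1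
  norm_num at this
  exact this

/-- For `y ≤ x` this is log₂ (1 + z) ≥ z with z = y / x in [0, 1]; for `y ≥ x` the logarithm grows
by at least 1 and `L ≥ x`. -/
theorem log_gain {x y L : ℝ} (hx : 0 < x) (hy : 0 ≤ y) (hL : x ≤ L) :
    min x y ≤ L * (Real.logb 2 (x + y) - Real.logb 2 x) := by
  rw [← Real.logb_div (by positivity) hx.ne', add_div, div_self hx.ne']
  rcases le_total y x with h | h
  · rw [min_eq_right h]
    have h1 : y / x ≤ 1 := (div_le_one hx).2 h
    have h2 := le_logb_add_one (div_nonneg hy hx.le) h1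
    calc y = x * (y / x) := by field_simp
      _ ≤ L * (y / x) := by gcongr
      _ ≤ _ := by gcongr; linarith
  · rw [min_eq_left h]
    have h1 : (1 : ℝ) ≤ Real.logb 2 (1 + y / x) := by
      rw [Real.le_logb_iff_rpow_le (by norm_num) (by positivity)]
      have := (one_le_div hx).2 h
      norm_num
      linarith
    nlinarith

/-- Let `x` and `y` count the rows with entry 0 and 1 at `i`, and `r` the rows of the branch with
value 1. The two inductive bounds leave `x + y - r` to be paid, which is at most `min x y` since `r`
is at least `x` and `y`. By `Rows.card_le`, `x ≤ 1 + c`, so `log_gain` applies with `L = 1 + c`. The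
summand `A.card` on the left is what makes the induction close. -/
theorem Rows.work_le (hR : Rows n m b) (f : ℕ) : ∀ (i : ℕ) (A : Finset ℕ), i + f = n →
    Canonical n m b i A → A.Nonempty → (work n m b f i A : ℝ) + A.card ≤
      (1 + count n m b f i A) * (1 + Real.logb 2 A.card) := by
  induction f with
  | zero =>
    intro i A hi hA hne
    have h1 := hR.card_le 0 i A hi hA
    have h2 := hne.card_pos
    simp only [count] at h1
    -- No position is left, so all suffixes coincide.
    have : A.card = 1 := by omega
    simp [work, count, this]
  | succ f ih =>
    intro i A hi hA hne
    simp only [count, work]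
    split_ifs with h
    · exact ih _ _ (by omega) (hR.canonical_succ hA h) hne
    · have hd := hR.canonical_down hA
      have hr := hR.canonical_rest hA
      have h1 := ih (i + 1) _ (by omega) hd (down_nonempty h)
      have h2 := ih (i + 1) _ (by omega) hr (rest_nonempty h)
      have hc := hR.card_le f (i + 1) _ (by omega) hd
      have hcd := hR.card_down hA
      have hs := card_sdiff_zeros (b := b) (i := i) (A := A)
      have h3 := card_sdiff_le_card_rest (n := n) (m := m) (b := b) (i := i) (A := A)
      have h4 := card_down_le_card_rest (n := n) (m := m) (b := b) (i := i) (A := A)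
      have h5 := hR.card_rest_le hA
      have h6 := (down_nonempty (n := n) (m := m) h).card_pos
      set x := (down n m b i A).card
      set r := (rest n m b i A).card
      set y := (A \ zeros b i A).card
      set c := count n m b f (i + 1) (down n m b i A)
      set d := count n m b f (i + 1) (rest n m b i A)
      rw [← hcd] at hs ⊢
      have hA' : (A.card : ℝ) = x + y := by
        rw [← hs]
        push_cast
        ring
      have hgain := log_gain (x := x) (y := y) (L := 1 + c) (by exact_mod_cast h6) (by positivity)
        (by
          have : (x : ℝ) ≤ c + 1 := by exact_mod_cast hc
          linarith)
      have hrest : Real.logb 2 r ≤ Real.logb 2 (x + y) := by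
        rw [← hA']
        apply Real.logb_le_logb_of_le (by norm_num)
        · exact_mod_cast h6.trans_le h4
        · exact_mod_cast h5
      have hmin : (x : ℝ) + y ≤ min (x : ℝ) y + r := by
        have h3' : (y : ℝ) ≤ r := by exact_mod_cast h3
        have h4' : (x : ℝ) ≤ r := by exact_mod_cast h4
        rcases le_total (x : ℝ) y with hxy | hxy
        · rw [min_eq_left hxy]; linarith
        · rw [min_eq_right hxy]; linarith
      have hmul : (1 + d : ℝ) * Real.logb 2 r ≤ (1 + d) * Real.logb 2 (x + y) := by gcongr
      rw [hA']
      push_cast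
      nlinarith

/-! ### The listed words are the required ones, without repetition -/

theorem words_support (f : ℕ) : ∀ (i : ℕ) (A : Finset ℕ) (α : ℕ → ℕ), i + f = n → ∀ β,
    β ∈ words n m b f i A α → ∀ j < i, β j = α j := by
  induction f with
  | zero => simp [words]
  | succ f ih =>
    intro i A α hi β hβ j hj
    simp only [words] at hβ
    split_ifs at hβ
    · exact ih _ _ _ (by omega) β hβ j (by omega)
    · simp only [List.mem_cons, List.mem_append] at hβ
      rcases hβ with rfl | hβ | hβ
      · rw [Function.update_of_ne (by omega)]
      · rw [ih _ _ _ (by omega) β hβ j (by omega), Function.update_of_ne (by omega)]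
      · exact ih _ _ _ (by omega) β hβ j (by omega)

/-- Case distinction on `β i`. For 0, the row below `β` has entry 0 at `i`, and either `β` is 1 at
all later positions, which is the word output here, or it belongs to the first branch. For 1, only
entries after `i` matter, so a row may be replaced by its representative. -/
theorem mem_words (f : ℕ) : ∀ (i : ℕ) (A : Finset ℕ) (α : ℕ → ℕ), i + f = n →
    (∀ j, i ≤ j → j < n → α j = 1) → ∀ β, β ∈ words n m b f i A α ↔
      (∀ j, j < i ∨ n ≤ j → β j = α j) ∧ (∀ j, i ≤ j → j < n → β j ≤ 1) ∧
      (∃ j, i ≤ j ∧ j < n ∧ β j = 0) ∧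
      ∃ t ∈ A, ∀ j, i ≤ j → j < n → b t j ≠ 0 → β j = 1 := by
  induction f with
  | zero =>
    intro i A α hi hα β
    simp only [words, List.not_mem_nil, false_iff]
    rintro ⟨-, -, ⟨j, h1, h2, -⟩, -⟩
    omega
  | succ f ih =>
    intro i A α hi hα β
    have hin : i < n := by omega
    have hsplit : ∀ j, i ≤ j → j = i ∨ i + 1 ≤ j := fun j hj => by omega
    have hrep : ∀ t j, i + 1 ≤ j → j < n → b (rep n m b (i + 1) t) j = b t j :=
      fun t j h1 h2 => rep_same (i + 1) t j h2 h1
    have hα' : ∀ j, i + 1 ≤ j → j < n → Function.update α i 0 j = 1 := fun j h1 h2 => by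
      rw [Function.update_of_ne (by omega)]
      exact hα j (by omega) h2
    simp only [words]
    split_ifs with h
    · rw [ih _ _ _ (by omega) (fun j h1 h2 => hα j (by omega) h2)]
      have hA : ∀ t ∈ A, b t i ≠ 0 := fun t ht h0 => by
        have := mem_zeros.2 ⟨ht, h0⟩
        simp [h] at this
      constructor
      · rintro ⟨h1, h2, ⟨j, h3, h4, h5⟩, t, ht, h6⟩
        have hbi : β i = 1 := by rw [h1 i (by omega), hα i le_rfl hin]
        refine ⟨fun j hj => h1 j (by omega), fun j hij hjn => ?_, ⟨j, by omega, h4, h5⟩, t, ht,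
          fun j hij hjn h0 => ?_⟩
        · rcases hsplit j hij with rfl | hlt
          · omega
          · exact h2 j hlt hjn
        · rcases hsplit j hij with rfl | hlt
          · exact hbi
          · exact h6 j hlt hjn h0
      · rintro ⟨h1, h2, ⟨j, h3, h4, h5⟩, t, ht, h6⟩
        have hbi : β i = 1 := h6 i le_rfl hin (hA t ht)
        refine ⟨fun j hj => ?_, fun j hij hjn => h2 j (by omega) hjn, ⟨j, ?_, h4, h5⟩, t, ht,
          fun j hij hjn h0 => h6 j (by omega) hjn h0⟩
        · by_cases hji : j = i
          · rw [hji, hbi, hα i le_rfl hin]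
          · exact h1 j (by omega)
        · rcases hsplit j h3 with rfl | hlt
          · omega
          · exact hlt
    · rw [List.mem_cons, List.mem_append, ih _ _ _ (by omega) hα',
        ih _ _ _ (by omega) (fun j h1 h2 => hα j (by omega) h2)]
      obtain ⟨t0, ht0⟩ := Finset.nonempty_iff_ne_empty.2 h
      rw [mem_zeros] at ht0
      constructor
      · rintro (rfl | ⟨h1, h2, ⟨j, h3, h4, h5⟩, u, hu, h6⟩ | ⟨h1, h2, ⟨j, h3, h4, h5⟩, u, hu, h6⟩)
        · refine ⟨fun j hj => Function.update_of_ne (by omega) _ _, fun j hij hjn => ?_,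
            ⟨i, le_rfl, hin, by simp⟩, t0, ht0.1, fun j hij hjn h0 => ?_⟩
          · rcases hsplit j hij with rfl | hlt
            · simp
            · rw [hα' j hlt hjn]
          · rcases hsplit j hij with rfl | hlt
            · exact absurd ht0.2 h0
            · exact hα' j hlt hjn
        · have hbi : β i = 0 := by rw [h1 i (by omega)]; simp
          obtain ⟨t, ht, h0, rfl⟩ := mem_down.1 hu
          refine ⟨fun j hj => ?_, fun j hij hjn => ?_, ⟨i, le_rfl, hin, hbi⟩, t, ht,
            fun j hij hjn hb => ?_⟩
          · rw [h1 j (by omega), Function.update_of_ne (by omega)]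
          · rcases hsplit j hij with rfl | hlt
            · omega
            · exact h2 j hlt hjn
          · rcases hsplit j hij with rfl | hlt
            · exact absurd h0 hb
            · exact h6 j hlt hjn (by rwa [hrep t j hlt hjn])
        · have hbi : β i = 1 := by rw [h1 i (by omega), hα i le_rfl hin]
          have ht : ∃ t ∈ A, ∀ j, i + 1 ≤ j → j < n → b t j ≠ 0 → β j = 1 := by
            rcases mem_rest.1 hu with ⟨hu, -⟩ | hu
            · exact ⟨u, hu, h6⟩
            · obtain ⟨t, ht, -, rfl⟩ := mem_down.1 hu
              exact ⟨t, ht, fun j hij hjn hb => h6 j hij hjn (by rwa [hrep t j hij hjn])⟩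
          obtain ⟨t, ht, h6⟩ := ht
          refine ⟨fun j hj => h1 j (by omega), fun j hij hjn => ?_, ⟨j, by omega, h4, h5⟩, t, ht,
            fun j hij hjn hb => ?_⟩
          · rcases hsplit j hij with rfl | hlt
            · omega
            · exact h2 j hlt hjn
          · rcases hsplit j hij with rfl | hlt
            · exact hbi
            · exact h6 j hlt hjn hb
      · rintro ⟨h1, h2, ⟨j, h3, h4, h5⟩, t, ht, h6⟩
        have hbi := h2 i le_rfl hin
        rcases Nat.eq_zero_or_pos (β i) with h0 | h0
        · have ht0 : b t i = 0 := by
            by_contra hne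
            have := h6 i le_rfl hin hne
            omega
          by_cases hz : ∃ j, i + 1 ≤ j ∧ j < n ∧ β j = 0
          · refine .inr (.inl ⟨fun j hj => ?_, fun j hij hjn => h2 j (by omega) hjn, hz, _,
              mem_down.2 ⟨t, ht, ht0, rfl⟩, fun j hij hjn hb => ?_⟩)
            · by_cases hji : j = i
              · rw [hji, h0]; simp
              · rw [Function.update_of_ne hji, h1 j (by omega)]
            · exact h6 j (by omega) hjn (by rwa [hrep t j hij hjn] at hb)
          · refine .inl (funext fun j => ?_)
            by_cases hji : j = i
            · rw [hji, h0]; simp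
            · rw [Function.update_of_ne hji]
              by_cases hj : j < i ∨ n ≤ j
              · exact h1 j hj
              · rw [hα j (by omega) (by omega)]
                have g1 : β j ≠ 0 := fun hh => hz ⟨j, by omega, by omega, hh⟩
                have g2 := h2 j (by omega) (by omega)
                omega
        · have hb1 : β i = 1 := by omega
          refine .inr (.inr ⟨fun j hj => ?_, fun j hij hjn => h2 j (by omega) hjn,
            ⟨j, ?_, h4, h5⟩, ?_⟩)
          · by_cases hji : j = i
            · rw [hji, hb1, hα i le_rfl hin]
            · exact h1 j (by omega)
          · rcases hsplit j h3 with rfl | hlt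
            · omega
            · exact hlt
          · by_cases ht0 : b t i = 0
            · refine ⟨_, mem_rest.2 (.inr (mem_down.2 ⟨t, ht, ht0, rfl⟩)), fun j hij hjn hb => ?_⟩
              exact h6 j (by omega) hjn (by rwa [hrep t j hij hjn] at hb)
            · exact ⟨t, mem_rest.2 (.inl ⟨ht, ht0⟩), fun j hij hjn hb => h6 j (by omega) hjn hb⟩

/-- The branches differ at position `i`; the word output at the branching has no zero after `i`,
whereas all words of its branch do. -/
theorem nodup_words (f : ℕ) : ∀ (i : ℕ) (A : Finset ℕ) (α : ℕ → ℕ), i + f = n →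
    (∀ j, i ≤ j → j < n → α j = 1) → (words n m b f i A α).Nodup := by
  induction f with
  | zero => simp [words]
  | succ f ih =>
    intro i A α hi hα
    have hα' : ∀ j, i + 1 ≤ j → j < n → Function.update α i 0 j = 1 := fun j h1 h2 => by
      rw [Function.update_of_ne (by omega)]
      exact hα j (by omega) h2
    have hα'' : ∀ j, i + 1 ≤ j → j < n → α j = 1 := fun j h1 h2 => hα j (by omega) h2
    simp only [words]
    split_ifs with h
    · exact ih _ _ _ (by omega) hα''
    · have hi1 : α i = 1 := hα i le_rfl (by omega)
      rw [List.nodup_cons, List.nodup_append, List.mem_append]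
      refine ⟨?_, ih _ _ _ (by omega) hα', ih _ _ _ (by omega) hα'', ?_⟩
      · rintro (hmem | hmem)
        · obtain ⟨-, -, ⟨j, h1, h2, h3⟩, -⟩ := (mem_words f _ _ _ (by omega) hα' _).1 hmem
          rw [hα' j h1 h2] at h3
          omega
        · have := words_support f _ _ _ (by omega) _ hmem i (by omega)
          simp [hi1] at this
      · rintro β hβ _ hβ' rfl
        have h1 := words_support f _ _ _ (by omega) _ hβ i (by omega)
        have h2 := words_support f _ _ _ (by omega) _ hβ' i (by omega)
        rw [h1] at h2
        simp [hi1] at h2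

/-! ### The next zero of a row -/

theorem nextZero_of_ge {t i : ℕ} (h : n ≤ i) : nextZero n b t i = n := by
  rw [nextZero, if_neg (by omega)]

theorem nextZero_of_eq_zero {t i : ℕ} (hi : i < n) (h : b t i = 0) : nextZero n b t i = i := by
  rw [nextZero, if_pos hi, if_pos h]

theorem nextZero_of_ne_zero {t i : ℕ} (hi : i < n) (h : b t i ≠ 0) :
    nextZero n b t i = nextZero n b t (i + 1) := by
  rw [nextZero, if_pos hi, if_neg h]

theorem le_nextZero {t i : ℕ} (hi : i ≤ n) : i ≤ nextZero n b t i := by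
  induction hk : n - i generalizing i with
  | zero => rw [nextZero_of_ge (by omega)]; exact hi
  | succ k ih =>
    by_cases h : b t i = 0
    · rw [nextZero_of_eq_zero (by omega) h]
    · rw [nextZero_of_ne_zero (by omega) h]
      exact (Nat.le_succ i).trans (ih (by omega) (by omega))

theorem nextZero_eq_self_iff {t i : ℕ} (hi : i < n) : nextZero n b t i = i ↔ b t i = 0 := by
  refine ⟨fun h => ?_, nextZero_of_eq_zero hi⟩
  by_contra hne
  rw [nextZero_of_ne_zero hi hne] at h
  have := le_nextZero (b := b) (t := t) (show i + 1 ≤ n by omega)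
  omega

end Monotone

/-! ### Buckets with a tournament tree -/

namespace While

section rows

variable (M : ℕ → ℕ → ℕ → ℕ)

@[simp] theorem upd_same (a k c x : ℕ) : upd M a k c x a k = Function.update (M a k) c x := by
  funext c'
  by_cases h : c' = c
  · subst h; simp [upd]
  · simp [upd, h]

theorem upd_row_of_ne {a k c x a' k' : ℕ} (h : a' ≠ a ∨ k' ≠ k) : upd M a k c x a' k' = M a' k' := by
  funext c'
  have : ¬ (a' = a ∧ k' = k ∧ c' = c) := by omega
  simp [upd, this]

@[simp] theorem upd_of_ne {a k c x a' : ℕ} (h : a' ≠ a) : upd M a k c x a' = M a' := by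
  funext k'
  exact upd_row_of_ne M (.inl h)

end rows

section simps

variable (s : St) (x y n a k c : ℕ) (w : List ℕ)

@[simp] theorem St.setv_v : (s.setv x n).v = Function.update s.v x n := rfl
@[simp] theorem St.setv_r : (s.setv x n).r = s.r := rfl
@[simp] theorem St.setv_mem : (s.setv x n).mem = s.mem := rfl
@[simp] theorem St.setv_out : (s.setv x n).out = s.out := rfl
@[simp] theorem St.setv_clock : (s.setv x n).clock = s.clock := rfl
@[simp] theorem St.setr_v : (s.setr x n).v = s.v := rfl
@[simp] theorem St.setr_r : (s.setr x n).r = Function.update s.r x n := rfl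
@[simp] theorem St.setr_mem : (s.setr x n).mem = s.mem := rfl
@[simp] theorem St.setr_out : (s.setr x n).out = s.out := rfl
@[simp] theorem St.setr_clock : (s.setr x n).clock = s.clock := rfl
@[simp] theorem St.setm_v : (s.setm a k c n).v = s.v := rfl
@[simp] theorem St.setm_r : (s.setm a k c n).r = s.r := rfl
@[simp] theorem St.setm_mem : (s.setm a k c n).mem = upd s.mem a k c n := rfl
@[simp] theorem St.setm_out : (s.setm a k c n).out = s.out := rfl
@[simp] theorem St.setm_clock : (s.setm a k c n).clock = s.clock := rfl
@[simp] theorem St.push_v : (s.push w).v = s.v := rfl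
@[simp] theorem St.push_r : (s.push w).r = s.r := rfl
@[simp] theorem St.push_mem : (s.push w).mem = s.mem := rfl
@[simp] theorem St.push_out : (s.push w).out = s.out ++ [w] := rfl
@[simp] theorem St.push_clock : (s.push w).clock = s.clock := rfl
@[simp] theorem St.tick_v : (s.tick n).v = s.v := rfl
@[simp] theorem St.tick_r : (s.tick n).r = s.r := rfl
@[simp] theorem St.tick_mem : (s.tick n).mem = s.mem := rfl
@[simp] theorem St.tick_out : (s.tick n).out = s.out := rfl
@[simp] theorem St.tick_clock : (s.tick n).clock = s.clock + n := rfl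

end simps

/-- Sequence of commands. -/
def block : List Cmd → Cmd
  | [] => .atom (.copy 2 2)
  | [c] => c
  | c :: d :: l => .seq c (block (d :: l))

theorem wp_block_cons {E : Env} {Q : St → Prop} {s : St} {c d : Cmd} {l : List Cmd} :
    wp E (block (c :: d :: l)) Q s ↔ wp E c (wp E (block (d :: l)) Q) s := wp_seq

theorem wp_block_single {E : Env} {Q : St → Prop} {s : St} {c : Cmd} :
    wp E (block [c]) Q s ↔ wp E c Q s := Iff.rfl

open Cmd Atom in
/-- Recompute the tree in the row of slot `y` from the node in scalar `12` up to the root. -/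
def fixTree (y : ℕ) : Cmd :=
  loop 2 12 (block [
    atom (load 13 1 0 12), atom (load 13 7 y 13),
    atom (load 14 2 0 12), atom (load 14 7 y 14),
    ite 13 14 (atom (store 7 y 12 14)) (atom (store 7 y 12 13)),
    atom (load 12 3 0 12)])

open Cmd Atom in
/-- Insert the row in scalar `10` into the bucket in scalar `11`, in the frame of slot `y`. -/
def insertRow (y : ℕ) : Cmd :=
  block [
    atom (load 13 10 y 10),
    ite 2 13 (block []) (block [
      atom (store 10 y 10 3),
      atom (load 13 8 y 11), atom (store 9 y 10 13), atom (store 8 y 11 10),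
      ite 2 13 (block []) (block [
        atom (add 12 0 11), atom (sub 13 0 11), atom (store 7 y 12 13),
        atom (load 12 3 0 12), fixTree y])])]

/-- Contents of the tables computed in advance. -/
structure Tables (n m : ℕ) (b : ℕ → ℕ → ℕ) (M : ℕ → ℕ → ℕ → ℕ) : Prop where
  -- Tree neighbours are tabulated because computing them would cost a logarithmic factor at every
  -- level of a climb.
  left : ∀ v, 1 ≤ v → v < n → M 1 0 v = 2 * v
  right : ∀ v, 1 ≤ v → v < n → M 2 0 v = 2 * v + 1
  -- The root 1 gets parent 0, which ends a climb.
  parent : ∀ v, 1 ≤ v → v < 2 * n → M 3 0 v = v / 2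
  nz : ∀ i ≤ n, ∀ t, 1 ≤ t → t ≤ m → M 5 i t = Monotone.nextZero n b t i
  rep : ∀ i ≤ n, ∀ t, 1 ≤ t → t ≤ m → M 6 i t = Monotone.rep n m b i t

/-- The constant scalars and the tables are in place. -/
structure Ctx (E : Env) (b : ℕ → ℕ → ℕ) (s : St) : Prop where
  nt_pos : 1 ≤ E.nt
  nv : s.v 0 = E.nv
  nt : s.v 1 = E.nt
  zero : s.v 2 = 0
  one : s.v 3 = 1
  row : s.r 0 = 0
  tables : Tables E.nv E.nt b s.mem

theorem Ctx.congr {E : Env} {b : ℕ → ℕ → ℕ} {s s' : St} (h : Ctx E b s)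
    (hv : ∀ x < 4, s'.v x = s.v x) (hr : s'.r 0 = s.r 0)
    (hm : ∀ a, a = 1 ∨ a = 2 ∨ a = 3 ∨ a = 5 ∨ a = 6 → s'.mem a = s.mem a) : Ctx E b s' := by
  obtain ⟨h0, h1, h2, h3, h4, h5, ⟨g1, g2, g3, g4, g5⟩⟩ := h
  refine ⟨h0, ?_, ?_, ?_, ?_, ?_, ⟨?_, ?_, ?_, ?_, ?_⟩⟩
  · rw [hv _ (by omega), h1]
  · rw [hv _ (by omega), h2]
  · rw [hv _ (by omega), h3]
  · rw [hv _ (by omega), h4]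
  · rw [hr, h5]
  · rwa [hm 1 (by omega)]
  · rwa [hm 2 (by omega)]
  · rwa [hm 3 (by omega)]
  · rwa [hm 5 (by omega)]
  · rwa [hm 6 (by omega)]

/-- Every inner node of the tree except possibly `u` holds the maximum of its children. -/
def TreeExcept (n u : ℕ) (T : ℕ → ℕ) : Prop :=
  ∀ v, 1 ≤ v → v < n → v ≠ u → T v = max (T (2 * v)) (T (2 * v + 1))

/-- Recomputing node `u` moves the only possible defect to `u / 2`, until it vanishes at 0; there
are `u.size` rounds of at most ten units. As in the later triples, `Q` is arbitrary and need only
hold in states with the listed properties, so that such statements can be chained. -/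
theorem wp_fixTree {E : Env} {b : ℕ → ℕ → ℕ} {Q : St → Prop} {k y : ℕ} (u : ℕ) : ∀ (s : St),
    Ctx E b s → s.r y = k → k < E.rows → s.v 12 = u → u < E.nv ∨ u = 0 →
    TreeExcept E.nv u (s.mem 7 k) →
    (∀ s' : St, s'.out = s.out → s'.r = s.r → (∀ x, x < 12 ∨ 14 < x → s'.v x = s.v x) →
      (∀ a k', (a ≠ 7 ∨ k' ≠ k) → s'.mem a k' = s.mem a k') →
      (∀ j, E.nv ≤ j → s'.mem 7 k j = s.mem 7 k j) → TreeExcept E.nv 0 (s'.mem 7 k) →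
      s'.clock ≤ s.clock + 10 * u.size + 2 → Q s') →
    wp E (fixTree y) Q s := by
  induction u using Nat.strong_induction_on with
  | _ u ih =>
  intro s hs hr hk hu hun hT hQ
  have hw : E.width = 2 * (E.nv + E.nt) := rfl
  have hnt := hs.nt_pos
  rcases Nat.eq_zero_or_pos u with rfl | hpos
  · refine wp_loop_of_not_lt (by simp [hs.zero, hu]) (hQ _ rfl rfl (fun _ _ => rfl)
      (fun _ _ _ => rfl) (fun _ _ => rfl) hT ?_)
    simp
  · have hun : u < E.nv := by omega
    refine wp_loop_of_lt (by rw [hs.zero, hu]; exact hpos) ?_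
    have e1 := hs.tables.left u hpos hun
    have e2 := hs.tables.right u hpos hun
    have e3 := hs.tables.parent u hpos (by omega)
    have e0 := hs.row
    have hrows : 0 < E.rows := by simp [Env.rows]
    simp only [wp_block_cons, wp_block_single, wp_atom, wp_ite, Atom.ok, Atom.next, St.tick_v,
      St.tick_r, St.tick_mem, St.setv_v, St.setv_r, St.setv_mem, e0, hr, hu, e1, e2,
      Function.update_self, ne_eq, Nat.reduceEqDiff, not_false_eq_true,
      Function.update_of_ne, St.setm_mem, St.setm_v, St.setm_r, upd_of_ne, e3]
    have key : ∀ (w : ℕ), w = max (s.mem 7 k (2 * u)) (s.mem 7 k (2 * u + 1)) → ∀ (s1 : St),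
        s1.v 12 = u / 2 → s1.out = s.out → s1.r = s.r →
        (∀ x, x < 12 ∨ 14 < x → s1.v x = s.v x) → s1.mem = upd s.mem 7 k u w →
        s1.clock ≤ s.clock + 10 → wp E (fixTree y) Q s1 := by
      intro w hw' s1 h12 hout hr1 hv1 hm1 hc1
      have hs1 : Ctx E b s1 := hs.congr (fun x hx => hv1 x (by omega)) (by rw [hr1])
        (fun a ha => by rw [hm1, upd_of_ne]; omega)
      refine ih (u / 2) (by omega) s1 hs1 (by rw [hr1, hr]) hk h12 (by omega) ?_ ?_
      · intro v hv hvn hne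
        rw [hm1, upd_same]
        by_cases hvu : v = u
        · subst hvu
          rw [Function.update_self, Function.update_of_ne (by omega),
            Function.update_of_ne (by omega), hw']
        · rw [Function.update_of_ne hvu, Function.update_of_ne (by omega),
            Function.update_of_ne (by omega)]
          exact hT v hv hvn hvu
      · intro s' g1 g2 g3 g4 g5 g6 g7
        refine hQ s' (g1.trans hout) (g2.trans hr1) (fun x hx => (g3 x hx).trans (hv1 x hx))
          (fun a k' hak => ?_) (fun j hj => ?_) g6 ?_
        · rw [g4 a k' hak, hm1, upd_row_of_ne _ hak]
        · rw [g5 j hj, hm1, upd_same, Function.update_of_ne (by omega)]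
        · have : u.size = (u / 2).size + 1 := by
            conv_lhs => rw [← Nat.bit_bodd_div2 u]
            rw [Nat.size_bit, Nat.div2_val]
            rw [Nat.bit_bodd_div2]; omega
          omega
    refine ⟨⟨hrows, by omega⟩, ⟨hk, by omega⟩, ⟨hrows, by omega⟩, ⟨hk, by omega⟩, ?_⟩
    split_ifs with hlt
    · refine ⟨⟨hk, by omega⟩, ⟨hrows, by omega⟩, key (s.mem 7 k (2 * u + 1)) (by omega) _ ?_ ?_ ?_ ?_ ?_ ?_⟩
      all_goals first | rfl | simp
      intro x hx
      simp only [Function.update_apply]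
      split_ifs <;> omega
    · refine ⟨⟨hk, by omega⟩, ⟨hrows, by omega⟩, key (s.mem 7 k (2 * u)) (by omega) _ ?_ ?_ ?_ ?_ ?_ ?_⟩
      all_goals first | rfl | simp
      intro x hx
      simp only [Function.update_apply]
      split_ifs <;> omega

end While

/-! ### Linked lists and frames -/

namespace While

/-- `l` is the list linked by `X` from `h` on. -/
def Chain (X : ℕ → ℕ) : ℕ → List ℕ → Prop
  | h, [] => h = 0
  | h, t :: l => h = t ∧ t ≠ 0 ∧ Chain X (X t) l

theorem Chain.congr {X X' : ℕ → ℕ} {l : List ℕ} : ∀ {h : ℕ}, Chain X h l →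
    (∀ t ∈ l, X' t = X t) → Chain X' h l := by
  induction l with
  | nil => intro h hc _; exact hc
  | cons t l ih =>
    intro h hc hX
    refine ⟨hc.1, hc.2.1, ?_⟩
    rw [hX t (by simp)]
    exact ih hc.2.2 fun u hu => hX u (by simp [hu])

theorem Chain.eq_zero_iff {X : ℕ → ℕ} {l : List ℕ} {h : ℕ} (hc : Chain X h l) :
    h = 0 ↔ l = [] := by
  cases l with
  | nil => simpa [Chain] using hc
  | cons t l =>
    obtain ⟨rfl, h0, -⟩ := hc
    simp [h0]

/-- A frame with tree `T`, bucket heads `H`, links `X` and marks `B` holds the rows in `S`, row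
`t` in bucket `z t`; the marked rows are those in `P`. -/
structure Frame (n m : ℕ) (T H X B : ℕ → ℕ) (S P : Finset ℕ) (z : ℕ → ℕ) : Prop where
  -- The sets differ only while a bucket is being distributed: its remaining rows are still marked.
  sub : S ⊆ P
  mem : ∀ t ∈ P, 1 ≤ t ∧ t ≤ m
  list : ∀ q < n, ∃ l, Chain X (H q) l ∧ l.Nodup ∧ ∀ t, t ∈ l ↔ t ∈ S ∧ z t = q
  mark : ∀ t, 1 ≤ t → t ≤ m → B t = if t ∈ P then 1 else 0
  -- The value `n - q` is positive and decreases with `q`, so the maximum points to the first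
  -- nonempty bucket, and 0 means that all are empty.
  leaf : ∀ q < n, T (n + q) = if ∃ t ∈ S, z t = q then n - q else 0
  node : TreeExcept n 0 T
  -- Without variables there are no leaves, but node 1 is read nevertheless.
  root : n = 0 → T 1 = 0

section

variable {n m : ℕ} {T H X B : ℕ → ℕ} {S P : Finset ℕ} {z : ℕ → ℕ}

theorem Frame.head_eq_zero (h : Frame n m T H X B S P z) {q : ℕ} (hq : q < n) :
    H q = 0 ↔ ¬ ∃ t ∈ S, z t = q := by
  obtain ⟨l, h1, -, h3⟩ := h.list q hq
  rw [h1.eq_zero_iff]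
  constructor
  · rintro rfl ⟨t, ht, hz⟩
    simpa using (h3 t).2 ⟨ht, hz⟩
  · intro hne
    refine List.eq_nil_iff_forall_not_mem.2 fun t ht => ?_
    obtain ⟨h4, h5⟩ := (h3 t).1 ht
    exact hne ⟨t, h4, h5⟩

/-- Used when the base position advances past positions where the stored rows have entry 1: their
next zeros do not change. -/
theorem Frame.congr_pos (h : Frame n m T H X B S P z) {z' : ℕ → ℕ} (hz : ∀ t ∈ S, z' t = z t) :
    Frame n m T H X B S P z' := by
  refine ⟨h.sub, h.mem, fun q hq => ?_, h.mark, fun q hq => ?_, h.node, h.root⟩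
  · obtain ⟨l, h1, h2, h3⟩ := h.list q hq
    refine ⟨l, h1, h2, fun t => (h3 t).trans (and_congr_right fun ht => ?_)⟩
    rw [hz t ht]
  · rw [h.leaf q hq]
    congr 1
    refine propext (exists_congr fun t => and_congr_right fun ht => ?_)
    rw [hz t ht]

theorem Frame.le_root (h : Frame n m T H X B S P z) (v : ℕ) : 1 ≤ v → v < 2 * n → T v ≤ T 1 := by
  induction v using Nat.strong_induction_on with
  | _ v ih =>
    intro h1 hv
    by_cases hv1 : v = 1
    · rw [hv1]
    · have hp := h.node (v / 2) (by omega) (by omega) (by omega)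
      have := ih (v / 2) (by omega) (by omega) (by omega)
      rcases Nat.even_or_odd' v with ⟨w, rfl | rfl⟩
      · rw [show 2 * w / 2 = w by omega] at *
        omega
      · rw [show (2 * w + 1) / 2 = w by omega] at *
        omega

theorem Frame.exists_leaf (h : Frame n m T H X B S P z) (k : ℕ) : ∀ v, 2 * n - v = k → 1 ≤ v →
    v < 2 * n → ∃ q < n, T (n + q) = T v := by
  induction k using Nat.strong_induction_on with
  | _ k ih =>
    intro v hk h1 hv
    by_cases hvn : n ≤ v
    · exact ⟨v - n, by omega, by rw [Nat.add_sub_cancel' hvn]⟩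
    · have hp := h.node v h1 (by omega) (by omega)
      rcases le_total (T (2 * v)) (T (2 * v + 1)) with hle | hle
      · obtain ⟨q, hq, he⟩ := ih (2 * n - (2 * v + 1)) (by omega) (2 * v + 1) rfl (by omega)
          (by omega)
        exact ⟨q, hq, by omega⟩
      · obtain ⟨q, hq, he⟩ := ih (2 * n - 2 * v) (by omega) (2 * v) rfl (by omega)
          (by omega)
        exact ⟨q, hq, by omega⟩

theorem Frame.root_of_empty (h : Frame n m T H X B ∅ P z) : T 1 = 0 := by
  rcases Nat.eq_zero_or_pos n with hn | hn
  · exact h.root hn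
  · obtain ⟨q, hq, he⟩ := h.exists_leaf _ 1 rfl le_rfl (by omega)
    rw [← he, h.leaf q hq]
    simp

/-- Leaf `i` makes the root positive, so the leaf attaining the maximum belongs to a nonempty
bucket, and no such bucket comes before `i`. -/
theorem Frame.root_eq (h : Frame n m T H X B S P z) {i : ℕ} (hi : i < n) (hex : ∃ t ∈ S, z t = i)
    (hle : ∀ t ∈ S, i ≤ z t) : T 1 = n - i := by
  obtain ⟨q, hq, he⟩ := h.exists_leaf _ 1 rfl le_rfl (by omega)
  have h1 := h.le_root (n + i) (by omega) (by omega)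
  rw [h.leaf i hi, if_pos hex] at h1
  rw [h.leaf q hq] at he
  split_ifs at he with hex'
  · obtain ⟨t, ht, rfl⟩ := hex'
    have := hle t ht
    omega
  · omega

/-- An unmarked row is in no list, so its link may be overwritten without damage. -/
theorem Frame.insert (h : Frame n m T H X B S P z) {t : ℕ} {T' : ℕ → ℕ} (ht : t ∉ P) (h1 : 1 ≤ t)
    (hm : t ≤ m) (hq : z t < n) (hT : ∀ q < n, T' (n + q) = if q = z t then n - q else T (n + q))
    (hT' : TreeExcept n 0 T') :
    Frame n m T' (Function.update H (z t) t) (Function.update X t (H (z t)))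
      (Function.update B t 1) (insert t S) (insert t P) z := by
  have hX : ∀ l : List ℕ, (∀ u ∈ l, u ∈ P) → ∀ u ∈ l, Function.update X t (H (z t)) u = X u :=
    fun l hl u hu => Function.update_of_ne (by rintro rfl; exact ht (hl _ hu)) _ _
  refine ⟨Finset.insert_subset_insert _ h.sub, fun u hu => ?_, fun q hq' => ?_, fun u hu hum => ?_,
    fun q hq' => ?_, hT', fun hn => by omega⟩
  · rcases Finset.mem_insert.1 hu with rfl | hu
    · exact ⟨h1, hm⟩
    · exact h.mem u hu
  · obtain ⟨l, g1, g2, g3⟩ := h.list q hq'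
    have hlP : ∀ u ∈ l, u ∈ P := fun u hu => h.sub ((g3 u).1 hu).1
    have hc := g1.congr (hX l hlP)
    by_cases hqz : q = z t
    · subst hqz
      refine ⟨t :: l, ⟨by simp, by omega, by simpa using hc⟩,
        List.nodup_cons.2 ⟨fun hmem => ht (hlP t hmem), g2⟩, fun u => ?_⟩
      rw [List.mem_cons, g3, Finset.mem_insert]
      constructor
      · rintro (rfl | ⟨a, e⟩)
        · exact ⟨.inl rfl, rfl⟩
        · exact ⟨.inr a, e⟩
      · rintro ⟨rfl | a, e⟩
        · exact .inl rfl
        · exact .inr ⟨a, e⟩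
    · refine ⟨l, by rwa [Function.update_of_ne hqz], g2, fun u => ?_⟩
      rw [g3, Finset.mem_insert]
      constructor
      · rintro ⟨a, e⟩
        exact ⟨.inr a, e⟩
      · rintro ⟨rfl | a, e⟩
        · exact absurd e.symm hqz
        · exact ⟨a, e⟩
  · by_cases hut : u = t
    · subst hut; simp
    · rw [Function.update_of_ne hut, h.mark u hu hum]
      simp [hut]
  · rw [hT q hq', h.leaf q hq']
    by_cases hqz : q = z t
    · rw [if_pos hqz, if_pos ⟨t, by simp, hqz.symm⟩]
    · rw [if_neg hqz]
      congr 1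
      refine propext ⟨fun ⟨u, hu, e⟩ => ⟨u, by simp [hu], e⟩, fun ⟨u, hu, e⟩ => ?_⟩
      rcases Finset.mem_insert.1 hu with rfl | hu
      · exact absurd e.symm hqz
      · exact ⟨u, hu, e⟩

/-- Emptying bucket `p`. -/
theorem Frame.remove (h : Frame n m T H X B S P z) {p : ℕ} {T' : ℕ → ℕ} (hp : p < n)
    (hT : ∀ q < n, T' (n + q) = if q = p then 0 else T (n + q)) (hT' : TreeExcept n 0 T') :
    Frame n m T' (Function.update H p 0) X B (S.filter (z · ≠ p)) P z := by
  refine ⟨(Finset.filter_subset _ _).trans h.sub, h.mem, fun q hq => ?_, h.mark, fun q hq => ?_,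
    hT', fun hn => by omega⟩
  · by_cases hqp : q = p
    · subst hqp
      refine ⟨[], by simp [Chain], by simp, fun t => ?_⟩
      simp only [List.not_mem_nil, Finset.mem_filter, false_iff]
      rintro ⟨⟨-, hne⟩, he⟩
      exact hne he
    · obtain ⟨l, g1, g2, g3⟩ := h.list q hq
      refine ⟨l, by rwa [Function.update_of_ne hqp], g2, fun t => ?_⟩
      rw [g3, Finset.mem_filter]
      constructor
      · rintro ⟨a, rfl⟩
        exact ⟨⟨a, hqp⟩, rfl⟩
      · rintro ⟨⟨a, -⟩, e⟩
        exact ⟨a, e⟩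
  · rw [hT q hq, h.leaf q hq]
    by_cases hqp : q = p
    · subst hqp
      rw [if_pos rfl, if_neg]
      rintro ⟨t, ht, e⟩
      exact (Finset.mem_filter.1 ht).2 e
    · rw [if_neg hqp]
      congr 1
      refine propext ⟨fun ⟨u, hu, e⟩ => ⟨u, Finset.mem_filter.2 ⟨hu, e ▸ hqp⟩, e⟩,
        fun ⟨u, hu, e⟩ => ⟨u, (Finset.mem_filter.1 hu).1, e⟩⟩

/-- Clearing a mark of a row that is not in a bucket. -/
theorem Frame.unmark (h : Frame n m T H X B S P z) {t : ℕ} (ht : t ∉ S) :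
    Frame n m T H X (Function.update B t 0) S (P.erase t) z := by
  refine ⟨fun u hu => Finset.mem_erase.2 ⟨fun he => ht (he ▸ hu), h.sub hu⟩,
    fun u hu => h.mem u (Finset.mem_of_mem_erase hu), h.list, fun u hu hum => ?_, h.leaf, h.node,
    h.root⟩
  by_cases hut : u = t
  · subst hut; simp
  · rw [Function.update_of_ne hut, h.mark u hu hum]
    simp [hut]

end

/-- The frame in row `k` of the memory. -/
abbrev FrameAt (E : Env) (M : ℕ → ℕ → ℕ → ℕ) (k : ℕ) (S P : Finset ℕ) (z : ℕ → ℕ) : Prop :=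
  Frame E.nv E.nt (M 7 k) (M 8 k) (M 9 k) (M 10 k) S P z

/-- Number of nonempty buckets. -/
def used (S : Finset ℕ) (z : ℕ → ℕ) : ℕ := (S.image z).card

/-- Bound on the time for opening a bucket. -/
def Env.opening (E : Env) : ℕ := 2 * E.arith + 10 * (2 * E.nv).size + 10

theorem one_le_arith (E : Env) : 1 ≤ E.arith := by simp [Env.arith]

theorem cap_big (E : Env) (h : 1 ≤ E.nt) : 2 * E.nv + 2 * E.nt + 2 ≤ E.cap := by
  have : 1 * E.width ≤ 12 * E.rows * E.width := Nat.mul_le_mul_right _ (by simp [Env.rows]; omega)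
  have h2 : 82 ≤ E.base := by simp [Env.base]
  simp only [Env.cap]
  rw [mul_comm E.width]
  have h3 : E.width = 2 * (E.nv + E.nt) := rfl
  omega

/-- Arithmetic and a climb in the tree are needed only if the bucket was empty; this is paid by the
growth of `used`. All else takes at most ten units. The hypothesis `hPS` ensures that a marked row
really is in a bucket already, and then nothing is to be done. -/
theorem wp_insertRow {E : Env} {b : ℕ → ℕ → ℕ} {Q : St → Prop} {s : St} {k y t : ℕ}
    {S P : Finset ℕ} {z : ℕ → ℕ} (hs : Ctx E b s) (hy : s.r y = k) (hk : k < E.rows)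
    (h10 : s.v 10 = t) (h1 : 1 ≤ t) (hm : t ≤ E.nt) (h11 : s.v 11 = z t) (hq : z t < E.nv)
    (hF : FrameAt E s.mem k S P z) (hPS : t ∈ P → t ∈ S)
    (hQ : ∀ s' : St, s'.out = s.out → s'.r = s.r → (∀ x, x < 12 ∨ 14 < x → s'.v x = s.v x) →
      (∀ a k', (a < 7 ∨ 10 < a ∨ k' ≠ k) → s'.mem a k' = s.mem a k') →
      (∀ u ∈ P, s'.mem 9 k u = s.mem 9 k u) →
      FrameAt E s'.mem k (insert t S) (insert t P) z →
      s'.clock + E.opening * used S z ≤ s.clock + 10 + E.opening * used (insert t S) z → Q s') :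
    wp E (insertRow y) Q s := by
  have hw : E.width = 2 * (E.nv + E.nt) := rfl
  have hcap := cap_big E hs.nt_pos
  have hmark := hF.mark t h1 hm
  have hused : used S z ≤ used (insert t S) z :=
    Finset.card_le_card (Finset.image_subset_image (Finset.subset_insert _ _))
  have hmul := Nat.mul_le_mul_left E.opening hused
  simp only [insertRow, block, wp_seq, wp_atom, wp_ite, Atom.ok, Atom.next, St.tick_v,
    St.tick_r, St.tick_mem, St.setv_v, St.setv_r, hy, h10,
    Function.update_self, ne_eq, Nat.reduceEqDiff, not_false_eq_true,
    Function.update_of_ne, hs.zero]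
  refine ⟨⟨hk, by omega⟩, ?_⟩
  by_cases hpos : 0 < s.mem 10 k t
  · rw [if_pos hpos]
    refine ⟨trivial, ?_⟩
    have htP : t ∈ P := by
      by_contra hne
      rw [hmark, if_neg hne] at hpos
      omega
    have e1 := Finset.insert_eq_of_mem (hPS htP)
    have e2 := Finset.insert_eq_of_mem htP
    refine hQ _ rfl rfl (fun x hx => ?_) (fun _ _ _ => rfl) (fun _ _ => rfl) ?_ ?_
    · simp only [St.tick_v, St.setv_v, Function.update_apply]
      split_ifs with h2 h13
      · rw [h2, hs.zero]
      · omega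
      · rfl
    · rw [e1, e2]; exact hF
    · rw [e1]; simp
  · rw [if_neg hpos]
    have htP : t ∉ P := fun htP => hpos (by rw [hmark, if_pos htP]; omega)
    simp only [St.setm_v, St.setm_r, St.setm_mem, upd_of_ne, ne_eq, Nat.reduceEqDiff,
      not_false_eq_true, St.tick_v, St.tick_r, St.tick_mem, h11, h10, hy, St.setv_v, St.setv_r, St.setv_mem,
      Function.update_self, Function.update_of_ne, hs.zero, hs.one, hs.nv]
    refine ⟨⟨hk, by omega⟩, ⟨hk, by omega⟩, ⟨hk, by omega⟩, ⟨hk, by omega⟩, ?_⟩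
    by_cases hH : 0 < s.mem 8 k (z t)
    · rw [if_pos hH]
      refine ⟨trivial, ?_⟩
      have hex : ∃ u ∈ S, z u = z t := by
        by_contra hne
        have := (hF.head_eq_zero hq).2 hne
        omega
      refine hQ _ rfl rfl (fun x hx => ?_) (fun a k' hak => ?_) (fun u hu => ?_) ?_ ?_
      · simp only [St.tick_v, St.setv_v, St.setm_v, Function.update_apply]
        split_ifs with h2 h13
        · rw [h2, hs.zero]
        · omega
        · rfl
      · simp only [St.tick_mem, St.setv_mem, St.setm_mem]
        rw [upd_row_of_ne _ (by omega), upd_row_of_ne _ (by omega), upd_row_of_ne _ (by omega)]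
      · have : u ≠ t := fun he => htP (he ▸ hu)
        simp [this]
      · simp only [FrameAt, St.tick_mem, St.setv_mem, St.setm_mem, upd_same, ne_eq,
          Nat.reduceEqDiff, not_false_eq_true, upd_of_ne]
        refine hF.insert htP h1 hm hq (fun q hq' => ?_) hF.node
        split_ifs with hqz
        · rw [hF.leaf q hq', if_pos (hqz ▸ hex)]
        · rfl
      · simp; omega
    · rw [if_neg hH]
      have hex : ¬ ∃ u ∈ S, z u = z t := (hF.head_eq_zero hq).1 (by omega)
      have e0 : s.r 0 = 0 := hs.row
      have e3 := hs.tables.parent (E.nv + z t) (by omega) (by omega)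
      have hrows : 0 < E.rows := by simp [Env.rows]
      have hused : used (insert t S) z = used S z + 1 := by
        simp only [used, Finset.image_insert]
        rw [Finset.card_insert_of_notMem]
        simpa using hex
      simp only [e0, e3]
      refine ⟨by omega, trivial, ⟨hk, by omega⟩, ⟨hrows, by omega⟩, ?_⟩
      refine wp_fixTree (b := b) (k := k) ((E.nv + z t) / 2) _ ?_ ?_ hk ?_ (by omega) ?_ ?_
      · refine hs.congr (fun x hx => ?_) rfl (fun a ha => ?_)
        · simp only [St.tick_v, St.setv_v, St.setm_v, Function.update_apply]
          split_ifs <;> omega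
        · simp only [St.tick_mem, St.setv_mem, St.setm_mem]
          rw [upd_of_ne _ (by omega), upd_of_ne _ (by omega), upd_of_ne _ (by omega),
            upd_of_ne _ (by omega)]
      · exact hy
      · simp
      · simp only [St.tick_mem, St.setv_mem, St.setm_mem, upd_same]
        intro v hv hvn hne
        simp only [ne_eq, Nat.reduceEqDiff, not_false_eq_true, upd_of_ne]
        rw [Function.update_of_ne (by omega), Function.update_of_ne (by omega),
          Function.update_of_ne (by omega)]
        exact hF.node v hv hvn (by omega)
      · intro s' g1 g2 g3 g4 g5 g6 g7
        have hrow : ∀ a, a ≠ 7 → ∀ k', s'.mem a k' =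
            upd (upd (upd s.mem 10 k t 1) 9 k t (s.mem 8 k (z t))) 8 k (z t) t a k' := by
          intro a ha k'
          rw [g4 a k' (.inl ha)]
          simp only [St.tick_mem, St.setv_mem, St.setm_mem]
          rw [upd_of_ne _ ha]
        refine hQ s' g1 g2 (fun x hx => ?_) (fun a k' hak => ?_) (fun u hu => ?_) ?_ ?_
        · rw [g3 x hx]
          simp only [St.tick_v, St.setv_v, St.setm_v, Function.update_apply]
          split_ifs <;> omega
        · by_cases ha : a = 7
          · subst ha
            rw [g4 7 k' (.inr (by omega))]
            simp only [St.tick_mem, St.setv_mem, St.setm_mem]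
            rw [upd_row_of_ne _ (by omega), upd_of_ne _ (by omega), upd_of_ne _ (by omega),
              upd_of_ne _ (by omega)]
          · rw [hrow a ha, upd_row_of_ne _ (by omega), upd_row_of_ne _ (by omega),
              upd_row_of_ne _ (by omega)]
        · have : u ≠ t := fun he => htP (he ▸ hu)
          rw [hrow 9 (by omega)]
          simp [this]
        · simp only [FrameAt]
          rw [hrow 8 (by omega), hrow 9 (by omega), hrow 10 (by omega)]
          simp only [upd_same, ne_eq, Nat.reduceEqDiff, not_false_eq_true, upd_of_ne]
          refine hF.insert htP h1 hm hq (fun q hq' => ?_) g6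
          rw [g5 _ (by omega)]
          simp only [St.tick_mem, St.setv_mem, St.setm_mem, upd_same, ne_eq, Nat.reduceEqDiff,
            not_false_eq_true, upd_of_ne]
          by_cases hqz : q = z t
          · subst hqz; simp
          · rw [if_neg hqz, Function.update_of_ne (by omega)]
        · have hsz : ((E.nv + z t) / 2).size ≤ (2 * E.nv).size := Nat.size_le_size (by omega)
          simp only [St.tick_clock, St.setv_clock, St.setm_clock] at g7
          rw [hused, mul_add, mul_one]
          have hD : E.opening = 2 * E.arith + 10 * (2 * E.nv).size + 10 := rfl
          omega

end While

/-! ### The main loop -/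

namespace While

open Monotone (nextZero rep zeros down rest words count work Canonical Rows)

open Cmd Atom in
/-- Distribute the rows of the list in scalar `8` over the frames of slots `2` and `1`. -/
def distribute : Cmd :=
  loop 2 8 (block [
    -- Link and mark are dealt with before the insertions, because the row may be its own
    -- representative and return to the same frame with a new link.
    atom (load 9 9 1 8), atom (store 10 1 8 2), atom (load 10 6 3 8), atom (load 11 5 3 10),
    ite 11 0 (block [insertRow 2, insertRow 1]) (block []),
    atom (copy 8 9)])

open Cmd Atom in
/-- Take the first bucket out of the current frame, output a word and open the next frame. -/
def pushFrame : Cmd :=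
  block [
    -- Scalar `13` holds the root, that is, `n` minus the position of the first nonempty bucket.
    atom (sub 6 0 13), atom (add 7 6 3), atom (row 3 7),
    atom (load 8 8 1 6), atom (store 8 1 6 2), atom (add 12 0 6), atom (store 7 1 12 2),
    atom (load 12 3 0 12), fixTree 1,
    atom (store 4 0 4 6), atom (store 0 0 6 2), atom (emit 0), distribute, atom (add 4 4 3)]

open Cmd Atom in
/-- Return to the previous frame. -/
def popFrame : Cmd :=
  block [atom (sub 4 4 3), atom (load 6 4 0 4), atom (store 0 0 6 3)]

open Cmd Atom in
/-- One iteration of the main loop. -/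
def mainBody : Cmd :=
  block [
    atom (row 1 4), atom (add 5 4 3), atom (row 2 5), atom (load 13 7 1 3),
    -- A positive root calls for a branching; an exhausted frame is left, and at level 0 the loop
    -- ends.
    ite 2 13 pushFrame (ite 2 4 popFrame (atom (const 15 0)))]

/-- The main loop. -/
def mainLoop : Cmd := .loop 2 15 mainBody

/-- The rows of `A` with a zero entry from position `i` on. -/
def live (n : ℕ) (b : ℕ → ℕ → ℕ) (i : ℕ) (A : Finset ℕ) : Finset ℕ :=
  A.filter fun t => nextZero n b t i < n

theorem mem_live {n : ℕ} {b : ℕ → ℕ → ℕ} {i t : ℕ} {A : Finset ℕ} :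
    t ∈ live n b i A ↔ t ∈ A ∧ nextZero n b t i < n := by
  simp [live]

theorem FrameAt.congr {E : Env} {M M' : ℕ → ℕ → ℕ → ℕ} {k : ℕ} {S P : Finset ℕ} {z : ℕ → ℕ}
    (h : FrameAt E M k S P z) (hM : ∀ a, 7 ≤ a → a ≤ 10 → M' a k = M a k) :
    FrameAt E M' k S P z := by
  unfold FrameAt
  rw [hM 7 (by omega) (by omega), hM 8 (by omega) (by omega), hM 9 (by omega) (by omega),
    hM 10 (by omega) (by omega)]
  exact h

/-- Induction on the list of the emptied bucket. The rows still to come are marked though no longer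
stored; by the assumption on representatives, none of them is the representative of another row of
the list, so their marks do no harm. Each row costs at most 40 units, apart from buckets opened in
the two frames. -/
theorem wp_distribute {E : Env} {b : ℕ → ℕ → ℕ} {Q : St → Prop} {K p : ℕ} (hK : K + 1 < E.rows)
    (hp : p < E.nv) (l : List ℕ) :
    ∀ (s : St) (S S' : Finset ℕ), Ctx E b s → s.r 1 = K → s.r 2 = K + 1 → s.r 3 = p + 1 →
    Chain (s.mem 9 K) (s.v 8) l → l.Nodup →
    (∀ t ∈ l, t ∉ S ∧ ∀ u ∈ l, rep E.nv E.nt b (p + 1) t = u → u = t) →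
    FrameAt E s.mem K S (S ∪ l.toFinset) (nextZero E.nv b · (p + 1)) →
    FrameAt E s.mem (K + 1) S' S' (nextZero E.nv b · (p + 1)) →
    (∀ (s' : St) (U : Finset ℕ), U = live E.nv b (p + 1) (l.toFinset.image (rep E.nv E.nt b (p + 1))) →
      s'.out = s.out → s'.r = s.r → (∀ x, x < 8 ∨ 14 < x → s'.v x = s.v x) →
      (∀ a k', (a < 7 ∨ 10 < a ∨ (k' ≠ K ∧ k' ≠ K + 1)) → s'.mem a k' = s.mem a k') →
      FrameAt E s'.mem K (S ∪ U) (S ∪ U) (nextZero E.nv b · (p + 1)) →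
      FrameAt E s'.mem (K + 1) (S' ∪ U) (S' ∪ U) (nextZero E.nv b · (p + 1)) →
      s'.clock + E.opening * (used S (nextZero E.nv b · (p + 1)) +
          used S' (nextZero E.nv b · (p + 1))) ≤ s.clock + 2 + 40 * l.length +
        E.opening * (used (S ∪ U) (nextZero E.nv b · (p + 1)) +
          used (S' ∪ U) (nextZero E.nv b · (p + 1))) → Q s') →
    wp E distribute Q s := by
  have hw : E.width = 2 * (E.nv + E.nt) := rfl
  have hr : E.rows = E.nv + E.nt + 2 := rfl
  induction l with
  | nil =>
    intro s S S' hs h1 h2 h3 hc _ _ hF hF' hQ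
    have h0 : s.v 8 = 0 := hc
    refine wp_loop_of_not_lt (by rw [h0]; omega) ?_
    refine hQ _ ∅ (by simp [live]) rfl rfl (fun _ _ => rfl) (fun _ _ _ => rfl) ?_ ?_ ?_
    · simpa using hF
    · simpa using hF'
    · simp
  | cons t l ih =>
    intro s S S' hs h1 h2 h3 hc hnd hl hF hF' hQ
    obtain ⟨h8, ht0, hc⟩ := hc
    obtain ⟨htl, hnd⟩ := List.nodup_cons.1 hnd
    obtain ⟨ht1, htm⟩ := hF.mem t (by simp)
    have e1 := hs.tables.rep (p + 1) (by omega) t ht1 htm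
    obtain ⟨hu1, hum⟩ := Monotone.rep_mem (n := E.nv) (b := b) (p + 1) ht1 htm
    have hul : rep E.nv E.nt b (p + 1) t ∉ l := fun hmem =>
      htl ((hl t (by simp)).2 _ (by simp [hmem]) rfl ▸ hmem)
    set u := rep E.nv E.nt b (p + 1) t with hu
    have e2 := hs.tables.nz (p + 1) (by omega) u hu1 hum
    refine wp_loop_of_lt (by rw [h8, hs.zero]; omega) ?_
    simp only [wp_block_cons, wp_atom, wp_ite, Atom.ok, Atom.next, St.tick_v,
      St.tick_r, St.tick_mem, St.setv_v, St.setv_r, St.setv_mem, h1, h3, h8, e1, e2,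
      Function.update_self, ne_eq, Nat.reduceEqDiff, not_false_eq_true,
      Function.update_of_ne, St.setm_mem, St.setm_v, St.setm_r, upd_of_ne, hs.zero, hs.nv,
      OfNat.zero_ne_ofNat]
    refine ⟨⟨by omega, by omega⟩, ⟨by omega, by omega⟩, ⟨by omega, by omega⟩,
      ⟨by omega, by omega⟩, ?_⟩
    have hF1 : FrameAt E (upd s.mem 10 K t 0) K S (S ∪ l.toFinset)
        (nextZero E.nv b · (p + 1)) := by
      have h := hF.unmark (t := t) (hl t (by simp)).1
      have he : (S ∪ (t :: l).toFinset).erase t = S ∪ l.toFinset := by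
        ext v
        have h3 := (hl t (by simp)).1
        simp only [Finset.mem_erase, Finset.mem_union, List.mem_toFinset, List.mem_cons]
        constructor
        · rintro ⟨hne, hv | rfl | hv⟩
          · exact .inl hv
          · exact absurd rfl hne
          · exact .inr hv
        · rintro (hv | hv)
          · exact ⟨fun e => h3 (e ▸ hv), .inl hv⟩
          · exact ⟨fun e => htl (e ▸ hv), .inr (.inr hv)⟩
      rw [he] at h
      simpa [FrameAt] using h
    have hF1' : FrameAt E (upd s.mem 10 K t 0) (K + 1) S' S' (nextZero E.nv b · (p + 1)) :=
      FrameAt.congr hF' fun a _ _ => upd_row_of_ne _ (.inr (by omega))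
    have hul' : u ∈ S ∪ l.toFinset → u ∈ S := fun h => by
      rcases Finset.mem_union.1 h with h | h
      · exact h
      · exact absurd (List.mem_toFinset.1 h) hul
    -- The common continuation of both cases: `V` is the representative as a singleton if it has a
    -- further zero, and empty otherwise.
    have key : ∀ (s1 : St) (V : Finset ℕ),
        V = live E.nv b (p + 1) {u} → s1.v 9 = s.mem 9 K t → s1.out = s.out → s1.r = s.r →
        (∀ x, x < 8 ∨ 14 < x → s1.v x = s.v x) →
        (∀ a k', (a < 7 ∨ 10 < a ∨ (k' ≠ K ∧ k' ≠ K + 1)) → s1.mem a k' = s.mem a k') →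
        (∀ v ∈ l, s1.mem 9 K v = s.mem 9 K v) →
        FrameAt E s1.mem K (S ∪ V) (S ∪ V ∪ l.toFinset) (nextZero E.nv b · (p + 1)) →
        FrameAt E s1.mem (K + 1) (S' ∪ V) (S' ∪ V) (nextZero E.nv b · (p + 1)) →
        s1.clock + E.opening * (used S (nextZero E.nv b · (p + 1)) +
          used S' (nextZero E.nv b · (p + 1))) ≤ s.clock + 39 +
        E.opening * (used (S ∪ V) (nextZero E.nv b · (p + 1)) +
          used (S' ∪ V) (nextZero E.nv b · (p + 1))) →
        wp E distribute Q ((s1.setv 8 (s1.v 9)).tick 1) := by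
      intro s1 V hV g9 gout gr gv gm gl gF gF' gc
      have hs1 : Ctx E b s1 := hs.congr (fun x hx => gv x (by omega)) (by rw [gr])
        (fun a ha => funext fun k' => gm a k' (by omega))
      have hVu : ∀ v ∈ V, v = u := fun v hv => by
        rw [hV, mem_live] at hv
        simpa using hv.1
      refine ih _ (S ∪ V) (S' ∪ V) ?_ ?_ ?_ ?_ ?_ hnd ?_ gF gF' ?_
      · refine hs1.congr (fun x hx => ?_) rfl (fun _ _ => rfl)
        simp only [St.tick_v, St.setv_v]
        rw [Function.update_of_ne (by omega)]
      · simp [gr, h1]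
      · simp [gr, h2]
      · simp [gr, h3]
      · simp only [St.tick_v, St.setv_v, St.tick_mem, St.setv_mem, Function.update_self, g9]
        exact hc.congr gl
      · intro v hv
        refine ⟨fun h => ?_, fun w hw => (hl v (by simp [hv])).2 w (by simp [hw])⟩
        rcases Finset.mem_union.1 h with h | h
        · exact (hl v (by simp [hv])).1 h
        · exact hul (hVu v h ▸ hv)
      · intro s' U hU k1 k2 k3 k4 k5 k6 k7
        have hUV : V ∪ U = live E.nv b (p + 1)
            ((t :: l).toFinset.image (rep E.nv E.nt b (p + 1))) := by
          rw [hV, hU]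
          simp only [live, List.toFinset_cons, Finset.image_insert, ← hu, Finset.filter_union,
            Finset.insert_eq u]
        refine hQ s' (V ∪ U) hUV (k1.trans gout) (k2.trans gr) (fun x hx => ?_)
          (fun a k' hak => (k4 a k' hak).trans (gm a k' hak)) ?_ ?_ ?_
        · rw [k3 x hx]
          simp only [St.tick_v, St.setv_v]
          rw [Function.update_of_ne (by omega), gv x hx]
        · rwa [← Finset.union_assoc]
        · rwa [← Finset.union_assoc]
        · simp only [St.tick_clock, St.setv_clock] at k7
          rw [← Finset.union_assoc, ← Finset.union_assoc, List.length_cons]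
          omega
    by_cases hz : nextZero E.nv b u (p + 1) < E.nv
    · rw [if_pos hz]
      have hV : {u} = live E.nv b (p + 1) {u} := by
        ext v
        simp only [Finset.mem_singleton, mem_live]
        exact ⟨fun h => ⟨h, h ▸ hz⟩, fun h => h.1⟩
      refine wp_insertRow (b := b) (k := K + 1) (t := u) (S := S') (P := S')
        (z := (nextZero E.nv b · (p + 1))) (hs.congr (fun x hx => ?_) rfl
          (fun a ha => ?_)) ?_ hK ?_ hu1 hum ?_ hz ?_ id ?_
      · simp only [St.tick_v, St.setv_v, St.setm_v]
        rw [Function.update_of_ne (by omega), Function.update_of_ne (by omega),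
          Function.update_of_ne (by omega)]
      · simp only [St.tick_mem, St.setv_mem, St.setm_mem]
        rw [upd_of_ne _ (by omega)]
      · simpa using h2
      · simp
      · simp
      · simpa only [St.tick_mem, St.setv_mem, St.setm_mem] using hF1'
      intro s1 a1 a2 a3 a4 a5 a6 a7
      have hs1 : Ctx E b s1 := by
        refine hs.congr (fun x hx => ?_) (by rw [a2]; rfl) (fun a ha => funext fun k' => ?_)
        · rw [a3 x (by omega)]
          simp only [St.tick_v, St.setv_v, St.setm_v]
          rw [Function.update_of_ne (by omega), Function.update_of_ne (by omega),
            Function.update_of_ne (by omega)]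
        · rw [a4 a k' (by omega)]
          simp only [St.tick_mem, St.setv_mem, St.setm_mem]
          rw [upd_of_ne _ (by omega)]
      refine wp_insertRow (b := b) (k := K) (t := u) (S := S) (P := S ∪ l.toFinset)
        (z := (nextZero E.nv b · (p + 1))) hs1 ?_ (by omega) ?_ hu1 hum ?_ hz ?_ hul' ?_
      · rw [a2]; simpa using h1
      · rw [a3 10 (by omega)]; simp
      · rw [a3 11 (by omega)]; simp
      · refine FrameAt.congr hF1 fun a _ _ => ?_
        rw [a4 a K (by omega)]
        rfl
      intro s2 b1 b2 b3 b4 b5 b6 b7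
      have hins : ∀ W : Finset ℕ, insert u W = W ∪ {u} := fun W => by
        rw [Finset.insert_eq, Finset.union_comm]
      rw [wp_block_single, wp_atom]
      refine ⟨trivial, key s2 {u} hV ?_ ?_ ?_ ?_ ?_ ?_ ?_ ?_ ?_⟩
      · rw [b3 9 (by omega), a3 9 (by omega)]; simp
      · rw [b1, a1]; rfl
      · rw [b2, a2]; rfl
      · intro x hx
        rw [b3 x (by omega), a3 x (by omega)]
        simp only [St.tick_v, St.setv_v, St.setm_v]
        rw [Function.update_of_ne (by omega), Function.update_of_ne (by omega),
          Function.update_of_ne (by omega)]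
      · intro a k' hak
        rw [b4 a k' (by omega), a4 a k' (by omega)]
        simp only [St.tick_mem, St.setv_mem, St.setm_mem]
        rw [upd_row_of_ne _ (by omega)]
      · intro v hv
        rw [b5 v (by simp [hv]), a4 9 K (by omega)]
        simp
      · rw [hins, hins] at b6
        rwa [Finset.union_right_comm]
      · rw [hins] at a6
        exact FrameAt.congr a6 fun a _ _ => b4 a _ (by omega)
      · simp only [St.tick_clock, St.setv_clock, St.setm_clock] at a7
        rw [hins] at a7 b7
        rw [mul_add, mul_add]
        omega
    · rw [if_neg hz]
      have hV : ∅ = live E.nv b (p + 1) {u} := by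
        ext v
        simp only [Finset.notMem_empty, mem_live, Finset.mem_singleton, false_iff]
        rintro ⟨rfl, h⟩
        exact hz h
      simp only [block, wp_atom, Atom.ok, Atom.next, true_and]
      refine key _ ∅ hV ?_ ?_ ?_ ?_ ?_ ?_ ?_ ?_ ?_
      · simp
      · simp
      · simp
      · intro x hx
        by_cases hx2 : x = 2
        · subst hx2; simp [hs.zero]
        · simp only [St.tick_v, St.setv_v, St.setm_v, Function.update_apply, if_neg hx2]
          split_ifs <;> omega
      · intro a k' hak
        simp only [St.tick_mem, St.setv_mem, St.setm_mem]
        rw [upd_row_of_ne _ (by omega)]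
      · intro v hv
        simp
      · simpa using hF1
      · simpa using hF1'
      · simp only [Finset.union_empty]
        simp only [St.tick_clock, St.setv_clock, St.setm_clock]
        omega

end While

/-! ### The invariant of the main loop and its amortised analysis -/

namespace While

open Monotone (nextZero rep zeros down rest words count work Canonical Rows)

/-- The main loop is about to process frame `K` at position `i`, with rows `A` and word `α`. -/
structure Run (E : Env) (b : ℕ → ℕ → ℕ) (K i : ℕ) (A : Finset ℕ) (α : ℕ → ℕ) (s : St) : Prop where
  ctx : Ctx E b s
  go : s.v 15 = 1
  level : s.v 4 = K
  level_le : K ≤ i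
  le : i ≤ E.nv
  canonical : Canonical E.nv E.nt b i A
  ones : ∀ j, i ≤ j → j < E.nv → α j = 1
  word : ∀ j < E.nv, s.mem 0 0 j = α j
  -- Rows without a further zero lead to no further word and are not stored.
  frame : FrameAt E s.mem K (live E.nv b i A) (live E.nv b i A) (nextZero E.nv b · i)
  -- An exhausted frame is empty again, so frames never have to be initialised before reuse.
  clean : ∀ k, K < k → k ≤ E.nv + 1 → FrameAt E s.mem k ∅ ∅ fun _ => 0

/-- The frames below level `K` and the stack below `K` are unchanged. -/
def Keep (K : ℕ) (s s' : St) : Prop :=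
  ∀ k < K, (∀ a, 7 ≤ a → a ≤ 10 → s'.mem a k = s.mem a k) ∧ s'.mem 4 0 k = s.mem 4 0 k

theorem Keep.trans {K : ℕ} {s s' s'' : St} (h : Keep K s s') (h' : Keep K s' s'') :
    Keep K s s'' := fun k hk =>
  ⟨fun a h1 h2 => ((h' k hk).1 a h1 h2).trans ((h k hk).1 a h1 h2),
    (h' k hk).2.trans (h k hk).2⟩

theorem Keep.mono {K L : ℕ} {s s' : St} (h : Keep L s s') (hKL : K ≤ L) : Keep K s s' :=
  fun k hk => h k (by omega)

section

variable {n m : ℕ} {b : ℕ → ℕ → ℕ} {i : ℕ} {A : Finset ℕ}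

theorem live_eq_of_zeros_empty (hi : i < n) (h : zeros b i A = ∅) {t : ℕ} (ht : t ∈ A) :
    nextZero n b t i = nextZero n b t (i + 1) := by
  refine Monotone.nextZero_of_ne_zero hi fun h0 => ?_
  have := Monotone.mem_zeros.2 ⟨ht, h0⟩
  simp [h] at this

theorem live_succ (hi : i < n) (h : zeros b i A = ∅) : live n b (i + 1) A = live n b i A := by
  ext t
  simp only [mem_live]
  refine and_congr_right fun ht => ?_
  rw [live_eq_of_zeros_empty hi h ht]

/-- The rows outside bucket `i` are those with entry 1 at `i`; adding the representatives of the
removed rows to the same frame therefore turns it into the frame of the branch with value 1. -/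
theorem live_filter_union (hi : i < n) :
    (live n b i A).filter (fun t => nextZero n b t i ≠ i) ∪ live n b (i + 1) (down n m b i A) =
      live n b (i + 1) (rest n m b i A) := by
  ext t
  simp only [Finset.mem_union, Finset.mem_filter, mem_live, Monotone.mem_rest, ne_eq,
    Monotone.nextZero_eq_self_iff hi, or_and_right]
  refine or_congr_left ⟨fun ⟨⟨h1, h2⟩, h3⟩ => ⟨⟨h1, h3⟩, ?_⟩, fun ⟨⟨h1, h3⟩, h2⟩ => ⟨⟨h1, ?_⟩, h3⟩⟩
  · rwa [← Monotone.nextZero_of_ne_zero hi h3]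
  · rwa [Monotone.nextZero_of_ne_zero hi h3]

theorem live_self : live n b n A = ∅ := by
  ext t
  simp [mem_live, Monotone.nextZero_of_ge]

end

/-- Bucket `i` consists of exactly the rows of `A` with entry 0 at `i`. Its distribution leaves the
branch with value 1 in frame `K`, to be resumed later, and puts the branch with value 0 into frame
`K + 1`. -/
theorem wp_push {E : Env} {b : ℕ → ℕ → ℕ} {Q : St → Prop} {K i : ℕ} {A : Finset ℕ} {α : ℕ → ℕ}
    {s : St} (hR : Rows E.nv E.nt b) (hs : Run E b K i A α s) (hi : i < E.nv) (hne : zeros b i A ≠ ∅)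
    (hQ : ∀ s' : St, Run E b (K + 1) (i + 1) (down E.nv E.nt b i A) (Function.update α i 0) s' →
      FrameAt E s'.mem K (live E.nv b (i + 1) (rest E.nv E.nt b i A))
        (live E.nv b (i + 1) (rest E.nv E.nt b i A)) (nextZero E.nv b · (i + 1)) →
      s'.mem 4 0 K = i → Keep K s s' →
      s'.out = s.out ++ [(List.range E.nv).map (Function.update α i 0)] →
      s'.clock + E.opening * used (live E.nv b i A) (nextZero E.nv b · i) ≤
        s.clock + 30 * E.opening + 40 * (zeros b i A).card +
        E.opening * (used (live E.nv b (i + 1) (rest E.nv E.nt b i A)) (nextZero E.nv b · (i + 1)) +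
          used (live E.nv b (i + 1) (down E.nv E.nt b i A)) (nextZero E.nv b · (i + 1))) → Q s') :
    wp E mainBody Q (s.tick 2) := by
  obtain ⟨hc, hgo, hlev, hKi, hin, hcan, hones, hword, hF, hclean⟩ := hs
  have hw : E.width = 2 * (E.nv + E.nt) := rfl
  have hr : E.rows = E.nv + E.nt + 2 := rfl
  have hcap := cap_big E hc.nt_pos
  have hnt := hc.nt_pos
  obtain ⟨t0, ht0⟩ := Finset.nonempty_iff_ne_empty.2 hne
  rw [Monotone.mem_zeros] at ht0
  have hz0 : nextZero E.nv b t0 i = i := Monotone.nextZero_of_eq_zero hi ht0.2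
  have hroot : s.mem 7 K 1 = E.nv - i := hF.root_eq hi ⟨t0, mem_live.2 ⟨ht0.1, by omega⟩, hz0⟩
    fun t _ => Monotone.le_nextZero hin
  obtain ⟨l, hl1, hl2, hl3⟩ := hF.list i hi
  have hl : ∀ t, t ∈ l ↔ t ∈ zeros b i A := fun t => by
    rw [hl3, mem_live, Monotone.mem_zeros]
    constructor
    · rintro ⟨⟨h1, -⟩, h2⟩
      exact ⟨h1, (Monotone.nextZero_eq_self_iff hi).1 h2⟩
    · rintro ⟨h1, h2⟩
      have := Monotone.nextZero_of_eq_zero hi h2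
      exact ⟨⟨h1, by omega⟩, this⟩
  have hlf : l.toFinset = zeros b i A := by
    ext t
    rw [List.mem_toFinset, hl]
  have hlen : l.length = (zeros b i A).card := by
    rw [← hlf, List.toFinset_card_of_nodup hl2]
  have e3 := hc.tables.parent (E.nv + i) (by omega) (by omega)
  have hpos : 0 < E.nv - i := by omega
  have hsub : E.nv - (E.nv - i) = i := by omega
  simp only [mainBody, pushFrame, block, wp_seq, wp_atom, wp_ite, Atom.ok, Atom.next,
    St.tick_v, St.tick_r, St.tick_mem, St.setv_v, St.setv_r, St.setv_mem, St.setr_v, St.setr_r,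
    St.setr_mem, hlev, hc.zero, hc.one, hc.nv, hc.row, hroot, hsub,
    Function.update_self, ne_eq, Nat.reduceEqDiff, not_false_eq_true, OfNat.zero_ne_ofNat,
    OfNat.one_ne_ofNat, zero_ne_one, hpos, if_true,
    Function.update_of_ne, St.setm_mem, St.setm_v, St.setm_r, upd_of_ne, true_and, e3]
  refine ⟨by omega, by omega, by omega, ⟨by omega, by omega⟩, by omega, by omega,
    ⟨by omega, by omega⟩, ⟨by omega, by omega⟩, by omega, ⟨by omega, by omega⟩,
    ⟨by omega, by omega⟩, ?_⟩
  refine wp_fixTree (b := b) (k := K) ((E.nv + i) / 2) _ ?_ ?_ (by omega) ?_ (by omega) ?_ ?_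
  · refine hc.congr (fun x hx => ?_) ?_ (fun a ha => ?_)
    · simp only [St.tick_v, St.setv_v, St.setm_v, St.setr_v, Function.update_apply]
      split_ifs <;> omega
    · simp [hc.row]
    · simp only [St.tick_mem, St.setv_mem, St.setm_mem, St.setr_mem]
      rw [upd_of_ne _ (by omega), upd_of_ne _ (by omega)]
  · simp
  · simp
  · simp only [St.tick_mem, St.setv_mem, St.setm_mem, St.setr_mem, upd_same]
    intro v hv hvn hvu
    simp only [ne_eq, Nat.reduceEqDiff, not_false_eq_true, upd_of_ne]
    rw [Function.update_of_ne (by omega), Function.update_of_ne (by omega),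
      Function.update_of_ne (by omega)]
    exact hF.node v hv hvn (by omega)
  intro s1 g1 g2 g3 g4 g5 g6 g7
  have v0 : s1.v 0 = E.nv := by rw [g3 _ (by omega)]; simpa using hc.nv
  have v1 : s1.v 1 = E.nt := by rw [g3 _ (by omega)]; simpa using hc.nt
  have v2 : s1.v 2 = 0 := by rw [g3 _ (by omega)]; simpa using hc.zero
  have v3 : s1.v 3 = 1 := by rw [g3 _ (by omega)]; simpa using hc.one
  have v4 : s1.v 4 = K := by rw [g3 _ (by omega)]; simpa using hlev
  have v6 : s1.v 6 = i := by rw [g3 _ (by omega)]; simp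
  have v8 : s1.v 8 = s.mem 8 K i := by rw [g3 _ (by omega)]; simp
  have v15 : s1.v 15 = 1 := by rw [g3 _ (by omega)]; simpa using hgo
  have r0 : s1.r 0 = 0 := by rw [g2]; simpa using hc.row
  have r1 : s1.r 1 = K := by rw [g2]; simp
  have r2 : s1.r 2 = K + 1 := by rw [g2]; simp
  have r3 : s1.r 3 = i + 1 := by rw [g2]; simp
  have o1 : s1.out = s.out := by rw [g1]; rfl
  have m8 : s1.mem 8 K = Function.update (s.mem 8 K) i 0 := by rw [g4 8 K (by omega)]; simp
  have ma : ∀ a k, (a ≠ 7 ∧ a ≠ 8 ∨ k ≠ K) → s1.mem a k = s.mem a k := by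
    intro a k hak
    rw [g4 a k (by omega)]
    simp only [St.tick_mem, St.setv_mem, St.setm_mem, St.setr_mem]
    rw [upd_row_of_ne _ (by omega), upd_row_of_ne _ (by omega)]
  have hc1 : s1.clock ≤ s.clock + 15 + 43 * E.arith + 10 * (2 * E.nv).size := by
    have hsz : ((E.nv + i) / 2).size ≤ (2 * E.nv).size := Nat.size_le_size (by omega)
    simp only [St.tick_clock, St.setv_clock, St.setm_clock, St.setr_clock] at g7
    omega
  have hcs1 : Ctx E b s1 := by
    refine hc.congr (fun x hx => ?_) (by rw [r0, hc.row]) (fun a ha => funext fun k =>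
      ma a k (by omega))
    rw [g3 x (by omega)]
    simp only [St.tick_v, St.setv_v, St.setm_v, St.setr_v, Function.update_apply]
    split_ifs <;> omega
  have hFK : FrameAt E s1.mem K ((live E.nv b i A).filter (nextZero E.nv b · i ≠ i))
      (live E.nv b i A) (nextZero E.nv b · i) := by
    simp only [FrameAt]
    rw [m8, ma 9 K (by omega), ma 10 K (by omega)]
    refine hF.remove hi (fun q hq => ?_) g6
    rw [g5 _ (by omega)]
    simp only [St.tick_mem, St.setv_mem, St.setm_mem, St.setr_mem, upd_same, ne_eq,
      Nat.reduceEqDiff, not_false_eq_true, upd_of_ne]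
    by_cases hqi : q = i
    · subst hqi; simp
    · rw [if_neg hqi, Function.update_of_ne (by omega)]
  clear g1 g2 g3 g4 g5 g6 g7
  simp only [wp_seq, wp_atom, Atom.ok, Atom.next, St.tick_v, St.tick_r, St.tick_mem, r0, v0, v2,
    v4, v6, St.setm_mem, St.setm_v, St.setm_r]
  refine ⟨⟨by omega, by omega⟩, ⟨by omega, by omega⟩, ⟨by omega, by omega⟩, ?_⟩
  -- Rows outside bucket `i` have entry 1 there, so their next zero is the same from `i + 1` on.
  have hfilt : ∀ t ∈ (live E.nv b i A).filter (nextZero E.nv b · i ≠ i),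
      nextZero E.nv b t (i + 1) = nextZero E.nv b t i := by
    intro t ht
    have := (Finset.mem_filter.1 ht).2
    rw [ne_eq, Monotone.nextZero_eq_self_iff hi] at this
    exact (Monotone.nextZero_of_ne_zero hi this).symm
  have hlsplit : (live E.nv b i A).filter (nextZero E.nv b · i ≠ i) ∪ l.toFinset =
      live E.nv b i A := by
    ext t
    rw [Finset.mem_union, List.mem_toFinset, hl3, Finset.mem_filter]
    tauto
  have hdown : l.toFinset.image (rep E.nv E.nt b (i + 1)) = down E.nv E.nt b i A := by
    rw [hlf]; rfl
  refine wp_distribute (b := b) (K := K) (p := i) (by omega) hi l _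
    ((live E.nv b i A).filter (nextZero E.nv b · i ≠ i)) ∅ ?_ ?_ ?_ ?_ ?_ hl2 ?_ ?_ ?_ ?_
  · refine hcs1.congr (fun x hx => rfl) rfl (fun a ha => ?_)
    simp only [St.tick_mem, St.push_mem, St.setm_mem]
    rw [upd_of_ne _ (by omega), upd_of_ne _ (by omega)]
  · simpa using r1
  · simpa using r2
  · simpa using r3
  · simp only [St.tick_mem, St.push_mem, St.setm_mem, St.tick_v, St.push_v, St.setm_v, ne_eq,
      OfNat.ofNat_ne_zero, Nat.reduceEqDiff, not_false_eq_true, upd_of_ne, v8]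
    rw [ma 9 K (by omega)]
    exact hl1
  · intro t ht
    refine ⟨fun h => (Finset.mem_filter.1 h).2 ((hl3 t).1 ht).2, fun u hu he => ?_⟩
    rw [hl] at ht hu
    have hu' := hu
    rw [Monotone.mem_zeros] at hu'
    obtain ⟨h1, h2, -⟩ := hcan u hu'.1
    obtain ⟨t1, t2, -⟩ := hcan t (Monotone.mem_zeros.1 ht).1
    refine (hR.rep_injOn hcan ht hu ?_).symm
    have h3 := Monotone.rep_same (n := E.nv) (m := E.nt) (b := b) (i + 1) t
    rw [he] at h3
    exact hR.rep_congr (i + 1) t1 t2 h1 h2 h3.symm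
  · rw [hlsplit]
    refine (FrameAt.congr hFK fun a ha ha' => ?_).congr_pos hfilt
    simp only [St.tick_mem, St.push_mem, St.setm_mem]
    rw [upd_of_ne _ (by omega), upd_of_ne _ (by omega)]
  · refine (FrameAt.congr (hclean (K + 1) (by omega) (by omega)) fun a ha ha' => ?_).congr_pos
      (by simp)
    simp only [St.tick_mem, St.push_mem, St.setm_mem]
    rw [upd_of_ne _ (by omega), upd_of_ne _ (by omega), ma a _ (by omega)]
  intro s2 U hU k1 k2 k3 k4 k5 k6 k7
  rw [hdown] at hU
  subst hU
  rw [live_filter_union hi] at k5 k7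
  rw [Finset.empty_union] at k6 k7
  simp only [St.tick_mem, St.push_mem, St.setm_mem, St.tick_v, St.push_v, St.setm_v, St.tick_r,
    St.push_r, St.setm_r, St.tick_out, St.push_out, St.setm_out, St.tick_clock, St.push_clock,
    St.setm_clock] at k1 k2 k3 k4 k7
  have mX : s2.mem 0 0 = Function.update (s.mem 0 0) i 0 := by
    rw [k4 0 0 (by omega)]
    simp only [upd_same, ne_eq, OfNat.zero_ne_ofNat, not_false_eq_true, upd_of_ne]
    rw [ma 0 0 (by omega)]
  have mP : s2.mem 4 0 = Function.update (s.mem 4 0) K i := by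
    rw [k4 4 0 (by omega)]
    simp only [upd_same, ne_eq, OfNat.ofNat_ne_zero, not_false_eq_true, upd_of_ne]
    rw [ma 4 0 (by omega)]
  have mb : ∀ a k, a ≠ 0 → a ≠ 4 → (a < 7 ∨ 10 < a ∨ (k ≠ K ∧ k ≠ K + 1)) →
      s2.mem a k = s.mem a k := by
    intro a k h0 h4 hak
    rw [k4 a k hak, upd_of_ne _ h0, upd_of_ne _ h4, ma a k (by omega)]
  simp only [wp_atom, Atom.ok, Atom.next]
  rw [k3 4 (by omega), k3 3 (by omega), v4, v3]
  refine ⟨by omega, ?_⟩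
  refine hQ _ ⟨?_, ?_, ?_, by omega, by omega, hR.canonical_down hcan, ?_, ?_, ?_, ?_⟩ ?_ ?_ ?_ ?_ ?_
  · refine hc.congr (fun x hx => ?_) ?_ (fun a ha => funext fun k => mb a k (by omega) (by omega)
      (by omega))
    · simp only [St.tick_v, St.setv_v]
      rw [Function.update_of_ne (by omega), k3 x (by omega)]
      obtain rfl | rfl | rfl | rfl : x = 0 ∨ x = 1 ∨ x = 2 ∨ x = 3 := by omega
      · rw [v0, hc.nv]
      · rw [v1, hc.nt]
      · rw [v2, hc.zero]
      · rw [v3, hc.one]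
    · simp [k2, r0, hc.row]
  · simp only [St.tick_v, St.setv_v]
    rw [Function.update_of_ne (by omega), k3 _ (by omega), v15]
  · simp
  · intro j h1 h2
    rw [Function.update_of_ne (by omega)]
    exact hones j (by omega) h2
  · intro j hj
    simp only [St.tick_mem, St.setv_mem, mX]
    by_cases hji : j = i
    · subst hji; simp
    · rw [Function.update_of_ne hji, Function.update_of_ne hji, hword j hj]
  · exact k6
  · intro k h1 h2
    refine FrameAt.congr (hclean k (by omega) h2) fun a ha ha' => ?_
    exact mb a k (by omega) (by omega) (by omega)
  · exact k5
  · simp [mP]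
  · intro k hk
    refine ⟨fun a h1 h2 => mb a k (by omega) (by omega) (by omega), ?_⟩
    simp only [St.tick_mem, St.setv_mem, mP]
    rw [Function.update_of_ne (by omega)]
  · simp only [St.tick_out, St.setv_out, k1, o1]
    congr 2
    refine List.map_congr_left fun j hj => ?_
    rw [List.mem_range] at hj
    rw [upd_same, upd_of_ne _ (by omega), ma 0 0 (by omega)]
    by_cases hji : j = i
    · subst hji; simp
    · rw [Function.update_of_ne hji, Function.update_of_ne hji, hword j hj]
  -- Emptying bucket `i`, which contains `t0`, lowers the number of used buckets by exactly one;
  -- this one opening is covered by the constant 30.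
  · have hused : used ((live E.nv b i A).filter (nextZero E.nv b · i ≠ i))
        (nextZero E.nv b · (i + 1)) + 1 = used (live E.nv b i A) (nextZero E.nv b · i) := by
      simp only [used]
      rw [Finset.image_congr (g := (nextZero E.nv b · i)) fun t ht => hfilt t ht]
      rw [← Finset.card_insert_of_notMem (a := i)]
      · congr 1
        ext q
        simp only [Finset.mem_insert, Finset.mem_image, Finset.mem_filter]
        constructor
        · rintro (rfl | ⟨t, ⟨h1, -⟩, h2⟩)
          · exact ⟨t0, mem_live.2 ⟨ht0.1, by omega⟩, hz0⟩
          · exact ⟨t, h1, h2⟩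
        · rintro ⟨t, h1, h2⟩
          by_cases hqi : q = i
          · exact .inl hqi
          · exact .inr ⟨t, ⟨h1, by omega⟩, h2⟩
      · simp only [Finset.mem_image, Finset.mem_filter, not_exists]
        rintro t ⟨⟨-, h1⟩, h2⟩
        exact h1 h2
    have hemp : used ∅ (nextZero E.nv b · (i + 1)) = 0 := by simp [used]
    rw [hemp, add_zero] at k7
    rw [← hused, mul_add, mul_one]
    simp only [St.tick_clock, St.setv_clock]
    have hD : E.opening = 2 * E.arith + 10 * (2 * E.nv).size + 10 := rfl
    rw [hlen] at k7
    omega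

/-- The upper frame is exhausted, so its root is 0. Frame `K` already holds the branch with value 1;
the saved position tells where the word has to be set back to 1. -/
theorem wp_pop {E : Env} {b : ℕ → ℕ → ℕ} {Q : St → Prop} {K i : ℕ} {A : Finset ℕ} {α : ℕ → ℕ}
    {s : St} (hs : Run E b (K + 1) E.nv ∅ (Function.update α i 0) s) (hKi : K ≤ i) (hi : i < E.nv)
    (hcan : Canonical E.nv E.nt b (i + 1) A) (hones : ∀ j, i ≤ j → j < E.nv → α j = 1)
    (hF : FrameAt E s.mem K (live E.nv b (i + 1) A) (live E.nv b (i + 1) A)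
      (nextZero E.nv b · (i + 1)))
    (hst : s.mem 4 0 K = i)
    (hQ : ∀ s' : St, Run E b K (i + 1) A α s' → Keep K s s' → s'.out = s.out →
      s'.clock ≤ s.clock + 30 * E.opening → Q s') :
    wp E mainBody Q (s.tick 2) := by
  obtain ⟨hc, hgo, hlev, -, -, -, -, hword, hFe, hclean⟩ := hs
  have hw : E.width = 2 * (E.nv + E.nt) := rfl
  have hr : E.rows = E.nv + E.nt + 2 := rfl
  have hcap := cap_big E hc.nt_pos
  have hnt := hc.nt_pos
  rw [live_self] at hFe
  have hroot : s.mem 7 (K + 1) 1 = 0 := hFe.root_of_empty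
  simp only [mainBody, popFrame, block, wp_seq, wp_atom, wp_ite, Atom.ok, Atom.next,
    St.tick_v, St.tick_r, St.tick_mem, St.setv_v, St.setv_r, St.setv_mem, St.setr_v, St.setr_r,
    St.setr_mem, hlev, hc.zero, hc.one, hc.row, hroot, hst, lt_irrefl, if_false, Nat.succ_pos,
    Function.update_self, ne_eq, Nat.reduceEqDiff, not_false_eq_true, OfNat.zero_ne_ofNat,
    OfNat.one_ne_ofNat, zero_ne_one, if_true, Nat.add_sub_cancel,
    Function.update_of_ne, true_and]
  refine ⟨by omega, by omega, by omega, ⟨by omega, by omega⟩, ⟨by omega, by omega⟩,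
    ⟨by omega, by omega⟩, ?_⟩
  refine hQ _ ⟨?_, ?_, ?_, by omega, by omega, hcan, fun j h1 h2 => hones j (by omega) h2, ?_, ?_,
    ?_⟩ ?_ ?_ ?_
  · refine hc.congr (fun x hx => ?_) ?_ (fun a ha => ?_)
    · simp only [St.tick_v, St.setv_v, St.setm_v, St.setr_v, Function.update_apply]
      split_ifs <;> omega
    · simp [hc.row]
    · simp only [St.tick_mem, St.setv_mem, St.setm_mem, St.setr_mem]
      rw [upd_of_ne _ (by omega)]
  · simpa using hgo
  · simp
  · intro j hj
    simp only [St.tick_mem, St.setv_mem, St.setm_mem, St.setr_mem, upd_same]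
    by_cases hji : j = i
    · subst hji; simp [hones j le_rfl hj]
    · rw [Function.update_of_ne hji, hword j hj, Function.update_of_ne hji]
  · refine FrameAt.congr hF fun a ha ha' => ?_
    simp only [St.tick_mem, St.setv_mem, St.setm_mem, St.setr_mem]
    rw [upd_of_ne _ (by omega)]
  · intro k h1 h2
    have : FrameAt E s.mem k ∅ ∅ fun _ => 0 := by
      -- The frame just left joins the clean ones, because it is empty.
      rcases Nat.eq_or_lt_of_le (show K + 1 ≤ k from h1) with rfl | hlt
      · exact hFe.congr_pos (by simp)
      · exact hclean k hlt h2
    refine FrameAt.congr this fun a ha ha' => ?_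
    simp only [St.tick_mem, St.setv_mem, St.setm_mem, St.setr_mem]
    rw [upd_of_ne _ (by omega)]
  · intro k hk
    constructor
    · intro a h1 h2
      simp only [St.tick_mem, St.setv_mem, St.setm_mem, St.setr_mem]
      rw [upd_of_ne _ (by omega)]
    · simp
  · simp
  · have hD : E.opening = 2 * E.arith + 10 * (2 * E.nv).size + 10 := rfl
    simp only [St.tick_clock, St.setv_clock, St.setm_clock, St.setr_clock]
    omega

/-- The induction follows the recursion of `words`. Where no row has entry 0 the machine does
nothing: the same state satisfies the invariant at `i + 1`. Otherwise it pushes, treats value 0,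
pops, and treats value 1. The buckets open at the start appear on the left: their opening was
charged earlier, and they are credited here. Push and pop, 30 openings each, fit into the 61 per
word. -/
theorem wp_run {E : Env} {b : ℕ → ℕ → ℕ} (hR : Rows E.nv E.nt b) (f : ℕ) :
    ∀ (K i : ℕ) (A : Finset ℕ) (α : ℕ → ℕ) (s : St) (Q : St → Prop), i + f = E.nv →
    Run E b K i A α s →
    (∀ s' : St, Run E b K E.nv ∅ α s' → Keep K s s' →
      s'.out = s.out ++ (words E.nv E.nt b f i A α).map (fun β => (List.range E.nv).map β) →
      s'.clock + E.opening * used (live E.nv b i A) (nextZero E.nv b · i) ≤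
        s.clock + 61 * E.opening * count E.nv E.nt b f i A + 40 * work E.nv E.nt b f i A →
      wp E mainLoop Q s') → wp E mainLoop Q s := by
  induction f with
  | zero =>
    intro K i A α s Q hi hs hQ
    obtain rfl : i = E.nv := by omega
    refine hQ s ?_ ?_ (by simp [words]) ?_
    · obtain ⟨h1, h2, h3, h4, h5, h6, h7, h8, h9, h10⟩ := hs
      refine ⟨h1, h2, h3, h4, h5, by simp [Canonical], h7, h8, ?_, h10⟩
      rw [live_self] at h9 ⊢
      exact h9
    · exact fun k hk => ⟨fun _ _ _ => rfl, rfl⟩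
    · rw [live_self]
      simp only [used, Finset.image_empty, Finset.card_empty]
      omega
  | succ f ih =>
    intro K i A α s Q hi hs hQ
    have hin : i < E.nv := by omega
    by_cases hz : zeros b i A = ∅
    · simp only [words, count, work, if_pos hz] at hQ
      have hlive : ∀ t ∈ live E.nv b i A, nextZero E.nv b t (i + 1) = nextZero E.nv b t i :=
        fun t ht => (live_eq_of_zeros_empty hin hz (mem_live.1 ht).1).symm
      refine ih K (i + 1) A α s Q (by omega) ?_ ?_
      · obtain ⟨h1, h2, h3, h4, h5, h6, h7, h8, h9, h10⟩ := hs
        refine ⟨h1, h2, h3, by omega, by omega, hR.canonical_succ h6 hz,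
          fun j g1 g2 => h7 j (by omega) g2, h8, ?_, h10⟩
        rw [live_succ hin hz]
        exact h9.congr_pos hlive
      · intro s' g1 g2 g3 g4
        refine hQ s' g1 g2 g3 ?_
        have : used (live E.nv b (i + 1) A) (nextZero E.nv b · (i + 1)) =
            used (live E.nv b i A) (nextZero E.nv b · i) := by
          rw [live_succ hin hz]
          simp only [used]
          rw [Finset.image_congr fun t ht => hlive t ht]
        rwa [this] at g4
    · simp only [words, count, work, if_neg hz] at hQ
      have hloop : ∀ {K' j : ℕ} {A' : Finset ℕ} {α' : ℕ → ℕ} {s' : St}, Run E b K' j A' α' s' →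
          wp E mainBody (wp E mainLoop Q) (s'.tick 2) → wp E mainLoop Q s' := fun h hw =>
        wp_loop_of_lt (by rw [h.ctx.zero, h.go]; omega) hw
      refine hloop hs (wp_push hR hs hin hz ?_)
      intro s1 a1 a2 a3 a4 a5 a6
      refine ih (K + 1) (i + 1) _ _ s1 Q (by omega) a1 ?_
      intro s2 b1 b2 b3 b4
      have hKi := hs.level_le
      have b5 := b2 K (by omega)
      refine hloop b1 (wp_pop b1 hs.level_le hin (hR.canonical_rest hs.canonical) hs.ones
        (FrameAt.congr a2 b5.1) (b5.2.trans a3) ?_)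
      intro s3 c1 c2 c3 c4
      refine ih K (i + 1) _ _ s3 Q (by omega) c1 ?_
      intro s4 d1 d2 d3 d4
      refine hQ s4 d1 ?_ ?_ ?_
      · exact ((a4.trans (b2.mono (by omega))).trans c2).trans d2
      · rw [d3, c3, b3, a5]
        simp
      · rw [mul_add, mul_add, mul_one]
        rw [mul_add] at a6
        have : 61 * E.opening = 60 * E.opening + E.opening := by ring
        omega

end While

/-! ### Precomputation -/

namespace While

open Monotone (nextZero rep SameFrom repAux)

/-- Repeat `c` while scalar `x`, which is increased by one after each round, is below scalar
`y`. -/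
def forLoop (x y : ℕ) (c : Cmd) : Cmd := .loop x y (.seq c (.atom (.add x x 3)))

/-- The invariant is indexed by the loop variable. The bound `max a N` allows for a start beyond
`N`, in which case the body is not executed. -/
theorem wp_forLoop {E : Env} {Q : St → Prop} {x y N : ℕ} {c : Cmd} (I : ℕ → St → Prop)
    (hN : N ≤ E.cap) (hI : ∀ j s, I j s → s.v x = j ∧ s.v y = N)
    (hbody : ∀ j < N, ∀ s, I j s → wp E c (fun s' => s'.v x = j ∧ s'.v 3 = 1 ∧
      I (j + 1) ((s'.setv x (j + 1)).tick E.arith)) (s.tick 2)) (d : ℕ) :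
    ∀ (a : ℕ) (s : St), N - a = d → I a s →
      (∀ j s', N ≤ j → j ≤ max a N → I j s' → Q (s'.tick 2)) → wp E (forLoop x y c) Q s := by
  induction d with
  | zero =>
    intro a s hd hs hQ
    obtain ⟨h1, h2⟩ := hI a s hs
    exact wp_loop_of_not_lt (by omega) (hQ a s (by omega) (by omega) hs)
  | succ d ih =>
    intro a s hd hs hQ
    obtain ⟨h1, h2⟩ := hI a s hs
    refine wp_loop_of_lt (by omega) ?_
    rw [wp_seq]
    refine wp_mono (hbody a (by omega) s hs) ?_
    rintro s' ⟨h3, h4, h5⟩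
    rw [wp_atom]
    simp only [Atom.ok, Atom.next, h3, h4]
    exact ⟨by omega, ih (a + 1) _ (by omega) h5 fun j s' hj hj' => hQ j s' hj (by omega)⟩

/-- The scalars set at the beginning. -/
structure Setup (E : Env) (s : St) : Prop where
  nt_pos : 1 ≤ E.nt
  nv : s.v 0 = E.nv
  nt : s.v 1 = E.nt
  zero : s.v 2 = 0
  one : s.v 3 = 1
  succ : s.v 7 = E.nt + 1
  out : s.out = []

/-- The scalars outside `lo, …, 14` and the output are unchanged. -/
def Same (lo : ℕ) (s s' : St) : Prop :=
  (∀ x, x < lo ∨ 14 < x → s'.v x = s.v x) ∧ s'.out = s.out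

theorem Same.mono {lo lo' : ℕ} {s s' : St} (h : Same lo s s') (hl : lo' ≤ lo) : Same lo' s s' :=
  ⟨fun x hx => h.1 x (by omega), h.2⟩

theorem Same.trans {lo : ℕ} {s s' s'' : St} (h : Same lo s s') (h' : Same lo s' s'') :
    Same lo s s'' :=
  ⟨fun x hx => (h'.1 x hx).trans (h.1 x hx), h'.2.trans h.2⟩

theorem Same.setv {lo x n k : ℕ} {s s' : St} (h : Same lo s s') (hx : lo ≤ x) (hx' : x ≤ 14) :
    Same lo s ((s'.setv x n).tick k) := by
  refine ⟨fun y hy => ?_, h.2⟩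
  simp only [St.tick_v, St.setv_v]
  rw [Function.update_of_ne (by omega)]
  exact h.1 y hy

theorem Same.setm {lo a k c n j : ℕ} {s s' : St} (h : Same lo s s') :
    Same lo s ((s'.setm a k c n).tick j) := h

theorem Same.setr {lo y n k : ℕ} {s s' : St} (h : Same lo s s') :
    Same lo s ((s'.setr y n).tick k) := h

theorem Same.tick {lo k : ℕ} {s s' : St} (h : Same lo s s') : Same lo s (s'.tick k) := h

theorem Setup.same {E : Env} {s s' : St} (h : Setup E s) {lo : ℕ} (hs : Same lo s s')
    (hlo : 8 ≤ lo) : Setup E s' := by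
  obtain ⟨h0, h1, h2, h3, h4, h5, h6⟩ := h
  refine ⟨h0, ?_, ?_, ?_, ?_, ?_, hs.2.trans h6⟩ <;> rw [hs.1 _ (by omega)] <;> assumption

theorem Same.refl {lo : ℕ} {s : St} : Same lo s s := ⟨fun _ _ => rfl, rfl⟩

open Cmd Atom in
/-- Fill the word with ones. -/
def fillWord : Cmd := block [atom (const 8 0), forLoop 8 0 (atom (store 0 0 8 3))]

theorem wp_fillWord {E : Env} {Q : St → Prop} {s : St} (hs : Setup E s) (h0 : s.r 0 = 0)
    (hQ : ∀ s' : St, Same 8 s s' → s'.r = s.r → (∀ a, a ≠ 0 → s'.mem a = s.mem a) →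
      (∀ j < E.nv, s'.mem 0 0 j = 1) → s'.clock ≤ s.clock + (E.nv + 1) * (10 * E.arith) → Q s') :
    wp E fillWord Q s := by
  have hw : E.width = 2 * (E.nv + E.nt) := rfl
  have hr : E.rows = E.nv + E.nt + 2 := rfl
  have hcap := cap_big E hs.nt_pos
  have hone := one_le_arith E
  simp only [fillWord, block, wp_seq, wp_atom, Atom.ok, Atom.next]
  refine ⟨by omega, wp_forLoop (N := E.nv)
    (fun j s' => s'.v 8 = j ∧ Same 8 s s' ∧ s'.r = s.r ∧ (∀ a, a ≠ 0 → s'.mem a = s.mem a) ∧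
      (∀ i < j, i < E.nv → s'.mem 0 0 i = 1) ∧ s'.clock ≤ s.clock + 1 + j * (5 * E.arith))
    (by omega) (fun j s' h => ⟨h.1, (hs.same h.2.1 le_rfl).nv⟩) ?_ E.nv 0 _ rfl ?_ ?_⟩
  · rintro j hj s' ⟨h1, h2, h3, h4, h5, h6⟩
    have hs' := hs.same h2 le_rfl
    simp only [wp_atom, Atom.ok, Atom.next, St.tick_v, St.tick_r, h3, h0, h1, hs'.one, St.setm_v]
    refine ⟨⟨by omega, by omega⟩, trivial, trivial, by simp, ?_, by simpa using h3, ?_, ?_, ?_⟩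
    · exact (h2.tick (k := 2).setm).setv le_rfl (by omega)
    · intro a ha
      simp only [St.tick_mem, St.setv_mem, St.setm_mem]
      rw [upd_of_ne _ ha, h4 a ha]
    · intro i hi hin
      simp only [St.tick_mem, St.setv_mem, St.setm_mem, upd_same, Function.update_apply]
      split_ifs
      · rfl
      · exact h5 i (by omega) hin
    · simp only [St.tick_clock, St.setv_clock, St.setm_clock, add_mul, one_mul]
      omega
  · refine ⟨by simp, Same.refl.setv (by omega) (by omega), rfl, fun _ _ => rfl, by omega, by simp⟩
  · rintro j s' hj hj' ⟨h1, h2, h3, h4, h5, h6⟩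
    obtain rfl : j = E.nv := by omega
    refine hQ _ h2.tick h3 h4 (fun i hi => h5 i hi hi) ?_
    have : E.nv * (5 * E.arith) ≤ E.nv * (10 * E.arith) := Nat.mul_le_mul_left _ (by omega)
    rw [add_mul]
    simp only [St.tick_clock]
    omega

open Cmd Atom in
/-- Compute the tables of children and parents. -/
def fillTree : Cmd :=
  block [atom (copy 8 3), forLoop 8 0 (block [
    atom (add 9 8 8), atom (store 1 0 8 9), atom (store 3 0 9 8),
    atom (add 9 9 3), atom (store 2 0 8 9), atom (store 3 0 9 8)])]

theorem wp_fillTree {E : Env} {Q : St → Prop} {s : St} (hs : Setup E s) (h0 : s.r 0 = 0)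
    -- The loop writes parents only for nodes from 2 on; the value for the root is that of fresh
    -- memory.
    (hm : s.mem 3 0 1 = 0)
    (hQ : ∀ s' : St, Same 8 s s' → s'.r = s.r →
      (∀ a, a ≠ 1 → a ≠ 2 → a ≠ 3 → s'.mem a = s.mem a) →
      (∀ v, 1 ≤ v → v < E.nv → s'.mem 1 0 v = 2 * v) →
      (∀ v, 1 ≤ v → v < E.nv → s'.mem 2 0 v = 2 * v + 1) →
      (∀ v, 1 ≤ v → v < 2 * E.nv → s'.mem 3 0 v = v / 2) →
      s'.clock ≤ s.clock + (E.nv + 2) * (20 * E.arith) → Q s') :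
    wp E fillTree Q s := by
  have hw : E.width = 2 * (E.nv + E.nt) := rfl
  have hr : E.rows = E.nv + E.nt + 2 := rfl
  have hcap := cap_big E hs.nt_pos
  have hone := one_le_arith E
  simp only [fillTree, wp_block_cons, wp_block_single, wp_atom, Atom.ok, Atom.next, true_and]
  refine wp_forLoop (N := E.nv)
    (fun j s' => s'.v 8 = j ∧ 1 ≤ j ∧ Same 8 s s' ∧ s'.r = s.r ∧
      (∀ a, a ≠ 1 → a ≠ 2 → a ≠ 3 → s'.mem a = s.mem a) ∧
      (∀ v, 1 ≤ v → v < j → s'.mem 1 0 v = 2 * v) ∧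
      (∀ v, 1 ≤ v → v < j → s'.mem 2 0 v = 2 * v + 1) ∧
      (∀ v, 1 ≤ v → v < 2 * j → s'.mem 3 0 v = v / 2) ∧
      s'.clock ≤ s.clock + 1 + j * (10 * E.arith))
    (by omega) (fun j s' h => ⟨h.1, (hs.same h.2.2.1 le_rfl).nv⟩) ?_ (E.nv - 1) 1 _ rfl ?_ ?_
  · rintro j hj s' ⟨h1, h2, h3, h4, h5, h6, h7, h8, h9⟩
    have hs' := hs.same h3 le_rfl
    simp only [wp_block_cons, wp_block_single, wp_atom, Atom.ok, Atom.next, St.tick_v, St.tick_r,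
      St.setv_v, St.setv_r, h4, h0, h1, hs'.one, St.setm_v, St.setm_r, Function.update_self, ne_eq,
      Nat.reduceEqDiff, not_false_eq_true, Function.update_of_ne]
    refine ⟨by omega, ⟨by omega, by omega⟩, ⟨by omega, by omega⟩, by omega,
      ⟨by omega, by omega⟩, ⟨by omega, by omega⟩, trivial, trivial, by simp, by omega, ?_, by simp,
      ?_, ?_, ?_, ?_, ?_⟩
    · exact (((h3.tick (k := 2).setv (x := 9) (by omega) (by omega)).setm.setm.setv (x := 9)
        (by omega) (by omega)).setm.setm).setv (by omega) (by omega)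
    · intro a ha1 ha2 ha3
      simp only [St.tick_mem, St.setv_mem, St.setm_mem]
      rw [upd_of_ne _ ha3, upd_of_ne _ ha2, upd_of_ne _ ha3, upd_of_ne _ ha1, h5 a ha1 ha2 ha3]
    · intro v hv hvj
      simp only [St.tick_mem, St.setv_mem, St.setm_mem, upd_same, ne_eq,
        not_false_eq_true, upd_of_ne, OfNat.one_ne_ofNat, Function.update_apply]
      split_ifs
      · omega
      · exact h6 v hv (by omega)
    · intro v hv hvj
      simp only [St.tick_mem, St.setv_mem, St.setm_mem, upd_same, ne_eq, Nat.reduceEqDiff,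
        not_false_eq_true, upd_of_ne, OfNat.ofNat_ne_one, Function.update_apply]
      split_ifs
      · omega
      · exact h7 v hv (by omega)
    · intro v hv hvj
      simp only [St.tick_mem, St.setv_mem, St.setm_mem, upd_same, ne_eq, Nat.reduceEqDiff,
        not_false_eq_true, upd_of_ne, OfNat.ofNat_ne_one, Function.update_apply]
      split_ifs
      · omega
      · omega
      · exact h8 v hv (by omega)
    · simp only [St.tick_clock, St.setv_clock, St.setm_clock, add_mul, one_mul]
      omega
  · refine ⟨by simp [hs.one], le_rfl, Same.refl.setv (by omega) (by omega), rfl,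
      fun _ _ _ _ => rfl, by omega, by omega, fun v hv hv' => ?_, by simp⟩
    obtain rfl : v = 1 := by omega
    simpa using hm
  · rintro j s' hj hj' ⟨h1, h2, h3, h4, h5, h6, h7, h8, h9⟩
    refine hQ _ h3.tick h4 h5 (fun v hv hv' => h6 v hv (by omega))
      (fun v hv hv' => h7 v hv (by omega)) (fun v hv hv' => h8 v hv (by omega)) ?_
    -- Without variables the loop variable starts beyond its bound, hence `E.nv + 1`.
    have h10 : j * (10 * E.arith) ≤ (E.nv + 1) * (10 * E.arith) :=
      Nat.mul_le_mul_right _ (by omega)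
    have h11 : (E.nv + 1) * (10 * E.arith) ≤ (E.nv + 1) * (20 * E.arith) :=
      Nat.mul_le_mul_left _ (by omega)
    rw [show E.nv + 2 = E.nv + 1 + 1 from rfl, add_mul _ 1]
    simp only [St.tick_clock]
    omega

open Cmd Atom in
/-- Copy the input into rows. -/
def fillBits : Cmd :=
  block [atom (copy 8 3), atom (const 9 2), forLoop 8 7 (block [
    atom (row 1 8), atom (const 10 0),
    forLoop 10 0 (block [atom (input 11 9), atom (store 11 1 10 11), atom (add 9 9 3)])])]

theorem wp_fillBits {E : Env} {Q : St → Prop} {s : St} (hs : Setup E s)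
    (hcap' : 2 + E.nv * E.nt ≤ E.cap)
    (hQ : ∀ s' : St, Same 8 s s' → s'.r 0 = s.r 0 → (∀ a, a ≠ 11 → s'.mem a = s.mem a) →
      (∀ t, 1 ≤ t → t ≤ E.nt → ∀ j < E.nv, s'.mem 11 t j = E.inp (2 + (t - 1) * E.nv + j)) →
      s'.clock ≤ s.clock + (E.nt + 2) * (30 * E.arith + E.nv * (10 * E.arith)) → Q s') :
    wp E fillBits Q s := by
  have hw : E.width = 2 * (E.nv + E.nt) := rfl
  have hr : E.rows = E.nv + E.nt + 2 := rfl
  have hcap := cap_big E hs.nt_pos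
  have hone := one_le_arith E
  simp only [fillBits, wp_block_cons, wp_block_single, wp_atom, Atom.ok, Atom.next, true_and]
  refine ⟨by omega, wp_forLoop (N := E.nt + 1)
    (fun t s' => s'.v 8 = t ∧ 1 ≤ t ∧ s'.v 9 = 2 + (t - 1) * E.nv ∧ Same 8 s s' ∧
      s'.r 0 = s.r 0 ∧ (∀ a, a ≠ 11 → s'.mem a = s.mem a) ∧
      (∀ u, 1 ≤ u → u < t → ∀ j < E.nv, s'.mem 11 u j = E.inp (2 + (u - 1) * E.nv + j)) ∧
      s'.clock ≤ s.clock + 2 + t * (30 * E.arith + E.nv * (10 * E.arith)))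
    (by omega) (fun j s' h => ⟨h.1, (hs.same h.2.2.2.1 le_rfl).succ⟩) ?_ E.nt 1 _ (by omega) ?_ ?_⟩
  · rintro t ht s' ⟨h1, h2, h3, h4, h5, h6, h7, h8⟩
    have hs' := hs.same h4 le_rfl
    simp only [wp_block_cons, wp_block_single, wp_atom, Atom.ok, Atom.next, St.tick_v, h1]
    refine ⟨by omega, by omega, wp_forLoop (N := E.nv)
      (fun j s2 => s2.v 10 = j ∧ j ≤ E.nv ∧ s2.v 8 = t ∧ s2.v 9 = 2 + (t - 1) * E.nv + j ∧
        Same 8 s s2 ∧ s2.r 0 = s.r 0 ∧ s2.r 1 = t ∧ (∀ a, a ≠ 11 → s2.mem a = s.mem a) ∧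
        (∀ u, 1 ≤ u → u < t → ∀ j < E.nv, s2.mem 11 u j = E.inp (2 + (u - 1) * E.nv + j)) ∧
        (∀ i < j, s2.mem 11 t i = E.inp (2 + (t - 1) * E.nv + i)) ∧
        s2.clock ≤ s'.clock + 3 + 13 * E.arith + j * (10 * E.arith))
      (by omega) (fun j s2 h => ⟨h.1, (hs.same h.2.2.2.2.1 le_rfl).nv⟩) ?_ E.nv 0 _ rfl ?_ ?_⟩
    · rintro j hj s2 ⟨g1, -, g2, g3, g4, g5, g6, g7, g8, g9, g10⟩
      have hs2 := hs.same g4 le_rfl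
      have hb : (t - 1) * E.nv + j < E.nv * E.nt := by
        have : (t - 1 + 1) * E.nv ≤ E.nt * E.nv := Nat.mul_le_mul_right _ (by omega)
        rw [mul_comm E.nv]
        rw [add_mul] at this
        omega
      simp only [wp_block_cons, wp_block_single, wp_atom, Atom.ok, Atom.next, St.tick_v,
        St.tick_r, St.setv_v, St.setv_r, g1, g2, g3, g6, hs2.one, St.setm_v, Function.update_self, ne_eq,
        Nat.reduceEqDiff, not_false_eq_true, Function.update_of_ne]
      refine ⟨by omega, ⟨by omega, by omega⟩, by omega, trivial, trivial, by simp, by omega,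
        by simp, by omega, ?_, by simpa using g5, by simpa using g6, ?_, ?_, ?_, ?_⟩
      · exact ((g4.tick (k := 2).setv (by omega) (by omega)).setm.setv (by omega)
          (by omega)).setv (by omega) (by omega)
      · intro a ha
        simp only [St.tick_mem, St.setv_mem, St.setm_mem]
        rw [upd_of_ne _ ha, g7 a ha]
      · intro u hu hut i hi
        simp only [St.tick_mem, St.setv_mem, St.setm_mem]
        rw [upd_row_of_ne _ (by omega), g8 u hu hut i hi]
      · intro i hi
        simp only [St.tick_mem, St.setv_mem, St.setm_mem, upd_same, Function.update_apply]
        split_ifs with hij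
        · rw [hij]
        · exact g9 i (by omega)
      · simp only [St.tick_clock, St.setv_clock, St.setm_clock, add_mul, one_mul]
        omega
    · refine ⟨by simp, by omega, by simpa using h1, by simpa using h3, ?_, by simpa using h5,
        by simp, h6, h7, by omega, ?_⟩
      · exact (h4.tick.setr).setv (by omega) (by omega)
      · simp
    · rintro j s2 hj hj' ⟨g1, g0, g2, g3, g4, g5, g6, g7, g8, g9, g10⟩
      obtain rfl : j = E.nv := by omega
      refine ⟨g2, (hs.same g4 le_rfl).one, by simp, by omega, ?_, ?_, by simpa using g5, g7, ?_, ?_⟩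
      · simp only [St.tick_v, St.setv_v, ne_eq, Nat.reduceEqDiff, not_false_eq_true,
          Function.update_of_ne, g3, Nat.add_sub_cancel]
        obtain ⟨t', rfl⟩ : ∃ t', t = t' + 1 := ⟨t - 1, by omega⟩
        rw [Nat.add_sub_cancel, add_mul]
        omega
      · exact g4.tick.setv (by omega) (by omega)
      · intro u hu hut i hi
        rcases Nat.eq_or_lt_of_le (show u ≤ t by omega) with rfl | hlt
        · exact g9 i hi
        · exact g8 u hu hlt i hi
      · simp only [St.tick_clock, St.setv_clock]
        rw [add_mul t 1]
        omega
  · refine ⟨by simp [hs.one], le_rfl, by simp, ?_, rfl, fun _ _ => rfl, by omega, ?_⟩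
    · exact (Same.refl.setv (by omega) (by omega)).setv (by omega) (by omega)
    · simp
  · rintro j s' hj hj' ⟨h1, h2, h3, h4, h5, h6, h7, h8⟩
    obtain rfl : j = E.nt + 1 := by omega
    refine hQ _ h4.tick h5 h6 (fun t ht htm => h7 t ht (by omega)) ?_
    rw [show E.nt + 2 = E.nt + 1 + 1 from rfl, add_mul _ 1]
    simp only [St.tick_clock]
    omega

end While

/-! ### The table of next zeros -/

namespace While

open Monotone (nextZero rep SameFrom repAux)

theorem Setup.congr {E : Env} {s s' : St} (h : Setup E s)
    (hv : ∀ x, x < 4 ∨ x = 7 → s'.v x = s.v x) (ho : s'.out = s.out) : Setup E s' := by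
  obtain ⟨h0, h1, h2, h3, h4, h5, h6⟩ := h
  refine ⟨h0, ?_, ?_, ?_, ?_, ?_, ho.trans h6⟩ <;> rw [hv _ (by omega)] <;> assumption

/-- Array `11` holds the matrix `b`. -/
def Bits (E : Env) (b : ℕ → ℕ → ℕ) (M : ℕ → ℕ → ℕ → ℕ) : Prop :=
  ∀ t, 1 ≤ t → t ≤ E.nt → ∀ j < E.nv, M 11 t j = b t j

theorem Bits.congr {E : Env} {b : ℕ → ℕ → ℕ} {M M' : ℕ → ℕ → ℕ → ℕ} (h : Bits E b M)
    (hM : M' 11 = M 11) : Bits E b M' := fun t h1 h2 j hj => by rw [hM]; exact h t h1 h2 j hj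

open Cmd Atom in
/-- Compute the entry in scalar `8` of the row of array `5` in slot `1` from the next row in
slot `2`. -/
def zeroEntry : Cmd :=
  block [
    atom (row 3 8), atom (load 9 11 3 6), ite 2 9 (atom (load 10 5 2 8)) (atom (copy 10 6)),
    atom (store 5 1 8 10)]

/-- One step of the recursion of `nextZero`: the entry is `i` itself or is copied from position `i +
1`. The table is therefore filled from the last position downwards. -/
theorem wp_zeroEntry {E : Env} {b : ℕ → ℕ → ℕ} {Q : St → Prop} {s : St} {i t : ℕ} (hs : Setup E s)
    (hi : i < E.nv) (ht : t ≤ E.nt) (h6 : s.v 6 = i) (h8 : s.v 8 = t) (h1 : s.r 1 = i)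
    (h2 : s.r 2 = i + 1) (hb : s.mem 11 t i = b t i)
    (hn : s.mem 5 (i + 1) t = nextZero E.nv b t (i + 1))
    (hQ : ∀ s' : St, Same 9 s s' → s'.r 0 = s.r 0 → s'.r 1 = s.r 1 → s'.r 2 = s.r 2 →
      s'.mem = upd s.mem 5 i t (nextZero E.nv b t i) → s'.clock ≤ s.clock + 20 * E.arith → Q s') :
    wp E zeroEntry Q s := by
  have hw : E.width = 2 * (E.nv + E.nt) := rfl
  have hr : E.rows = E.nv + E.nt + 2 := rfl
  have hone := one_le_arith E
  simp only [zeroEntry, wp_block_cons, wp_block_single, wp_atom, wp_ite, Atom.ok, Atom.next,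
    St.tick_v, St.tick_r, St.setv_v, St.setv_r, h8, h6, St.setr_v, St.setr_r, Function.update_self,
    ne_eq, Nat.reduceEqDiff, not_false_eq_true, Function.update_of_ne, St.tick_mem, St.setr_mem, hb,
    hs.zero, St.setv_mem, h2, h1, hn, true_and, OfNat.one_ne_ofNat]
  have hsame : ∀ x y, Same 9 s (((((((((s.setr 3 t).tick (13 * E.arith)).setv 9 x).tick 1).tick
      2).setv 10 y).tick 1).setm 5 i t y).tick 1) := fun x y =>
    ((Same.refl.setr.setv (by omega) (by omega)).tick.setv (by omega) (by omega)).setm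
  refine ⟨by omega, ⟨by omega, by omega⟩, ?_⟩
  split_ifs with hlt
  · refine ⟨⟨by omega, by omega⟩, ⟨by omega, by omega⟩,
      hQ _ (hsame _ _) (by simp) (by simp) (by simp) ?_ ?_⟩
    · rw [Monotone.nextZero_of_ne_zero hi (by omega)]
      rfl
    · simp only [St.tick_clock, St.setv_clock, St.setm_clock, St.setr_clock]
      omega
  · refine ⟨⟨by omega, by omega⟩, hQ _ (hsame _ _) (by simp) (by simp) (by simp) ?_ ?_⟩
    · rw [Monotone.nextZero_of_eq_zero hi (by omega)]
      rfl
    · simp only [St.tick_clock, St.setv_clock, St.setm_clock, St.setr_clock]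
      omega

open Cmd Atom in
/-- Compute the row of array `5` in slot `1` from the next one in slot `2`. -/
def zeroRow : Cmd := block [atom (copy 8 3), forLoop 8 7 zeroEntry]

theorem wp_zeroRow {E : Env} {b : ℕ → ℕ → ℕ} {Q : St → Prop} {s : St} {i : ℕ} (hs : Setup E s)
    (hi : i < E.nv) (h6 : s.v 6 = i) (h1 : s.r 1 = i) (h2 : s.r 2 = i + 1) (hb : Bits E b s.mem)
    (hn : ∀ t, 1 ≤ t → t ≤ E.nt → s.mem 5 (i + 1) t = nextZero E.nv b t (i + 1))
    (hQ : ∀ s' : St, Same 8 s s' → s'.r 0 = s.r 0 →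
      (∀ a k, a ≠ 5 ∨ k ≠ i → s'.mem a k = s.mem a k) →
      (∀ t, 1 ≤ t → t ≤ E.nt → s'.mem 5 i t = nextZero E.nv b t i) →
      s'.clock ≤ s.clock + (E.nt + 2) * (30 * E.arith) → Q s') :
    wp E zeroRow Q s := by
  have hcap := cap_big E hs.nt_pos
  have hone := one_le_arith E
  simp only [zeroRow, wp_block_cons, wp_block_single, wp_atom, Atom.ok, Atom.next, true_and]
  refine wp_forLoop (N := E.nt + 1)
    (fun t s' => s'.v 8 = t ∧ 1 ≤ t ∧ Same 8 s s' ∧ s'.r 0 = s.r 0 ∧ s'.r 1 = i ∧ s'.r 2 = i + 1 ∧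
      (∀ a k, a ≠ 5 ∨ k ≠ i → s'.mem a k = s.mem a k) ∧
      (∀ u, 1 ≤ u → u < t → s'.mem 5 i u = nextZero E.nv b u i) ∧
      s'.clock ≤ s.clock + 1 + t * (30 * E.arith))
    (by omega) (fun j s' h => ⟨h.1, (hs.same h.2.2.1 le_rfl).succ⟩) ?_ E.nt 1 _ (by omega) ?_ ?_
  · rintro t ht s' ⟨g1, g2, g3, g4, g5, g6, g7, g8, g9⟩
    have hs' := hs.same g3 le_rfl
    refine wp_zeroEntry (b := b) (i := i) (t := t) (hs'.congr (fun _ _ => rfl) rfl) hi (by omega)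
      ((g3.1 6 (by omega)).trans h6) g1 g5 g6 ?_ ?_ ?_
    · rw [St.tick_mem, g7 11 t (.inl (by omega)), hb t g2 (by omega) i hi]
    · rw [St.tick_mem, g7 5 (i + 1) (by omega), hn t g2 (by omega)]
    intro s1 e1 e2 e3 e4 e5 e6
    have e7 : Same 8 s' s1 := e1.mono (by omega)
    refine ⟨(e1.1 8 (by omega)).trans g1, (hs'.same e7 le_rfl).one, by simp, by omega,
      (g3.trans e7).setv le_rfl (by omega), e2.trans g4, e3.trans g5, e4.trans g6, ?_, ?_, ?_⟩
    · intro a k hak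
      simp only [St.tick_mem, St.setv_mem, e5]
      rw [upd_row_of_ne _ hak, g7 a k hak]
    · intro u hu hut
      simp only [St.tick_mem, St.setv_mem, e5, upd_same, Function.update_apply]
      split_ifs with hc
      · rw [hc]
      · exact g8 u hu (by omega)
    · simp only [St.tick_clock, St.setv_clock] at e6 ⊢
      rw [add_mul t 1]
      omega
  · refine ⟨by simp [hs.one], le_rfl, Same.refl.setv (by omega) (by omega), rfl, h1, h2,
      fun _ _ _ => rfl, by omega, by simp⟩
  · rintro j s' hj hj' ⟨g1, g2, g3, g4, g5, g6, g7, g8, g9⟩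
    obtain rfl : j = E.nt + 1 := by omega
    refine hQ _ g3.tick g4 g7 (fun t ht ht' => g8 t ht (by omega)) ?_
    rw [show E.nt + 2 = E.nt + 1 + 1 from rfl, add_mul _ 1]
    simp only [St.tick_clock]
    omega

open Cmd Atom in
/-- The rows of array `5` from the last one down to row `0`. -/
def zeroRows : Cmd :=
  loop 2 6 (block [atom (copy 5 6), atom (sub 6 6 3), atom (row 1 6), atom (row 2 5), zeroRow])

theorem wp_zeroRows {E : Env} {b : ℕ → ℕ → ℕ} {Q : St → Prop} (i : ℕ) : ∀ s : St, Setup E s →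
    i ≤ E.nv → s.v 6 = i → Bits E b s.mem →
    (∀ k, i ≤ k → k ≤ E.nv → ∀ t, 1 ≤ t → t ≤ E.nt → s.mem 5 k t = nextZero E.nv b t k) →
    (∀ s' : St, Setup E s' → s'.r 0 = s.r 0 → (∀ a, a ≠ 5 → s'.mem a = s.mem a) →
      (∀ k ≤ E.nv, ∀ t, 1 ≤ t → t ≤ E.nt → s'.mem 5 k t = nextZero E.nv b t k) →
      s'.clock ≤ s.clock + 2 + i * ((E.nt + 3) * (30 * E.arith)) → Q s') →
    wp E zeroRows Q s := by
  have hw : E.width = 2 * (E.nv + E.nt) := rfl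
  have hr : E.rows = E.nv + E.nt + 2 := rfl
  have hone := one_le_arith E
  induction i with
  | zero =>
    intro s hs hi h6 hb hn hQ
    refine wp_loop_of_not_lt (by omega) (hQ _ (hs.congr (fun _ _ => rfl) rfl) rfl
      (fun _ _ => rfl) (fun k hk => hn k (by omega) hk) (by simp))
  | succ i ih =>
    intro s hs hi h6 hb hn hQ
    refine wp_loop_of_lt (by rw [hs.zero]; omega) ?_
    simp only [wp_block_cons, wp_atom, Atom.ok, Atom.next, St.tick_v, St.setv_v, h6, hs.one,
      St.setr_v, Function.update_self, ne_eq,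
      Nat.reduceEqDiff, not_false_eq_true, Function.update_of_ne, true_and, Nat.add_sub_cancel]
    have hset : ∀ s1 : St, s1.v = Function.update (Function.update s.v 5 (i + 1)) 6 i →
        s1.out = s.out → Setup E s1 := fun s1 hv ho => hs.congr (fun x hx => by
      rw [hv, Function.update_of_ne (by omega), Function.update_of_ne (by omega)]) ho
    refine ⟨by omega, by omega, wp_zeroRow (b := b) (i := i) (hset _ rfl rfl) (by omega) ?_ ?_ ?_
      hb (fun t ht ht' => hn (i + 1) le_rfl hi t ht ht') ?_⟩
    · simp
    · simp
    · simp
    · intro s' g1 g2 g3 g4 g5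
      refine ih s' (by refine Setup.same (hset _ ?_ ?_) g1 le_rfl <;> rfl) (by omega) ?_ (hb.congr ?_) ?_ ?_
      · rw [g1.1 6 (by omega)]; simp
      · exact funext fun k => g3 11 k (by omega)
      · intro k hk hk' t ht ht'
        rcases Nat.eq_or_lt_of_le hk with rfl | hlt
        · exact g4 t ht ht'
        · rw [g3 5 k (by omega)]
          exact hn k hlt hk' t ht ht'
      · intro s'' k1 k2 k3 k4 k5
        refine hQ s'' k1 (k2.trans g2) (fun a ha => (k3 a ha).trans
          (funext fun k => g3 a k (.inl ha))) k4 ?_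
        simp only [St.tick_clock, St.setv_clock, St.setr_clock] at g5
        rw [add_mul i 1, one_mul, show E.nt + 3 = E.nt + 2 + 1 from rfl, add_mul (E.nt + 2) 1]
        rw [show E.nt + 3 = E.nt + 2 + 1 from rfl, add_mul (E.nt + 2) 1] at k5
        omega

open Cmd Atom in
/-- Compute array `5`. -/
def fillZeros : Cmd :=
  block [atom (row 1 0), atom (copy 8 3), forLoop 8 7 (atom (store 5 1 8 0)), atom (copy 6 0),
    zeroRows]

theorem wp_fillZeros {E : Env} {b : ℕ → ℕ → ℕ} {Q : St → Prop} {s : St} (hs : Setup E s)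
    (hb : Bits E b s.mem)
    (hQ : ∀ s' : St, Setup E s' → s'.r 0 = s.r 0 → (∀ a, a ≠ 5 → s'.mem a = s.mem a) →
      (∀ k ≤ E.nv, ∀ t, 1 ≤ t → t ≤ E.nt → s'.mem 5 k t = nextZero E.nv b t k) →
      s'.clock ≤ s.clock + (E.nv + 1) * ((E.nt + 5) * (30 * E.arith)) → Q s') :
    wp E fillZeros Q s := by
  have hw : E.width = 2 * (E.nv + E.nt) := rfl
  have hr : E.rows = E.nv + E.nt + 2 := rfl
  have hcap := cap_big E hs.nt_pos
  have hone := one_le_arith E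
  simp only [fillZeros, wp_block_cons, wp_atom, Atom.ok, Atom.next, true_and,
    hs.nv]
  refine ⟨by omega, wp_forLoop (N := E.nt + 1)
    (fun t s' => s'.v 8 = t ∧ 1 ≤ t ∧ Same 8 s s' ∧ s'.r 0 = s.r 0 ∧ s'.r 1 = E.nv ∧
      (∀ a, a ≠ 5 → s'.mem a = s.mem a) ∧ (∀ u, 1 ≤ u → u < t → s'.mem 5 E.nv u = E.nv) ∧
      s'.clock ≤ s.clock + 1 + 13 * E.arith + t * (30 * E.arith))
    (by omega) (fun j s' h => ⟨h.1, (hs.same h.2.2.1 le_rfl).succ⟩) ?_ E.nt 1 _ (by omega) ?_ ?_⟩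
  · rintro t ht s' ⟨g1, g2, g3, g4, g5, g7, g8, g9⟩
    have hs' := hs.same g3 le_rfl
    simp only [wp_atom, Atom.ok, Atom.next, St.tick_v, St.tick_r, g1, g5, hs'.nv, St.setm_v]
    refine ⟨⟨by omega, by omega⟩, trivial, hs'.one, by simp, by omega,
      Same.setv g3 le_rfl (by omega), g4, g5, ?_, ?_, ?_⟩
    · intro a ha
      simp only [St.tick_mem, St.setv_mem, St.setm_mem]
      rw [upd_of_ne _ ha, g7 a ha]
    · intro u hu hut
      simp only [St.tick_mem, St.setv_mem, St.setm_mem, upd_same, Function.update_apply]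
      split_ifs with hc
      · rfl
      · exact g8 u hu (by omega)
    · simp only [St.tick_clock, St.setv_clock, St.setm_clock]
      rw [add_mul t 1]
      omega
  · refine ⟨by simp [hs.one], le_rfl, Same.refl.setr.setv (by omega) (by omega), by simp, by simp,
      fun _ _ => rfl, by omega, ?_⟩
    simp only [St.tick_clock, St.setv_clock, St.setr_clock]
    omega
  · rintro j s' hj hj' ⟨g1, g2, g3, g4, g5, g7, g8, g9⟩
    obtain rfl : j = E.nt + 1 := by omega
    have hs' := hs.same g3 le_rfl
    rw [wp_block_cons, wp_atom]
    refine ⟨trivial, wp_zeroRows (b := b) E.nv _ (hs'.congr (fun x hx => ?_) rfl) le_rfl ?_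
      (hb.congr ?_) ?_ ?_⟩
    · simp only [Atom.next, St.tick_v, St.setv_v]
      rw [Function.update_of_ne (by omega)]
    · simp [Atom.next, hs'.nv]
    · exact g7 11 (by omega)
    · intro k hk hk' t ht ht'
      obtain rfl : k = E.nv := by omega
      rw [Monotone.nextZero_of_ge le_rfl]
      exact g8 t ht (by omega)
    · intro s'' k1 k2 k3 k4 k5
      refine hQ s'' k1 (k2.trans g4) (fun a ha => (k3 a ha).trans (g7 a ha)) k4 ?_
      simp only [Atom.next, St.tick_clock, St.setv_clock] at k5
      have h1 : E.nv * ((E.nt + 3) * (30 * E.arith)) ≤ E.nv * ((E.nt + 5) * (30 * E.arith)) :=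
        Nat.mul_le_mul_left _ (Nat.mul_le_mul_right _ (by omega))
      rw [add_mul _ 1, one_mul, show E.nt + 5 = E.nt + 1 + 4 from rfl, add_mul (E.nt + 1) 4]
      rw [show E.nt + 5 = E.nt + 1 + 4 from rfl, add_mul (E.nt + 1) 4] at h1
      omega

end While

/-! ### The table of representatives -/

namespace While

open Monotone (nextZero rep SameFrom repAux)

open Cmd Atom in
/-- Reset scalar `12` if the rows in slots `0` and `3` differ at the position in scalar `11`. -/
def compareStep : Cmd :=
  block [atom (load 13 11 0 11), atom (load 14 11 3 11),
    ite 13 14 (atom (const 12 0)) (ite 14 13 (atom (const 12 0)) (atom (const 13 0)))]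

theorem wp_compareStep {E : Env} {Q : St → Prop} {s : St} {j : ℕ} (hj : j < E.nv)
    (h11 : s.v 11 = j) (h0 : s.r 0 < E.rows) (h3 : s.r 3 < E.rows)
    (hQ : ∀ s' : St, Same 12 s s' → s'.r = s.r → s'.mem = s.mem →
      s'.v 12 = (if s.mem 11 (s.r 0) j = s.mem 11 (s.r 3) j then s.v 12 else 0) →
      s'.clock ≤ s.clock + 7 → Q s') :
    wp E compareStep Q s := by
  have hw : E.width = 2 * (E.nv + E.nt) := rfl
  simp only [compareStep, wp_block_cons, wp_block_single, wp_atom, wp_ite, Atom.ok, Atom.next,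
    St.tick_v, St.tick_r, St.setv_v, St.setv_r, h11, Function.update_self, ne_eq,
    Nat.reduceEqDiff, not_false_eq_true, Function.update_of_ne, St.tick_mem, St.setv_mem]
  have hsame : ∀ x y : ℕ, Same 12 s ((((s.setv 13 x).tick 1).setv 14 y).tick 1) := fun x y =>
    (Same.refl.setv (by omega) (by omega)).setv (by omega) (by omega)
  refine ⟨⟨h0, by omega⟩, ⟨h3, by omega⟩, ?_⟩
  split_ifs with hlt hgt
  · refine ⟨by omega, hQ _ ((hsame _ _).tick.setv (by omega) (by omega)) rfl rfl ?_ (by simp)⟩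
    rw [if_neg (by omega)]
    simp
  · refine ⟨by omega, hQ _ ((hsame _ _).tick.tick.setv (by omega) (by omega)) rfl rfl ?_ (by simp)⟩
    rw [if_neg (by omega)]
    simp
  · refine ⟨by omega, hQ _ ((hsame _ _).tick.tick.setv (by omega) (by omega)) rfl rfl ?_ (by simp)⟩
    rw [if_pos (by omega)]
    simp

open Cmd Atom in
/-- Test whether the rows in slots `0` and `3` agree from the position in scalar `5` on. -/
def compareRows : Cmd :=
  block [atom (const 12 1), atom (copy 11 5), forLoop 11 0 compareStep]

/-- Scalar `12` starts at 1 and is reset at the first difference; the invariant is agreement on the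
positions passed so far. -/
theorem wp_compareRows {E : Env} {b : ℕ → ℕ → ℕ} {Q : St → Prop} {s : St} {i t u : ℕ}
    (hs : Setup E s) (hi : i ≤ E.nv) (h5 : s.v 5 = i) (h0 : s.r 0 = t) (h3 : s.r 3 = u)
    (ht1 : 1 ≤ t) (ht : t ≤ E.nt) (hu1 : 1 ≤ u) (hu : u ≤ E.nt) (hb : Bits E b s.mem)
    (hQ : ∀ s' : St, Same 11 s s' → s'.r = s.r → s'.mem = s.mem →
      s'.v 12 = (if SameFrom E.nv b i t u then 1 else 0) →
      s'.clock ≤ s.clock + (E.nv + 2) * (10 * E.arith) → Q s') :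
    wp E compareRows Q s := by
  have hw : E.width = 2 * (E.nv + E.nt) := rfl
  have hr : E.rows = E.nv + E.nt + 2 := rfl
  have hcap := cap_big E hs.nt_pos
  have hone := one_le_arith E
  simp only [compareRows, wp_block_cons, wp_block_single, wp_atom, Atom.ok, Atom.next, true_and]
  refine ⟨by omega, wp_forLoop (N := E.nv)
    (fun j s' => s'.v 11 = j ∧ i ≤ j ∧ Same 11 s s' ∧ s'.r = s.r ∧ s'.mem = s.mem ∧
      s'.v 12 = (if ∀ k, k < j → i ≤ k → b t k = b u k then 1 else 0) ∧
      s'.clock ≤ s.clock + 2 + j * (10 * E.arith))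
    (by omega) (fun j s' h => ⟨h.1, (hs.same h.2.2.1 (by omega)).nv⟩) ?_ (E.nv - i) i _ rfl ?_ ?_⟩
  · rintro j hj s' ⟨g1, g2, g3, g4, g5, g6, g7⟩
    have hs' := hs.same g3 (by omega)
    have hiff : (∀ k, k < j + 1 → i ≤ k → b t k = b u k) ↔
        b t j = b u j ∧ ∀ k, k < j → i ≤ k → b t k = b u k := by
      refine ⟨fun h => ⟨h j (by omega) g2, fun k hk => h k (by omega)⟩, fun h k hk hik => ?_⟩
      rcases Nat.eq_or_lt_of_le (show k ≤ j by omega) with rfl | hlt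
      · exact h.1
      · exact h.2 k hlt hik
    refine wp_compareStep (s := s'.tick 2) hj g1 (by simp [g4, h0]; omega) (by simp [g4, h3]; omega)
      ?_
    intro s1 e1 e2 e3 e4 e5
    have e6 : Same 11 s s1 := g3.trans (Same.mono (s := s') e1 (by omega))
    refine ⟨(e1.1 11 (by omega)).trans g1, (hs.same e6 (by omega)).one, by simp, by omega,
      e6.setv (by omega) (by omega), e2.trans g4, e3.trans g5, ?_, ?_⟩
    · simp only [St.tick_v, St.tick_r, St.tick_mem, g4, g5, h0, h3, hb t ht1 ht j hj,
        hb u hu1 hu j hj, g6] at e4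
      simp only [St.tick_v, St.setv_v, ne_eq, Nat.reduceEqDiff, not_false_eq_true,
        Function.update_of_ne, e4, hiff, ite_and]
    · simp only [St.tick_clock, St.setv_clock] at e5 ⊢
      rw [add_mul j 1]
      omega
  · refine ⟨by simp [h5], le_rfl, (Same.refl.setv (by omega) (by omega)).setv (by omega)
      (by omega), rfl, rfl, ?_, by simp⟩
    rw [if_pos fun k hk hk' => by omega]
    simp
  · rintro j s' hj hj' ⟨g1, g2, g3, g4, g5, g6, g7⟩
    obtain rfl : j = E.nv := by omega
    refine hQ _ g3.tick g4 g5 g6 ?_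
    rw [add_mul]
    simp only [St.tick_clock]
    omega

open Cmd Atom in
/-- Process the row in scalar `10` in the search of `repEntry`. -/
def repStep : Cmd :=
  block [atom (row 3 10), compareRows, ite 2 12
    (block [atom (load 13 11 3 6), ite 2 13 (atom (load 9 6 1 10)) (atom (const 13 0))])
    (atom (const 13 0))]

theorem wp_repStep {E : Env} {b : ℕ → ℕ → ℕ} {Q : St → Prop} {s : St} {i t u x : ℕ}
    (hs : Setup E s) (hi : i < E.nv) (h5 : s.v 5 = i + 1) (h6 : s.v 6 = i) (h10 : s.v 10 = u)
    (h9 : s.v 9 = x)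
    (h0 : s.r 0 = t) (h1 : s.r 1 = i)
    (ht1 : 1 ≤ t) (ht : t ≤ E.nt) (hu1 : 1 ≤ u) (hu : u ≤ E.nt) (hb : Bits E b s.mem)
    (hQ : ∀ s' : St, Same 9 s s' → s'.v 10 = u → (∀ y < 3, s'.r y = s.r y) → s'.mem = s.mem →
      s'.v 9 = (if SameFrom E.nv b (i + 1) t u ∧ 0 < b u i then s.mem 6 i u else x) →
      s'.clock ≤ s.clock + 20 * E.arith + (E.nv + 2) * (10 * E.arith) → Q s') :
    wp E repStep Q s := by
  have hw : E.width = 2 * (E.nv + E.nt) := rfl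
  have hr : E.rows = E.nv + E.nt + 2 := rfl
  have hone := one_le_arith E
  rw [repStep, wp_block_cons, wp_atom]
  simp only [Atom.ok, Atom.next, h10]
  refine ⟨by omega, ?_⟩
  rw [wp_block_cons]
  refine wp_compareRows (b := b) (i := i + 1) (t := t) (u := u) (hs.congr (fun _ _ => rfl) rfl) hi
    h5 (by simpa using h0) (by simp) ht1 ht hu1 hu hb ?_
  intro s1 g1 g2 g3 g4 g5
  have hs1 : Setup E s1 := Setup.same (s := s) hs g1 (by omega)
  have k1 : s1.v 10 = u := (g1.1 10 (by omega)).trans h10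
  have k2 : s1.v 6 = i := (g1.1 6 (by omega)).trans h6
  have k3 : s1.mem = s.mem := g3
  have k4 : s1.r 3 = u := by rw [g2]; simp
  have k5 : s1.r 1 = i := by rw [g2]; simpa using h1
  have k6 : s1.v 9 = x := (g1.1 9 (by omega)).trans h9
  have k7 : ∀ y < 3, s1.r y = s.r y := fun y hy => by
    rw [g2, St.tick_r, St.setr_r, Function.update_of_ne (by omega)]
  have k8 : Same 9 s s1 := Same.mono (s := s) g1 (by omega)
  have k9 : s1.clock ≤ s.clock + 13 * E.arith + (E.nv + 2) * (10 * E.arith) := g5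
  simp only [wp_block_cons, wp_block_single, wp_atom, wp_ite, Atom.ok, Atom.next, St.tick_v,
      St.tick_r, St.setv_v, St.setv_r, hs1.zero, g4, k1, k2, k3, k4, k5, Function.update_self, ne_eq,
      Nat.reduceEqDiff, not_false_eq_true, Function.update_of_ne, St.tick_mem,
      St.setv_mem, hb u hu1 hu i hi]
  split_ifs with hA hB hC hC
  · refine ⟨⟨by omega, by omega⟩, ⟨by omega, by omega⟩, hQ _ ?_ ?_ k7 k3 ?_ ?_⟩
    · exact (((k8.tick).setv (by omega) (by omega)).tick).setv (by omega) (by omega)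
    · simpa using k1
    · rw [if_pos ⟨hA, hC⟩]; simp
    · simp only [St.tick_clock, St.setv_clock]; omega
  · refine ⟨⟨by omega, by omega⟩, by omega, hQ _ ?_ ?_ k7 k3 ?_ ?_⟩
    · exact (((k8.tick).setv (by omega) (by omega)).tick).setv (by omega) (by omega)
    · simpa using k1
    · rw [if_neg fun h => hC h.2]; simpa using k6
    · simp only [St.tick_clock, St.setv_clock]; omega
  all_goals first | omega | skip
  · refine ⟨by omega, hQ _ ?_ ?_ k7 k3 ?_ ?_⟩
    · exact ((k8.tick).setv (by omega) (by omega))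
    · simpa using k1
    · rw [if_neg fun h => hA h.1]; simpa using k6
    · simp only [St.tick_clock, St.setv_clock]; omega

open Cmd Atom in
/-- Compute in scalar `9` the entry in column `8` of the row of array `6` after the one in
slot `1`. -/
def repEntry : Cmd :=
  block [atom (load 9 6 1 8), atom (copy 10 3), forLoop 10 7 repStep]

/-- In `repAux` the last suitable row wins, so an upward loop that overwrites its result computes
it. -/
theorem wp_repEntry {E : Env} {b : ℕ → ℕ → ℕ} {Q : St → Prop} {s : St} {i t : ℕ} {prev : ℕ → ℕ}
    (hs : Setup E s) (hi : i < E.nv) (h5 : s.v 5 = i + 1) (h6 : s.v 6 = i) (h8 : s.v 8 = t)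
    (h0 : s.r 0 = t) (h1 : s.r 1 = i) (ht1 : 1 ≤ t) (ht : t ≤ E.nt) (hb : Bits E b s.mem)
    (hp : ∀ u, 1 ≤ u → u ≤ E.nt → s.mem 6 i u = prev u)
    (hQ : ∀ s' : St, Same 9 s s' → (∀ y < 3, s'.r y = s.r y) → s'.mem = s.mem →
      s'.v 9 = repAux E.nv b prev i t E.nt →
      s'.clock ≤ s.clock + (E.nt + 2) * ((E.nv + 5) * (10 * E.arith)) → Q s') :
    wp E repEntry Q s := by
  have hw : E.width = 2 * (E.nv + E.nt) := rfl
  have hr : E.rows = E.nv + E.nt + 2 := rfl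
  have hcap := cap_big E hs.nt_pos
  have hone := one_le_arith E
  have hbig : 30 * E.arith ≤ (E.nv + 5) * (10 * E.arith) := by
    calc 30 * E.arith = 3 * (10 * E.arith) := by ring
      _ ≤ _ := Nat.mul_le_mul_right _ (by omega)
  simp only [repEntry, wp_block_cons, wp_block_single, wp_atom, Atom.ok, Atom.next, true_and, h1,
    h8]
  refine ⟨⟨by omega, by omega⟩, wp_forLoop (N := E.nt + 1)
    (fun u s' => s'.v 10 = u ∧ 1 ≤ u ∧ Same 9 s s' ∧ (∀ y < 3, s'.r y = s.r y) ∧ s'.mem = s.mem ∧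
      s'.v 9 = repAux E.nv b prev i t (u - 1) ∧
      s'.clock ≤ s.clock + 2 + u * ((E.nv + 5) * (10 * E.arith)))
    (by omega) (fun j s' h => ⟨h.1, (hs.same h.2.2.1 (by omega)).succ⟩) ?_ E.nt 1 _ (by omega)
    ?_ ?_⟩
  · rintro u hu s' ⟨g1, g2, g3, g4, g5, g6, g7⟩
    have hs' := hs.same g3 (by omega)
    refine wp_repStep (b := b) (i := i) (t := t) (u := u) (x := repAux E.nv b prev i t (u - 1))
      (hs'.congr (fun _ _ => rfl) rfl) hi ((g3.1 5 (by omega)).trans h5)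
      ((g3.1 6 (by omega)).trans h6) g1 g6 ((g4 0 (by omega)).trans h0)
      ((g4 1 (by omega)).trans h1) ht1 ht g2 (by omega) (hb.congr (by rw [St.tick_mem, g5])) ?_
    intro s1 e1 e2 e3 e4 e5 e6
    have e7 : Same 9 s s1 := g3.trans e1
    refine ⟨e2, (hs.same e7 (by omega)).one, by simp, by omega, e7.setv (by omega) (by omega),
      fun y hy => (e3 y hy).trans (g4 y hy), e4.trans g5, ?_, ?_⟩
    · obtain ⟨u', rfl⟩ : ∃ u', u = u' + 1 := ⟨u - 1, by omega⟩
      simp only [St.tick_v, St.setv_v, ne_eq, Nat.reduceEqDiff, not_false_eq_true,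
        Function.update_of_ne, e5, St.tick_mem, g5, hp (u' + 1) g2 (by omega), Nat.add_sub_cancel,
        repAux]
    · simp only [St.tick_clock, St.setv_clock] at e6 ⊢
      rw [add_mul u 1, one_mul, add_mul E.nv 5]
      rw [add_mul] at e6
      rw [add_mul E.nv 5] at g7
      omega
  · refine ⟨by simp [hs.one], le_rfl, (Same.refl.setv (by omega) (by omega)).setv (by omega)
      (by omega), fun _ _ => rfl, rfl, ?_, by simp⟩
    simp [repAux, hp t ht1 ht]
  · rintro j s' hj hj' ⟨g1, g2, g3, g4, g5, g6, g7⟩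
    obtain rfl : j = E.nt + 1 := by omega
    refine hQ _ g3.tick g4 g5 g6 ?_
    rw [show E.nt + 2 = E.nt + 1 + 1 from rfl, add_mul _ 1]
    simp only [St.tick_clock]
    omega

open Cmd Atom in
/-- Compute the row of array `6` in slot `2` from the previous one in slot `1`. -/
def repRow : Cmd :=
  block [atom (copy 8 3), forLoop 8 7 (block [atom (row 0 8), repEntry, atom (store 6 2 8 9)])]

theorem wp_repRow {E : Env} {b : ℕ → ℕ → ℕ} {Q : St → Prop} {s : St} {i : ℕ} {prev : ℕ → ℕ}
    (hs : Setup E s) (hi : i < E.nv) (h5 : s.v 5 = i + 1) (h6 : s.v 6 = i)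
    (h1 : s.r 1 = i) (h2 : s.r 2 = i + 1) (hb : Bits E b s.mem)
    (hp : ∀ u, 1 ≤ u → u ≤ E.nt → s.mem 6 i u = prev u)
    (hQ : ∀ s' : St, Same 8 s s' → (∀ a k, a ≠ 6 ∨ k ≠ i + 1 → s'.mem a k = s.mem a k) →
      (∀ t, 1 ≤ t → t ≤ E.nt → s'.mem 6 (i + 1) t = repAux E.nv b prev i t E.nt) →
      s'.clock ≤ s.clock + (E.nt + 2) * ((E.nt + 4) * ((E.nv + 5) * (10 * E.arith))) → Q s') :
    wp E repRow Q s := by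
  have hw : E.width = 2 * (E.nv + E.nt) := rfl
  have hr : E.rows = E.nv + E.nt + 2 := rfl
  have hcap := cap_big E hs.nt_pos
  have hone := one_le_arith E
  have hbig : 20 * E.arith ≤ 2 * ((E.nv + 5) * (10 * E.arith)) := by
    calc 20 * E.arith = 2 * (1 * (10 * E.arith)) := by ring
      _ ≤ _ := Nat.mul_le_mul_left _ (Nat.mul_le_mul_right _ (by omega))
  set D := (E.nv + 5) * (10 * E.arith) with hD
  simp only [repRow, wp_block_cons, wp_block_single, wp_atom, Atom.ok, Atom.next, true_and]
  refine wp_forLoop (N := E.nt + 1)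
    (fun t s' => s'.v 8 = t ∧ 1 ≤ t ∧ Same 8 s s' ∧ s'.r 1 = i ∧ s'.r 2 = i + 1 ∧
      (∀ a k, a ≠ 6 ∨ k ≠ i + 1 → s'.mem a k = s.mem a k) ∧
      (∀ u, 1 ≤ u → u < t → s'.mem 6 (i + 1) u = repAux E.nv b prev i u E.nt) ∧
      s'.clock ≤ s.clock + 1 + t * ((E.nt + 4) * D))
    (by omega) (fun j s' h => ⟨h.1, (hs.same h.2.2.1 le_rfl).succ⟩) ?_ E.nt 1 _ (by omega)
    ?_ ?_
  · rintro t ht s' ⟨g1, g2, g3, g4, g5, g6, g7, g8⟩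
    have hs' := hs.same g3 le_rfl
    rw [wp_block_cons, wp_atom]
    simp only [Atom.ok, Atom.next, St.tick_v, g1]
    refine ⟨by omega, ?_⟩
    rw [wp_block_cons]
    refine wp_repEntry (b := b) (i := i) (t := t) (prev := prev) (hs'.congr (fun _ _ => rfl) rfl)
      hi ((g3.1 5 (by omega)).trans h5) ((g3.1 6 (by omega)).trans h6) g1 (by simp)
      (by simpa using g4) g2 (by omega) (hb.congr ?_) (fun u hu hu' => ?_) ?_
    · exact funext fun k => g6 11 k (by omega)
    · rw [← hp u hu hu', ← g6 6 i (by omega)]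
      rfl
    intro s1 e1 e2 e3 e4 e5
    have e6 : Same 8 s' s1 := Same.mono (s := s') e1 (by omega)
    have e7 : s1.r 1 = i := by rw [e2 1 (by omega)]; simpa using g4
    have e8 : s1.r 2 = i + 1 := by rw [e2 2 (by omega)]; simpa using g5
    have e9 : s1.v 8 = t := (e1.1 8 (by omega)).trans g1
    have e10 : s1.mem = s'.mem := e3
    simp only [wp_block_single, wp_atom, Atom.ok, Atom.next, e8, e9, e4, St.setm_v, St.tick_v]
    refine ⟨⟨by omega, by omega⟩, trivial, (hs'.same e6 le_rfl).one, by simp, by omega,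
      (g3.trans e6.setm).setv le_rfl (by omega), e7, e8, ?_, ?_, ?_⟩
    · intro a k hak
      simp only [St.tick_mem, St.setv_mem, St.setm_mem, e10]
      rw [upd_row_of_ne _ hak, g6 a k hak]
    · intro u hu hut
      simp only [St.tick_mem, St.setv_mem, St.setm_mem, e10, upd_same, Function.update_apply]
      split_ifs with hc
      · rw [hc]
      · exact g7 u hu (by omega)
    · simp only [St.tick_clock, St.setv_clock, St.setm_clock, St.setr_clock, ← hD] at e5 ⊢
      rw [add_mul t 1, one_mul, show E.nt + 4 = E.nt + 2 + 2 from rfl, add_mul (E.nt + 2) 2 D]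
      rw [show E.nt + 4 = E.nt + 2 + 2 from rfl, add_mul (E.nt + 2) 2 D] at g8
      omega
  · refine ⟨by simp [hs.one], le_rfl, Same.refl.setv (by omega) (by omega), h1, h2,
      fun _ _ _ => rfl, by omega, by simp⟩
  · rintro j s' hj hj' ⟨g1, g2, g3, g4, g5, g6, g7, g8⟩
    obtain rfl : j = E.nt + 1 := by omega
    refine hQ _ g3.tick g6 (fun t ht ht' => g7 t ht (by omega)) ?_
    have : 1 * (2 * D) ≤ (E.nt + 4) * D := by
      rw [one_mul]
      exact Nat.mul_le_mul_right _ (by omega)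
    rw [show E.nt + 2 = E.nt + 1 + 1 from rfl, add_mul _ 1, one_mul]
    simp only [St.tick_clock]
    omega

open Cmd Atom in
/-- Compute array `6`. -/
def fillReps : Cmd :=
  block [atom (row 1 2), atom (copy 8 3), forLoop 8 7 (atom (store 6 1 8 8)), atom (const 6 0),
    forLoop 6 0 (block [atom (add 5 6 3), atom (row 1 6), atom (row 2 5), repRow]),
    -- Slot `0` was used for the rows under comparison and must select row 0 again, as `Ctx`
    -- demands.
    atom (row 0 2)]

theorem wp_fillReps {E : Env} {b : ℕ → ℕ → ℕ} {Q : St → Prop} {s : St} (hs : Setup E s)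
    (hb : Bits E b s.mem)
    (hQ : ∀ s' : St, Setup E s' → s'.r 0 = 0 → (∀ a, a ≠ 6 → s'.mem a = s.mem a) →
      (∀ i ≤ E.nv, ∀ t, 1 ≤ t → t ≤ E.nt → s'.mem 6 i t = rep E.nv E.nt b i t) →
      s'.clock ≤ s.clock + (E.nv + 2) *
        (100 * E.arith + (E.nt + 2) * ((E.nt + 4) * ((E.nv + 5) * (10 * E.arith)))) +
          (E.nt + 1) * (10 * E.arith) → Q s') :
    wp E fillReps Q s := by
  have hw : E.width = 2 * (E.nv + E.nt) := rfl
  have hr : E.rows = E.nv + E.nt + 2 := rfl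
  have hcap := cap_big E hs.nt_pos
  have hone := one_le_arith E
  simp only [fillReps, wp_block_cons, wp_atom, Atom.ok, Atom.next, true_and, hs.zero]
  refine ⟨by omega, wp_forLoop (N := E.nt + 1)
    (fun t s' => s'.v 8 = t ∧ 1 ≤ t ∧ Same 8 s s' ∧ s'.r 1 = 0 ∧
      (∀ a, a ≠ 6 → s'.mem a = s.mem a) ∧ (∀ u, 1 ≤ u → u < t → s'.mem 6 0 u = u) ∧
      s'.clock ≤ s.clock + 1 + 13 * E.arith + t * (10 * E.arith))
    (by omega) (fun j s' h => ⟨h.1, (hs.same h.2.2.1 le_rfl).succ⟩) ?_ E.nt 1 _ (by omega) ?_ ?_⟩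
  · rintro t ht s' ⟨g1, g2, g3, g4, g5, g6, g7⟩
    have hs' := hs.same g3 le_rfl
    simp only [wp_atom, Atom.ok, Atom.next, St.tick_v, St.tick_r, g1, g4, St.setm_v]
    refine ⟨⟨by omega, by omega⟩, trivial, hs'.one, by simp, by omega,
      Same.setv g3 le_rfl (by omega), g4, ?_, ?_, ?_⟩
    · intro a ha
      simp only [St.tick_mem, St.setv_mem, St.setm_mem]
      rw [upd_of_ne _ ha, g5 a ha]
    · intro u hu hut
      simp only [St.tick_mem, St.setv_mem, St.setm_mem, upd_same, Function.update_apply]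
      split_ifs with hc
      · rw [hc]
      · exact g6 u hu (by omega)
    · simp only [St.tick_clock, St.setv_clock, St.setm_clock]
      rw [add_mul t 1]
      omega
  · refine ⟨by simp [hs.one], le_rfl, Same.refl.setr.setv (by omega) (by omega), by simp,
      fun _ _ => rfl, by omega, ?_⟩
    simp only [St.tick_clock, St.setv_clock, St.setr_clock]
    omega
  · rintro j s1 hj hj' ⟨g1, g2, g3, g4, g5, g6, g7⟩
    obtain rfl : j = E.nt + 1 := by omega
    have hs1 := hs.same g3 le_rfl
    set D := (E.nt + 2) * ((E.nt + 4) * ((E.nv + 5) * (10 * E.arith))) with hD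
    rw [wp_block_cons, wp_atom, wp_block_cons]
    refine ⟨by simp [Atom.ok], wp_forLoop (N := E.nv)
      (fun i s' => s'.v 6 = i ∧ i ≤ E.nv ∧ Setup E s' ∧ (∀ a, a ≠ 6 → s'.mem a = s.mem a) ∧
        (∀ k ≤ i, ∀ t, 1 ≤ t → t ≤ E.nt → s'.mem 6 k t = rep E.nv E.nt b k t) ∧
        s'.clock ≤ s1.clock + 10 + i * (100 * E.arith + D))
      (by omega) (fun j s' h => ⟨h.1, h.2.2.1.nv⟩) ?_ E.nv 0 _ (by omega) ?_ ?_⟩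
    · rintro i hi s' ⟨k1, -, k3, k4, k5, k6⟩
      simp only [wp_block_cons, wp_atom, Atom.ok, Atom.next, St.tick_v, St.setv_v, k1, k3.one,
        St.setr_v, Function.update_self, ne_eq, Nat.reduceEqDiff, not_false_eq_true,
        Function.update_of_ne]
      refine ⟨by omega, by omega, by omega, ?_⟩
      have hset : ∀ s2 : St, s2.v = Function.update s'.v 5 (i + 1) → s2.out = s'.out →
          Setup E s2 := fun s2 hv ho => k3.congr (fun x hx => by
        rw [hv, Function.update_of_ne (by omega)]) ho
      refine wp_repRow (b := b) (i := i) (prev := rep E.nv E.nt b i) (hset _ rfl rfl) hi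
        (by simp) (by simpa using k1) (by simp) (by simp) (hb.congr (k4 11 (by omega)))
        (fun u hu hu' => k5 i le_rfl u hu hu') ?_
      intro s2 e1 e2 e3 e4
      have hs2 : Setup E s2 := by refine Setup.same (hset _ ?_ ?_) e1 le_rfl <;> rfl
      refine ⟨?_, hs2.one, by simp, by omega, hs2.congr (fun x hx => ?_) rfl, ?_, ?_, ?_⟩
      · rw [e1.1 6 (by omega)]
        simpa using k1
      · simp only [St.tick_v, St.setv_v]
        rw [Function.update_of_ne (by omega)]
      · intro a ha
        rw [← k4 a ha]
        exact funext fun k => e2 a k (.inl ha)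
      · intro k hk t ht ht'
        rcases Nat.eq_or_lt_of_le hk with rfl | hlt
        · exact e3 t ht ht'
        · refine Eq.trans ?_ (k5 k (by omega) t ht ht')
          exact congrFun (e2 6 k (by omega)) t
      · simp only [St.tick_clock, St.setv_clock, St.setr_clock, ← hD] at e4 ⊢
        rw [add_mul i 1, one_mul]
        omega
    · refine ⟨by simp [Atom.next], by omega, hs1.congr (fun x hx => ?_) rfl, g5, ?_,
        by simp [Atom.next]⟩
      · simp only [Atom.next, St.tick_v, St.setv_v]
        rw [Function.update_of_ne (by omega)]
      · intro k hk t ht ht'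
        obtain rfl : k = 0 := by omega
        exact g6 t ht (by omega)
    · rintro j s2 hj hj' ⟨k1, -, k3, k4, k5, k6⟩
      obtain rfl : j = E.nv := by omega
      rw [wp_block_single, wp_atom]
      refine ⟨by simp [Atom.ok, k3.zero, hr], hQ _ (k3.congr (fun _ _ => rfl) rfl) ?_ k4 k5 ?_⟩
      · simp [Atom.next, k3.zero]
      · simp only [Atom.next, St.tick_clock, St.setr_clock]
        rw [add_mul _ 2]
        omega

/-! ### The first frame -/

theorem Frame.zero {n m : ℕ} {T H X B z : ℕ → ℕ} (hT : ∀ c, T c = 0) (hH : ∀ c, H c = 0)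
    (hB : ∀ c, B c = 0) : Frame n m T H X B ∅ ∅ z := by
  refine ⟨le_rfl, by simp, fun q _ => ⟨[], hH q, List.nodup_nil, by simp⟩, by simp [hB],
    by simp [hT], ?_, fun _ => hT 1⟩
  intro v _ _ _
  simp [hT]

theorem used_le_card (S : Finset ℕ) (z : ℕ → ℕ) : used S z ≤ S.card := Finset.card_image_le

open Cmd Atom in
/-- Insert the row in scalar `8` into the first frame. -/
def fillStep : Cmd :=
  block [atom (copy 10 8), atom (load 11 5 1 8), ite 11 0 (insertRow 1) (atom (const 13 0))]

theorem wp_fillStep {E : Env} {b : ℕ → ℕ → ℕ} {Q : St → Prop} {s : St} {t : ℕ} {S : Finset ℕ}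
    (hs : Ctx E b s) (h1 : s.r 1 = 0) (h8 : s.v 8 = t) (ht1 : 1 ≤ t) (ht : t ≤ E.nt)
    (hF : FrameAt E s.mem 0 S S (nextZero E.nv b · 0))
    (hQ : ∀ (s' : St) (S' : Finset ℕ),
      S' = (if nextZero E.nv b t 0 < E.nv then insert t S else S) →
      s'.out = s.out → s'.r = s.r → (∀ x, x < 10 ∨ 14 < x → s'.v x = s.v x) →
      (∀ a k', (a < 7 ∨ 10 < a ∨ k' ≠ 0) → s'.mem a k' = s.mem a k') →
      FrameAt E s'.mem 0 S' S' (nextZero E.nv b · 0) →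
      s'.clock + E.opening * used S (nextZero E.nv b · 0) ≤
        s.clock + 20 + E.opening * used S' (nextZero E.nv b · 0) → Q s') :
    wp E fillStep Q s := by
  have hw : E.width = 2 * (E.nv + E.nt) := rfl
  have hr : E.rows = E.nv + E.nt + 2 := rfl
  have e := hs.tables.nz 0 (by omega) t ht1 ht
  simp only [fillStep, wp_block_cons, wp_block_single, wp_atom, wp_ite, Atom.ok, Atom.next,
    St.tick_v, St.tick_r, St.setv_v, St.setv_r, h8, h1, Function.update_self, ne_eq,
    Nat.reduceEqDiff, not_false_eq_true, Function.update_of_ne, St.tick_mem, St.setv_mem, e,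
    hs.nv, true_and, OfNat.zero_ne_ofNat]
  refine ⟨⟨by omega, by omega⟩, ?_⟩
  split_ifs with hlt
  · refine wp_insertRow (b := b) (k := 0) (t := t) (S := S) (P := S)
      (z := (nextZero E.nv b · 0)) (hs.congr (fun x hx => ?_) rfl (fun _ _ => rfl)) h1 (by omega)
      (by simp) ht1 ht (by simp) hlt hF id ?_
    · simp only [St.tick_v, St.setv_v]
      rw [Function.update_of_ne (by omega), Function.update_of_ne (by omega)]
    · intro s' g1 g2 g3 g4 _ g6 g7
      refine hQ s' _ (if_pos hlt).symm g1 g2 (fun x hx => ?_) g4 g6 ?_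
      · rw [g3 x (by omega)]
        simp only [St.tick_v, St.setv_v]
        rw [Function.update_of_ne (by omega), Function.update_of_ne (by omega)]
      · simp only [St.tick_clock, St.setv_clock] at g7
        omega
  · refine ⟨by omega, hQ _ S (if_neg hlt).symm rfl rfl (fun x hx => ?_) (fun _ _ _ => rfl) hF ?_⟩
    · simp only [St.tick_v, St.setv_v]
      rw [Function.update_of_ne (by omega), Function.update_of_ne (by omega),
        Function.update_of_ne (by omega)]
    · simp only [St.tick_clock, St.setv_clock]
      omega

open Cmd Atom in
/-- Prepare the first frame. -/
def fillFrame : Cmd :=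
  block [atom (row 1 2), atom (copy 8 3), forLoop 8 7 fillStep, atom (const 4 0),
    atom (const 15 1)]

/-- Zero memory already represents empty frames at every level, so it remains to insert the rows
that have a zero. At position 0 every row represents itself, and at most `E.nt` buckets are opened.
-/
theorem wp_fillFrame {E : Env} {b : ℕ → ℕ → ℕ} {Q : St → Prop} {s : St} (hs : Ctx E b s)
    (h7 : s.v 7 = E.nt + 1) (hword : ∀ j < E.nv, s.mem 0 0 j = 1)
    (hmem : ∀ a, 7 ≤ a → a ≤ 10 → ∀ k c, s.mem a k c = 0)
    (hQ : ∀ s' : St, Run E b 0 0 (Finset.Icc 1 E.nt) (fun _ => 1) s' → s'.out = s.out →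
      s'.clock ≤ s.clock + (E.nt + 2) * (40 * E.arith + E.opening) → Q s') :
    wp E fillFrame Q s := by
  have hw : E.width = 2 * (E.nv + E.nt) := rfl
  have hr : E.rows = E.nv + E.nt + 2 := rfl
  have hcap := cap_big E hs.nt_pos
  have hone := one_le_arith E
  have hF : ∀ k z, FrameAt E s.mem k ∅ ∅ z := fun k z =>
    Frame.zero (hmem 7 (by omega) (by omega) k) (hmem 8 (by omega) (by omega) k)
      (hmem 10 (by omega) (by omega) k)
  simp only [fillFrame, wp_block_cons, wp_atom, Atom.ok, Atom.next, true_and, hs.zero]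
  refine ⟨by omega, wp_forLoop (N := E.nt + 1)
    (fun t s' => s'.v 8 = t ∧ 1 ≤ t ∧ t ≤ E.nt + 1 ∧ Ctx E b s' ∧ s'.v 7 = E.nt + 1 ∧
      s'.out = s.out ∧ s'.r 1 = 0 ∧
      (∀ a k', (a < 7 ∨ 10 < a ∨ k' ≠ 0) → s'.mem a k' = s.mem a k') ∧
      FrameAt E s'.mem 0 (live E.nv b 0 (Finset.Ico 1 t)) (live E.nv b 0 (Finset.Ico 1 t))
        (nextZero E.nv b · 0) ∧
      s'.clock ≤ s.clock + 1 + 13 * E.arith + t * (40 * E.arith) +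
        E.opening * used (live E.nv b 0 (Finset.Ico 1 t)) (nextZero E.nv b · 0))
    (by omega) (fun j s' h => ⟨h.1, h.2.2.2.2.1⟩) ?_ E.nt 1 _ (by omega) ?_ ?_⟩
  · rintro t ht s' ⟨g1, g2, g3, g4, g5, g6, g7, g8, g9, g10⟩
    refine wp_fillStep (b := b) (t := t) (S := live E.nv b 0 (Finset.Ico 1 t))
      (g4.congr (fun _ _ => rfl) rfl (fun _ _ => rfl)) g7 g1 g2 (by omega) g9 ?_
    intro s1 S' hS' e1 e2 e3 e4 e5 e6
    obtain rfl : S' = live E.nv b 0 (Finset.Ico 1 (t + 1)) := by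
      rw [hS']
      simp only [live, ← Finset.insert_Ico_right_eq_Ico_add_one g2, Finset.filter_insert]
    refine ⟨(e3 8 (by omega)).trans g1, (e3 3 (by omega)).trans g4.one, by simp, by omega,
      by omega, g4.congr (fun x hx => ?_) (congrFun e2 0) (fun a ha => ?_), ?_, e1.trans g6,
      (congrFun e2 1).trans g7, fun a k' hak => (e4 a k' hak).trans (g8 a k' hak), e5, ?_⟩
    · simp only [St.tick_v, St.setv_v]
      rw [Function.update_of_ne (by omega), e3 x (by omega)]
      rfl
    · exact funext fun k' => e4 a k' (by omega)
    · exact (e3 7 (by omega)).trans g5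
    · simp only [St.tick_clock, St.setv_clock] at e6 ⊢
      rw [add_mul t 1]
      omega
  · refine ⟨by simp [hs.one], le_rfl, by omega, hs.congr (fun x hx => ?_) rfl (fun _ _ => rfl),
      by simpa using h7, rfl, by simp, fun _ _ _ => rfl, ?_, ?_⟩
    · simp only [St.tick_v, St.setv_v, St.setr_v]
      rw [Function.update_of_ne (by omega)]
    · simpa [live] using hF 0 _
    · simp only [St.tick_clock, St.setv_clock, St.setr_clock]
      omega
  · rintro j s' hj hj' ⟨g1, g2, g3, g4, g5, g6, g7, g8, g9, g10⟩
    obtain rfl : j = E.nt + 1 := by omega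
    have hI : Finset.Ico 1 (E.nt + 1) = Finset.Icc 1 E.nt := rfl
    rw [hI] at g9 g10
    simp only [wp_block_cons, wp_block_single, wp_atom, Atom.ok, Atom.next]
    refine ⟨by omega, by omega, hQ _ ⟨g4.congr (fun x hx => ?_) rfl (fun _ _ => rfl), by simp,
      by simp, le_rfl, by omega, ?_, fun _ _ _ => rfl, ?_, g9, ?_⟩ g6 ?_⟩
    · simp only [St.tick_v, St.setv_v]
      rw [Function.update_of_ne (by omega), Function.update_of_ne (by omega)]
    · intro t ht
      simpa [rep] using ht
    · intro j hj
      rw [← hword j hj]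
      exact congrFun (g8 0 0 (by omega)) j
    · intro k hk _
      exact (hF k _).congr fun a _ _ => g8 a k (by omega)
    · have h1 : used (live E.nv b 0 (Finset.Icc 1 E.nt)) (nextZero E.nv b · 0) ≤ E.nt + 2 := by
        refine (used_le_card _ _).trans ((Finset.card_filter_le _ _).trans ?_)
        simp
      have h2 : _ ≤ E.opening * (E.nt + 1 + 1) := Nat.mul_le_mul_left E.opening h1
      rw [mul_add, mul_comm _ E.opening,
        show E.nt + 2 = E.nt + 1 + 1 from rfl, add_mul (E.nt + 1) 1]
      simp only [St.tick_clock, St.setv_clock]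
      omega

end While

/-! ### The machine -/

namespace While

open Monotone (Rows words count work)

/-- The initial state. -/
def start (E : Env) : St :=
  -- The index `E.rows` marks all slots as not yet selected.
  ⟨fun x => if x = 0 then E.nv else if x = 1 then E.nt else 0, fun _ => E.rows, fun _ _ _ => 0,
    [], 0⟩

open Cmd Atom in
/-- The precomputation phase. -/
def precompute : Cmd :=
  block [atom (const 3 1), atom (row 0 2), atom (add 7 1 3), fillWord, fillTree, fillBits,
    fillZeros, fillReps, fillFrame]

/-- Bound on the time of the precomputation phase. -/
def preTime {R : Type*} [CommSemiring R] (n m a o : R) : R :=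
  30 * a + (n + 1) * (10 * a) + (n + 2) * (20 * a) + (m + 2) * (30 * a + n * (10 * a)) +
    (n + 1) * ((m + 5) * (30 * a)) +
    ((n + 2) * (100 * a + (m + 2) * ((m + 4) * ((n + 5) * (10 * a)))) + (m + 1) * (10 * a)) +
    (m + 2) * (40 * a + o)

theorem wp_precompute {E : Env} {b : ℕ → ℕ → ℕ} {Q : St → Prop} (hnt : 1 ≤ E.nt)
    (hb : ∀ t, 1 ≤ t → t ≤ E.nt → ∀ j < E.nv, b t j = E.inp (2 + (t - 1) * E.nv + j))
    (hQ : ∀ s', Run E b 0 0 (Finset.Icc 1 E.nt) (fun _ => 1) s' → s'.out = [] →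
      -- The summand on the left leaves room for the fourteen instructions of the prologue.
      s'.clock + 14 * E.arith ≤ preTime E.nv E.nt E.arith E.opening → Q s') :
    wp E precompute Q (start E) := by
  have hw : E.width = 2 * (E.nv + E.nt) := rfl
  have hr : E.rows = E.nv + E.nt + 2 := rfl
  have hcap := cap_big E hnt
  have hone := one_le_arith E
  have hin : 2 + E.nv * E.nt ≤ E.cap := by
    simp only [Env.cap, Env.base]
    omega
  rw [precompute, wp_block_cons, wp_atom, wp_block_cons, wp_atom, wp_block_cons, wp_atom,
    wp_block_cons]
  refine ⟨by simp [Atom.ok], by simp [Atom.ok, Atom.next, start, hr], ?_, ?_⟩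
  · simp only [Atom.ok, Atom.next, start, St.tick_v, St.setr_v, St.setv_v]
    simp
    omega
  generalize hs : Atom.next E _ _ = s
  have h0 : s.r 0 = 0 := by simp [← hs, Atom.next, start]
  have hm : s.mem = fun _ _ _ => 0 := by rw [← hs]; rfl
  have hc : s.clock = 1 + 13 * E.arith + E.arith := by simp [← hs, Atom.next, start]
  have hs0 : Setup E s := by
    refine ⟨hnt, ?_, ?_, ?_, ?_, ?_, ?_⟩ <;> simp [← hs, Atom.next, start]
  clear hs
  refine wp_fillWord hs0 h0 fun s1 a1 a2 a3 a4 a5 => ?_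
  have hs1 := hs0.same a1 le_rfl
  rw [wp_block_cons]
  refine wp_fillTree hs1 (by rw [a2, h0]) (by rw [a3 3 (by omega), hm])
    fun s2 b1 b2 b3 b4 b5 b6 b7 => ?_
  have hs2 := hs1.same b1 le_rfl
  rw [wp_block_cons]
  refine wp_fillBits hs2 hin fun s3 c1 c2 c3 c4 c5 => ?_
  have hs3 := hs2.same c1 le_rfl
  rw [wp_block_cons]
  have hB : Bits E b s3.mem := fun t h1 h2 j hj => by rw [c4 t h1 h2 j hj, hb t h1 h2 j hj]
  refine wp_fillZeros hs3 hB fun s4 hs4 d2 d3 d4 d5 => ?_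
  rw [wp_block_cons]
  refine wp_fillReps hs4 (hB.congr (d3 11 (by omega))) fun s5 hs5 e2 e3 e4 e5 => ?_
  rw [wp_block_single]
  have keep : ∀ a, a < 4 → s5.mem a = s2.mem a := fun a ha => by
    rw [e3 a (by omega), d3 a (by omega), c3 a (by omega)]
  refine wp_fillFrame (b := b) ⟨hs5.nt_pos, hs5.nv, hs5.nt, hs5.zero, hs5.one, e2,
    ⟨?_, ?_, ?_, ?_, ?_⟩⟩ hs5.succ ?_ ?_ fun s6 g1 g2 g3 => hQ s6 g1 (g2.trans hs5.out) ?_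
  · rw [keep 1 (by omega)]; exact b4
  · rw [keep 2 (by omega)]; exact b5
  · rw [keep 3 (by omega)]; exact b6
  · rw [e3 5 (by omega)]; exact d4
  · exact e4
  · intro j hj
    rw [keep 0 (by omega), b3 0 (by omega) (by omega) (by omega), a4 j hj]
  · intro a h7 h10 k c
    rw [e3 a (by omega), d3 a (by omega), c3 a (by omega), b3 a (by omega) (by omega) (by omega),
      a3 a (by omega), hm]
  · simp only [preTime]
    omega

open Cmd Atom in
/-- The enumeration phase. -/
def enumerate : Cmd := .seq (atom (emit 0)) mainLoop

/-- The all-ones word is not among `words` and is output separately. A last round of the loop finds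
the empty frame at level 0 and clears the flag. -/
theorem wp_enumerate {E : Env} {b : ℕ → ℕ → ℕ} {Q : St → Prop} (hR : Rows E.nv E.nt b) {s : St}
    {A : Finset ℕ} (hs : Run E b 0 0 A (fun _ => 1) s)
    (hQ : ∀ s' : St, s'.out = s.out ++ ((fun _ => 1) :: words E.nv E.nt b E.nv 0 A fun _ => 1).map
        (fun β => (List.range E.nv).map β) →
      s'.clock ≤ s.clock + 50 * E.arith + 61 * E.opening * count E.nv E.nt b E.nv 0 A +
        40 * work E.nv E.nt b E.nv 0 A → Q s') :
    wp E enumerate Q s := by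
  have hw : E.width = 2 * (E.nv + E.nt) := rfl
  have hr : E.rows = E.nv + E.nt + 2 := rfl
  have hnt := hs.ctx.nt_pos
  have hcap := cap_big E hnt
  have hone := one_le_arith E
  have hc := hs.ctx
  rw [enumerate, wp_seq, wp_atom]
  refine ⟨by simp only [Atom.ok, hc.row, hc.nv]; omega, wp_run hR E.nv 0 0 A (fun _ => 1)
    ((Atom.emit 0).next E s) Q (by omega) ⟨hc.congr (fun _ _ => rfl) rfl (fun _ _ => rfl), hs.go,
      hs.level, hs.level_le, hs.le, hs.canonical, hs.ones, hs.word, hs.frame, hs.clean⟩ ?_⟩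
  intro s1 g1 _ g3 g4
  have hc1 := g1.ctx
  have hroot : s1.mem 7 0 1 = 0 := by
    have h := g1.frame
    rw [live_self] at h
    exact h.root_of_empty
  refine wp_loop_of_lt (by rw [hc1.zero, g1.go]; omega) ?_
  simp only [mainBody, wp_block_cons, wp_block_single, wp_atom, wp_ite, Atom.ok, Atom.next,
    St.tick_v, St.tick_r, St.setv_v, St.setv_r, St.setr_v, St.setr_r, g1.level, hc1.one,
    Function.update_self, ne_eq, Nat.reduceEqDiff, not_false_eq_true, Function.update_of_ne,
    St.tick_mem, St.setv_mem, St.setr_mem, hc1.zero, OfNat.one_ne_ofNat, hroot, lt_irrefl, if_false]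
  refine ⟨by omega, by omega, by omega, ⟨by omega, by omega⟩, by omega, ?_⟩
  refine wp_loop_of_not_lt (by simp) (hQ _ ?_ ?_)
  · simp only [St.tick_out, St.setv_out, St.setr_out]
    rw [g3]
    have : (List.range E.nv).map (s.mem 0 0) = (List.range E.nv).map fun _ => 1 :=
      List.map_congr_left fun j hj => hs.word j (List.mem_range.1 hj)
    simp [Atom.next, hc.nv, hc.row, this]
  · simp only [St.tick_clock, St.setv_clock, St.setr_clock]
    simp only [Atom.next, St.tick_clock, St.push_clock] at g4
    omega

end While

/-! ### The prologue and the two phases of the whole machine -/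

namespace While

open Monotone (Rows words count work)

/-- Read the parameters and compute the layout of the memory; stop if there are no terms. -/
def prologue : List Instr :=
  -- Register 6 is still 0 and serves as index 0 and as the zero of the test. The base address is
  -- then accumulated as `nm + 80 + 1 + 1`.
  [.const 4 80, .const 5 1, .load 8 4 6, .load 9 4 5, .jumpLT 6 9 6, .halt, .mul 2 8 9,
    .add 2 2 4, .add 2 2 5, .add 2 2 5, .add 1 8 9, .add 1 1 1, .const 3 12, .mul 3 3 1]

/-- The machine that enumerates the models of a monotone formula. -/
def machine : RAM := ⟨prologue ++ (Cmd.seq precompute enumerate).code 14, 80⟩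

theorem code_prologue {i : ℕ} (hi : i < 14) : machine.code[i]? = prologue[i]? :=
  List.getElem?_append_left hi

theorem codeAt_precompute : CodeAt machine 14 (precompute.code 14) := by
  have h : CodeAt machine 0 machine.code := fun i _ => by rw [Nat.zero_add]
  exact (CodeAt.append (CodeAt.append h).2).1

theorem codeAt_enumerate :
    CodeAt machine (14 + precompute.len) (enumerate.code (14 + precompute.len)) := by
  have h : CodeAt machine 0 machine.code := fun i _ => by rw [Nat.zero_add]
  have h2 := (CodeAt.append (CodeAt.append h).2).2
  rwa [Cmd.length_code] at h2

theorem code_end : machine.code[14 + precompute.len + enumerate.len]? = none := by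
  rw [List.getElem?_eq_none_iff]
  show (prologue ++ (Cmd.seq precompute enumerate).code 14).length ≤ _
  rw [List.length_append, Cmd.length_code]
  show 14 + (precompute.len + enumerate.len) ≤ _
  omega

theorem wf_precompute : precompute.wf = true := by decide

theorem wf_enumerate : enumerate.wf = true := by decide

/-- The letters of the input word. -/
structure Input (E : Env) (w : List ℕ) : Prop where
  inp : ∀ j, E.inp j = w.getD j 0
  length : w.length = 2 + E.nv * E.nt
  nv : w.getD 0 0 = E.nv
  nt : w.getD 1 0 = E.nt
  le : ∀ j, w.getD j 0 ≤ E.cap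

theorem Input.safe {E : Env} {w : List ℕ} (h : Input E w) : Safe E.cap (machine.init w).reg := by
  intro a
  show (if a < 80 then 0 else w.getD (a - 80) 0) ≤ E.cap ∧
    (E.cap ≤ a → (if a < 80 then 0 else w.getD (a - 80) 0) = 0)
  have hb : 82 + E.nv * E.nt ≤ E.cap := by
    simp only [Env.cap, Env.base]
    omega
  split_ifs
  · exact ⟨Nat.zero_le _, fun _ => rfl⟩
  · refine ⟨h.le _, fun ha => List.getD_eq_default _ _ ?_⟩
    have := h.length
    omega

/-- The machine reaches program position `k` with registers `R`, in time at most `a` for each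
position, and `P` holds on the way. -/
def Reaches (P : (ℕ → ℕ) → Prop) (a : ℕ) (w : List ℕ) (k : ℕ) (R : ℕ → ℕ) : Prop :=
  P R ∧ ∃ c, Steps machine P (machine.init w) c ∧ c.pc = k ∧ c.reg = R ∧ c.out = [] ∧
    c.clock ≤ k * a

theorem Reaches.plain {P : (ℕ → ℕ) → Prop} {a : ℕ} {w : List ℕ} {k i x : ℕ} {R : ℕ → ℕ}
    (h : Reaches P a w k R) (I : Instr) (hI : machine.code[k]? = some I) (hp : Plain I)
    (ho : I.emit R = []) (hR : I.nextReg R = Function.update R i x) (hcost : I.cost R ≤ a)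
    (hP : P (Function.update R i x)) : Reaches P a w (k + 1) (Function.update R i x) := by
  obtain ⟨hs, c, hc, rfl, rfl, hout, hclock⟩ := h
  refine ⟨hP, _, hc.trans (.plain hI hp hs (.refl ?_)), rfl, hR, ?_, ?_⟩
  · rw [hR]
    exact hP
  · simp [hout, ho]
  · simp only [add_mul, one_mul]
    omega

theorem Reaches.safe {E : Env} {w : List ℕ} {k i x : ℕ} {R : ℕ → ℕ}
    (h : Reaches (Safe E.cap) E.arith w k R) (I : Instr) (hI : machine.code[k]? = some I)
    (hp : Plain I) (ho : I.emit R = []) (hR : I.nextReg R = Function.update R i x)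
    (hi : i < E.cap) (hx : x ≤ E.cap) :
    Reaches (Safe E.cap) E.arith w (k + 1) (Function.update R i x) :=
  h.plain I hI hp ho hR (cost_le h.1 I) (h.1.update hi hx)

theorem Reaches.jump {P : (ℕ → ℕ) → Prop} {a : ℕ} {w : List ℕ} {k i j l : ℕ} {R : ℕ → ℕ}
    (h : Reaches P a w k R) (hI : machine.code[k]? = some (.jumpLT i j l)) (ha : 1 ≤ a) {l' : ℕ}
    (hl : (if R i < R j then l else k + 1) = l') (hk : k < l') : Reaches P a w l' R := by
  obtain ⟨hs, c, hc, rfl, rfl, hout, hclock⟩ := h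
  have hstep : machine.step c = ⟨l', c.reg, c.out, c.clock + 1⟩ := by
    simp [RAM.step, hI, Instr.nextPc, hl, Instr.nextReg, Instr.emit, Instr.cost]
  refine ⟨hs, _, hc.trans (.head hs (.refl ?_)), by rw [hstep], by rw [hstep], ?_, ?_⟩
  · rw [hstep]
    exact hs
  · rw [hstep]
    exact hout
  · rw [hstep]
    have h2 : (c.pc + 1) * a ≤ l' * a := Nat.mul_le_mul_right _ hk
    rw [add_mul] at h2
    show c.clock + 1 ≤ l' * a
    omega

/-- The registers up to the test for the empty formula. -/
theorem reaches_test {P : (ℕ → ℕ) → Prop} {a n m : ℕ} {w : List ℕ} (ha : 1 ≤ a)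
    (h0 : P (machine.init w).reg) (hn : w.getD 0 0 = n) (hm : w.getD 1 0 = m)
    (hP : ∀ R i x, P R → i < 10 → x ≤ max 80 (max n m) → P (Function.update R i x)) :
    Reaches P a w 4 (Function.update (Function.update (Function.update
      (Function.update (machine.init w).reg 4 80) 5 1) 8 n) 9 m) := by
  have h6 : (machine.init w).reg 6 = 0 := rfl
  have h80 : (machine.init w).reg 80 = n := hn
  have h81 : (machine.init w).reg 81 = m := hm
  have h0 : Reaches P a w 0 (machine.init w).reg :=
    ⟨h0, _, .refl h0, rfl, rfl, rfl, by simp [RAM.init]⟩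
  have h1 := h0.plain (i := 4) (x := 80) (.const 4 80) (code_prologue (by omega)) trivial rfl rfl
    ha (hP _ _ _ h0.1 (by omega) (by omega))
  have h2 := h1.plain (i := 5) (x := 1) (.const 5 1) (code_prologue (by omega)) trivial rfl rfl
    ha (hP _ _ _ h1.1 (by omega) (by omega))
  have h3 := h2.plain (i := 8) (x := n) (.load 8 4 6) (code_prologue (by omega)) trivial rfl
    (by simp [Instr.nextReg, h6, h80]) ha (hP _ _ _ h2.1 (by omega) (by omega))
  exact h3.plain (i := 9) (x := m) (.load 9 4 5) (code_prologue (by omega)) trivial rfl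
    (by simp [Instr.nextReg, h81]) ha (hP _ _ _ h3.1 (by omega) (by omega))

theorem steps_prologue {E : Env} {w : List ℕ} (h : Input E w) (hnt : 1 ≤ E.nt) :
    ∃ c, Steps machine (Safe E.cap) (machine.init w) c ∧ c.pc = 14 ∧ Sim E (start E) c.reg ∧ c.out = [] ∧
      c.clock ≤ 14 * E.arith := by
  have hcap := cap_big E hnt
  have hcap' := cap_ge E
  have hb : E.base ≤ E.cap := by
    simp only [Env.cap]
    omega
  have hbase : E.base = 82 + E.nv * E.nt := rfl
  have hw : E.width = 2 * (E.nv + E.nt) := rfl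
  have hw12 : 12 * E.width ≤ E.cap := by
    have : E.width * 12 ≤ E.width * (12 * E.rows) := by
      refine Nat.mul_le_mul_left _ ?_
      simp only [Env.rows]
      omega
    simp only [Env.cap]
    omega
  set R := (machine.init w).reg with hR
  have hsafe := h.safe
  have hlow : ∀ a < 80, R a = 0 := fun a ha => if_pos ha
  have hhigh : ∀ j, R (80 + j) = E.inp j := fun j => by
    show (if 80 + j < 80 then 0 else w.getD (80 + j - 80) 0) = _
    rw [if_neg (by omega), Nat.add_sub_cancel_left, h.inp]
  have hn : E.nv ≤ E.cap ∧ E.nt ≤ E.cap := by omega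
  have h4 := reaches_test (one_le_arith E) hsafe h.nv h.nt
    fun R i x hR hi hx => hR.update (by omega) (by omega)
  have h6 := h4.jump (l' := 6) (code_prologue (by omega)) (one_le_arith E)
    (if_pos (by simp [← hR, hlow]; omega)) (by omega)
  have h7 := h6.safe (i := 2) (x := E.nv * E.nt) (.mul 2 8 9) (code_prologue (by omega)) trivial
    rfl (by simp [Instr.nextReg]) (by omega) (by omega)
  have h8 := h7.safe (i := 2) (x := E.nv * E.nt + 80) (.add 2 2 4) (code_prologue (by omega))
    trivial rfl (by simp [Instr.nextReg]) (by omega) (by omega)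
  have h9 := h8.safe (i := 2) (x := E.nv * E.nt + 80 + 1) (.add 2 2 5) (code_prologue (by omega))
    trivial rfl (by simp [Instr.nextReg]) (by omega) (by omega)
  have h10 := h9.safe (i := 2) (x := E.base) (.add 2 2 5) (code_prologue (by omega))
    trivial rfl (by simp [Instr.nextReg, hbase]; congr 1; omega) (by omega) (by omega)
  have h11 := h10.safe (i := 1) (x := E.nv + E.nt) (.add 1 8 9) (code_prologue (by omega))
    trivial rfl (by simp [Instr.nextReg]) (by omega) (by omega)
  have h12 := h11.safe (i := 1) (x := E.width) (.add 1 1 1) (code_prologue (by omega))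
    trivial rfl (by simp [Instr.nextReg, hw, two_mul]) (by omega) (by omega)
  have h13 := h12.safe (i := 3) (x := 12) (.const 3 12) (code_prologue (by omega))
    trivial rfl rfl (by omega) (by omega)
  have h14 := h13.safe (i := 3) (x := 12 * E.width) (.mul 3 3 1) (code_prologue (by omega))
    trivial rfl (by simp [Instr.nextReg]) (by omega) hw12
  simp only [← hR, Function.update_idem] at h14
  obtain ⟨hs14, c, hc, hpc, hreg, hout, hclock⟩ := h14
  refine ⟨c, hc, hpc, ?_, hout, hclock⟩
  rw [← hreg] at hs14
  have hval : ∀ a, 10 ≤ a → c.reg a = R a := fun a ha => by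
    rw [hreg]
    simp only [Function.update_apply]
    split_ifs <;> omega
  refine ⟨by simp [hreg], by simp [hreg], by simp [hreg], by simp [hreg], by simp [hreg], ?_, ?_,
    ?_, ?_, hs14⟩
  · intro x hx
    by_cases hx2 : 2 ≤ x
    · rw [hval _ (by omega), hlow _ (by omega)]
      show 0 = if x = 0 then E.nv else if x = 1 then E.nt else 0
      rw [if_neg (by omega), if_neg (by omega)]
    · obtain rfl | rfl : x = 0 ∨ x = 1 := by omega
      · simp [hreg, start]
      · simp [hreg, start]
  -- No slot is selected yet, so there is nothing to show about pointers.
  · intro a _ y _ hlt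
    exact absurd hlt (lt_irrefl _)
  · intro a _ k _ x _
    have hge := addr_ge (E := E) (a := a) (k := k) (c := x)
    rw [hval _ (by omega)]
    obtain ⟨j, hj⟩ : ∃ j, E.addr a k x = 80 + j := ⟨E.addr a k x - 80, by omega⟩
    rw [hj, hhigh, h.inp]
    refine List.getD_eq_default _ _ ?_
    have := h.length
    omega
  · intro j _
    rw [hval _ (by omega), hhigh]

/-- Register contents are bounded by `V`, and the registers from `82` on hold `0`. -/
def Small (V : ℕ) (R : ℕ → ℕ) : Prop := ∀ a, R a ≤ V ∧ (82 ≤ a → R a = 0)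

/-- If there are no terms, then the machine stops without output. -/
theorem steps_empty (n : ℕ) :
    ∃ c, Steps machine (Small (max 80 n)) (machine.init [n, 0]) c ∧ machine.Halted c ∧ c.out = [] ∧
      c.clock ≤ 5 := by
  have h0 : Small (max 80 n) (machine.init [n, 0]).reg := by
    intro a
    show (if a < 80 then 0 else [n, 0].getD (a - 80) 0) ≤ max 80 n ∧
      (82 ≤ a → (if a < 80 then 0 else [n, 0].getD (a - 80) 0) = 0)
    split_ifs with h
    · simp
    · obtain ⟨j, rfl⟩ : ∃ j, a = 80 + j := ⟨a - 80, by omega⟩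
      rw [Nat.add_sub_cancel_left]
      match j with
      | 0 => simp
      | 1 => simp
      | j + 2 => simp
  have h4 := reaches_test (n := n) (m := 0) (a := 1) le_rfl h0 rfl rfl
    fun R i x hR hi hx => by
      intro a
      simp only [Function.update_apply]
      split_ifs with h
      · exact ⟨by omega, by omega⟩
      · exact hR a
  obtain ⟨-, c, h1, h2, -, h3, h4⟩ := h4.jump (l' := 5) (code_prologue (by omega)) le_rfl
    (if_neg (by simp)) (by omega)
  exact ⟨c, h1, .inr (by rw [h2]; exact code_prologue (by omega)), h3, by omega⟩

/-- The two phases of the machine. -/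
theorem steps_phases {E : Env} {w : List ℕ} {b : ℕ → ℕ → ℕ} (h : Input E w) (hnt : 1 ≤ E.nt)
    (hR : Rows E.nv E.nt b)
    (hb : ∀ t, 1 ≤ t → t ≤ E.nt → ∀ j < E.nv, b t j = E.inp (2 + (t - 1) * E.nv + j)) :
    ∃ c d, Steps machine (Safe E.cap) (machine.init w) c ∧ Steps machine (Safe E.cap) c d ∧ c.out = [] ∧
      c.clock ≤ preTime E.nv E.nt E.arith E.opening ∧ machine.Halted d ∧
      d.out = ((fun _ => 1) :: words E.nv E.nt b E.nv 0 (Finset.Icc 1 E.nt) fun _ => 1).map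
        (fun β => (List.range E.nv).map β) ∧
      d.clock ≤ c.clock + 50 * E.arith +
        61 * E.opening * count E.nv E.nt b E.nv 0 (Finset.Icc 1 E.nt) +
        40 * work E.nv E.nt b E.nv 0 (Finset.Icc 1 E.nt) := by
  obtain ⟨c0, h1, h2, h3, h4, h5⟩ := steps_prologue h hnt
  obtain ⟨s, hs, hrun, hout, hclock⟩ : wp E precompute (fun s => Run E b 0 0 (Finset.Icc 1 E.nt)
      (fun _ => 1) s ∧ s.out = [] ∧
      s.clock + 14 * E.arith ≤ preTime E.nv E.nt E.arith E.opening) (start E) :=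
    wp_precompute hnt hb fun s g1 g2 g3 => ⟨g1, g2, g3⟩
  obtain ⟨c, k1, k2, k3, k4, k5⟩ := simulates hs machine 14 wf_precompute codeAt_precompute c0 h2
    h3 h4
  obtain ⟨s', hs', hout', hclock'⟩ := wp_enumerate hR hrun fun s' g1 g2 => (⟨g1, g2⟩ : _ ∧ _)
  obtain ⟨d, l1, l2, -, l4, l5⟩ := simulates hs' machine _ wf_enumerate codeAt_enumerate c k2
    k3 k4
  refine ⟨c, d, h1.trans k1, l1, k4.trans hout, ?_, ?_, ?_, ?_⟩
  · have : (start E).clock = 0 := rfl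
    omega
  · left
    rw [l2]
    exact code_end
  · rw [l4, hout', hout, List.nil_append]
  · omega

/-! ### Time and space of runs -/

theorem space_le_of_support {B V : ℕ} {c : Config} (hV : ∀ a, c.reg a ≤ V)
    (hB : ∀ a, B ≤ a → c.reg a = 0) : c.space ≤ ((B * V.size : ℕ) : ℕ∞) := by
  refine iSup_le fun s => ?_
  rw [Nat.cast_le]
  calc ∑ a ∈ s, (c.reg a).size = ∑ a ∈ s with a < B, (c.reg a).size := by
        refine (Finset.sum_filter_of_ne fun a _ ha => ?_).symm
        by_contra hlt
        rw [hB a (by omega)] at ha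
        exact ha rfl
    _ ≤ (s.filter (· < B)).card * V.size := by
        rw [← smul_eq_mul]
        exact Finset.sum_le_card_nsmul _ _ _ fun a _ => Nat.size_le_size (hV a)
    _ ≤ B * V.size := by
        refine Nat.mul_le_mul_right _ ?_
        calc _ ≤ (Finset.range B).card := Finset.card_le_card fun a ha => by
              rw [Finset.mem_filter] at ha
              exact Finset.mem_range.2 ha.2
          _ = B := Finset.card_range B

theorem step_of_halted {M : RAM} {c : Config} (h : M.Halted c) : M.step c = c := by
  rcases h with h | h <;> simp [RAM.step, h]

/-- A halted configuration is fixed, so bounding the steps up to `d` bounds them all. -/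
theorem Steps.usesSpace {M : RAM} {P : (ℕ → ℕ) → Prop} {w : List ℕ} {d : Config} {b : ℕ}
    (h : Steps M P (M.init w) d) (hd : M.Halted d)
    (hb : ∀ c : Config, P c.reg → c.space ≤ (b : ℕ∞)) : M.UsesSpace w b := by
  obtain ⟨T, hT, hs⟩ := h
  intro t
  by_cases ht : t ≤ T
  · exact hb _ (hs t ht)
  · obtain ⟨k, rfl⟩ : ∃ k, t = k + T := ⟨t - T, by omega⟩
    have : M.run w (k + T) = d := by
      rw [RAM.run, Function.iterate_add_apply, hT]
      exact Function.iterate_fixed (step_of_halted hd) k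
    rw [this, ← hT]
    exact hb _ (hs T le_rfl)

end While

namespace While

open Monotone (Rows words count work)

/-! ### Bounds in terms of the parameters -/

section bounds

variable {E : Env}

theorem size_le_logb {k : ℕ} (hk : 1 ≤ k) : (k.size : ℝ) ≤ 1 + Real.logb 2 k := by
  obtain ⟨j, hj⟩ : ∃ j, k.size = j + 1 :=
    ⟨k.size - 1, by have := Nat.size_pos.2 hk; omega⟩
  have h1 : 2 ^ j ≤ k := Nat.lt_size.1 (by omega)
  have h2 : (j : ℝ) ≤ Real.logb 2 k := by
    rw [Real.le_logb_iff_rpow_le (by norm_num) (by exact_mod_cast hk), Real.rpow_natCast]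
    exact_mod_cast h1
  rw [hj]
  push_cast
  linarith

/-- If there are no variables, then there is at most one term. -/
theorem add_le_param (h1 : 1 ≤ E.nt) (h0 : E.nv = 0 → E.nt ≤ 1) :
    E.nv + E.nt ≤ E.nt * E.nv + 2 := by
  rcases Nat.eq_zero_or_pos E.nv with h | h
  · have := h0 h
    rw [h]
    omega
  · obtain ⟨n, hn⟩ : ∃ n, E.nv = n + 1 := ⟨E.nv - 1, by omega⟩
    obtain ⟨m, hm⟩ : ∃ m, E.nt = m + 1 := ⟨E.nt - 1, by omega⟩
    rw [hn, hm]
    -- The reason is (n - 1)(m - 1) ≥ 0, written in the shifted variables.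
    nlinarith

/-- With p = n + m, `E.cap` is 82 + nm + 24 p (p + 2), and p ≤ mn + 2. A polynomial bound in mn + 2
alone is what makes arithmetic cost O(log(mn + 2)). -/
theorem cap_le (h1 : 1 ≤ E.nt) (h0 : E.nv = 0 → E.nt ≤ 1) :
    E.cap ≤ 128 * (E.nt * E.nv + 2) ^ 2 := by
  have h2 := add_le_param h1 h0
  have h3 : E.nv * E.nt = E.nt * E.nv := mul_comm _ _
  simp only [Env.cap, Env.base, Env.width, Env.rows]
  generalize E.nt * E.nv = q at *
  rw [h3]
  generalize E.nv + E.nt = p at *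
  have h4 : p * (p + 2) ≤ (q + 2) * (q + 2 + 2) := Nat.mul_le_mul h2 (by omega)
  nlinarith

/-- With y the logarithm on the right, which is at least 1, `cap_le` gives 1 + 7 + 2y, where 7 =
log₂ 128. -/
theorem size_cap_le (h1 : 1 ≤ E.nt) (h0 : E.nv = 0 → E.nt ≤ 1) :
    (E.cap.size : ℝ) ≤ 10 * Real.logb 2 ((E.nt : ℝ) * E.nv + 2) := by
  have hy : (2 : ℝ) ≤ (E.nt : ℝ) * E.nv + 2 := by
    have : (0 : ℝ) ≤ (E.nt : ℝ) * E.nv := by positivity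
    linarith
  have hl : 1 ≤ Real.logb 2 ((E.nt : ℝ) * E.nv + 2) := by
    rw [Real.le_logb_iff_rpow_le (by norm_num) (by linarith)]
    simpa using hy
  have hpos : 0 < 128 * (E.nt * E.nv + 2) ^ 2 := by positivity
  have h2 := size_le_logb (Nat.succ_le_of_lt hpos)
  have h3 : (E.cap.size : ℝ) ≤ ((128 * (E.nt * E.nv + 2) ^ 2 : ℕ).size : ℝ) := by
    exact_mod_cast Nat.size_le_size (cap_le h1 h0)
  push_cast at h2 h3
  rw [Real.logb_mul (by norm_num) (by positivity), Real.logb_pow,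
    show (128 : ℝ) = 2 ^ 7 by norm_num, Real.logb_pow, Real.logb_self_eq_one (by norm_num)] at h2
  push_cast at h2
  linarith

/-- With y = log₂ (mn + 2) ≥ 1, `E.arith` is at most 21y, `E.opening` at most 152y, and
`Rows.work_le` bounds the work by 2y per word. Since 50·21 + 61·152 + 40·2 is below 20000, the
constant is ample; the division by `Real.log 2` changes the base. -/
theorem time_le {b : ℕ → ℕ → ℕ} (hR : Rows E.nv E.nt b) (h1 : 1 ≤ E.nt)
    (h0 : E.nv = 0 → E.nt ≤ 1) :
    (50 * E.arith + 61 * E.opening * count E.nv E.nt b E.nv 0 (Finset.Icc 1 E.nt) +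
        40 * work E.nv E.nt b E.nv 0 (Finset.Icc 1 E.nt) : ℝ) ≤
      20000 / Real.log 2 * Real.log ((E.nt : ℝ) * E.nv + 2) *
        (1 + count E.nv E.nt b E.nv 0 (Finset.Icc 1 E.nt)) := by
  have hwork := hR.work_le E.nv 0 (Finset.Icc 1 E.nt) (by omega)
    (fun t ht => by simpa [Monotone.rep] using ht) ⟨1, by simpa using h1⟩
  have hsize := size_cap_le h1 h0
  have hy : (2 : ℝ) ≤ (E.nt : ℝ) * E.nv + 2 := by
    have : (0 : ℝ) ≤ (E.nt : ℝ) * E.nv := by positivity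
    linarith
  have hl : 1 ≤ Real.logb 2 ((E.nt : ℝ) * E.nv + 2) := by
    rw [Real.le_logb_iff_rpow_le (by norm_num) (by linarith)]
    simpa using hy
  have hm : Real.logb 2 E.nt ≤ Real.logb 2 ((E.nt : ℝ) * E.nv + 2) := by
    refine Real.logb_le_logb_of_le (by norm_num) (by exact_mod_cast h1) ?_
    have h2 := add_le_param h1 h0
    exact_mod_cast (show E.nt ≤ E.nt * E.nv + 2 by omega)
  have ho : (E.opening : ℝ) ≤ 2 * E.arith + 10 * E.cap.size + 10 := by
    have h2 : (2 * E.nv).size ≤ E.cap.size := Nat.size_le_size (by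
      have := cap_big E h1
      omega)
    have h3 : E.opening ≤ 2 * E.arith + 10 * E.cap.size + 10 := by
      simp only [Env.opening]
      omega
    exact_mod_cast h3
  have ha : (E.arith : ℝ) = 1 + 2 * E.cap.size := by simp [Env.arith]
  rw [show 20000 / Real.log 2 * Real.log ((E.nt : ℝ) * E.nv + 2) =
    20000 * Real.logb 2 ((E.nt : ℝ) * E.nv + 2) by rw [Real.logb]; ring]
  simp only [Nat.card_Icc, Nat.add_sub_cancel] at hwork
  generalize Real.logb 2 ((E.nt : ℝ) * E.nv + 2) = y at *
  have hcount : (0 : ℝ) ≤ count E.nv E.nt b E.nv 0 (Finset.Icc 1 E.nt) := Nat.cast_nonneg _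
  generalize (count E.nv E.nt b E.nv 0 (Finset.Icc 1 E.nt) : ℝ) = c at *
  generalize (work E.nv E.nt b E.nv 0 (Finset.Icc 1 E.nt) : ℝ) = k at *
  have hnt : (0 : ℝ) ≤ E.nt := Nat.cast_nonneg _
  have hk : k ≤ (1 + c) * (2 * y) := by
    have : (1 + c) * (1 + Real.logb 2 E.nt) ≤ (1 + c) * (2 * y) :=
      mul_le_mul_of_nonneg_left (by linarith) (by linarith)
    linarith
  have hoc : (E.opening : ℝ) * c ≤ 152 * y * c :=
    mul_le_mul_of_nonneg_right (by linarith) hcount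
  have hyc : 0 ≤ y * c := mul_nonneg (by linarith) hcount
  nlinarith

end bounds

/-- Polynomial for the precomputation time. -/
noncomputable def prePoly : Polynomial ℕ :=
  let c : Polynomial ℕ := 128 * (Polynomial.X * Polynomial.X + 2) ^ 2
  -- The five additional units pay for the run on a formula without terms.
  preTime Polynomial.X Polynomial.X (1 + 2 * c) (2 * (1 + 2 * c) + 10 * c + 10) + 5

/-- Polynomial for the space. -/
noncomputable def spacePoly : Polynomial ℕ :=
  -- The second summand is for formulas without terms, where only the first 82 registers are in use.
  (128 * (Polynomial.X * Polynomial.X + 2) ^ 2) ^ 2 + 82 * (Polynomial.X + 7)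

theorem size_le_self (k : ℕ) : k.size ≤ k := Nat.size_le.2 Nat.lt_two_pow_self

theorem preTime_mono {n m a o n' m' a' o' : ℕ} (h1 : n ≤ n') (h2 : m ≤ m') (h3 : a ≤ a')
    (h4 : o ≤ o') : preTime n m a o ≤ preTime n' m' a' o' := by
  simp only [preTime]
  gcongr

theorem preTime_le {E : Env} {N : ℕ} (h1 : 1 ≤ E.nt) (h0 : E.nv = 0 → E.nt ≤ 1) (hn : E.nv ≤ N)
    (hm : E.nt ≤ N) : preTime E.nv E.nt E.arith E.opening ≤ prePoly.eval N := by
  have hc : E.cap ≤ 128 * (N * N + 2) ^ 2 := (cap_le h1 h0).trans (by gcongr)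
  have hs := size_le_self E.cap
  have hb := cap_big E h1
  have hs' := size_le_self (2 * E.nv)
  have he : prePoly.eval N = preTime N N (1 + 2 * (128 * (N * N + 2) ^ 2))
      (2 * (1 + 2 * (128 * (N * N + 2) ^ 2)) + 10 * (128 * (N * N + 2) ^ 2) + 10) + 5 := by
    simp [prePoly, preTime]
  rw [he]
  generalize 128 * (N * N + 2) ^ 2 = c at *
  refine (preTime_mono hn hm ?_ ?_).trans (Nat.le_add_right _ 5)
  · simp only [Env.arith]
    omega
  · simp only [Env.opening, Env.arith]
    omega

theorem space_le {B N : ℕ} (h : B ≤ 128 * (N * N + 2) ^ 2) : B * B.size ≤ spacePoly.eval N := by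
  have he : spacePoly.eval N = (128 * (N * N + 2) ^ 2) ^ 2 + 82 * (N + 7) := by
    simp [spacePoly]
  rw [he, sq (128 * _)]
  exact (Nat.mul_le_mul h ((size_le_self B).trans h)).trans (Nat.le_add_right _ _)

theorem size_max_le {n s : ℕ} (h : n.size ≤ s) : (max 80 n).size ≤ s + 7 := by
  rw [Nat.size_le] at h ⊢
  rw [pow_add]
  have : 1 ≤ 2 ^ s := Nat.one_le_two_pow
  omega

/-! ### Words and formulas -/

theorem getD_flatMap {α : Type*} {f : α → List ℕ} {n : ℕ} (hf : ∀ a, (f a).length = n) :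
    ∀ (l : List α) (i : ℕ) (hi : i < l.length) (j : ℕ), j < n →
      (l.flatMap f).getD (i * n + j) 0 = (f l[i]).getD j 0
  | a :: l, 0, _, j, hj => by
    rw [List.flatMap_cons, List.getD_append _ _ _ _ (by rw [hf]; omega)]
    simp
  | a :: l, i + 1, hi, j, hj => by
    rw [List.flatMap_cons, List.getD_append_right _ _ _ _ (by rw [hf, add_mul]; omega), hf,
      show (i + 1) * n + j - n = i * n + j by rw [add_mul]; omega,
      getD_flatMap hf l i (by simpa using hi) j hj]
    rfl

theorem length_flatMap {α : Type*} {f : α → List ℕ} {n : ℕ} (hf : ∀ a, (f a).length = n)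
    (l : List α) : (l.flatMap f).length = n * l.length := by
  simp [List.length_flatMap, hf, mul_comm]

theorem length_le_wordSize (w : List ℕ) : w.length ≤ wordSize w := by
  rw [wordSize, ← List.length_map (f := fun a : ℕ => a.size + 1) (as := w)]
  refine List.length_le_sum_of_one_le _ fun a ha => ?_
  obtain ⟨x, -, rfl⟩ := List.mem_map.1 ha
  omega

section formula

variable {n : ℕ} {l : List (Term n)}

/-- The matrix of a list of terms, with rows numbered from `1`. -/
def matrix (l : List (Term n)) (t j : ℕ) : ℕ :=
  if ∃ (ht : t - 1 < l.length) (hj : j < n), ((⟨j, hj⟩ : Fin n), true) ∈ l[t - 1].1 then 1 else 0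

theorem matrix_ne_zero {t j : ℕ} (ht : t - 1 < l.length) (hj : j < n) :
    matrix l t j ≠ 0 ↔ ((⟨j, hj⟩ : Fin n), true) ∈ l[t - 1].1 := by
  simp [matrix, ht, hj]

/-- A monotone term is determined by its positive literals, so distinct terms give distinct rows. -/
theorem rows_matrix (hl : l.Nodup) (hm : DNF.IsMonotone l.toFinset) :
    Rows n l.length (matrix l) := by
  refine ⟨fun t j => ?_, fun t u h1 h2 h3 h4 h => ?_⟩
  · unfold matrix
    split_ifs <;> omega
  · have ht : t - 1 < l.length := by omega
    have hu : u - 1 < l.length := by omega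
    have heq : l[t - 1] = l[u - 1] := by
      refine Subtype.ext (Finset.ext fun ⟨i, v⟩ => ?_)
      cases v with
      | false =>
        refine iff_of_false (fun hmem => ?_) fun hmem => ?_
        · exact absurd (hm _ (by simp) _ hmem) (by simp)
        · exact absurd (hm _ (by simp) _ hmem) (by simp)
      | true =>
        have := h i i.2 (Nat.zero_le _)
        rw [← matrix_ne_zero ht i.2, ← matrix_ne_zero hu i.2, this]
    have := (List.Nodup.getElem_inj_iff hl).1 heq
    omega

theorem length_encode (T : Term n) : (Term.encode T).length = n := by simp [Term.encode]

/-- The layout for the input that consists of a list of terms. -/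
def env (l : List (Term n)) : Env := ⟨n, l.length, fun j => (encodeInput l).getD j 0⟩

theorem matrix_eq (hm : DNF.IsMonotone l.toFinset) {t : ℕ} (h1 : 1 ≤ t) (ht : t ≤ l.length)
    {j : ℕ} (hj : j < n) : matrix l t j = (encodeInput l).getD (2 + (t - 1) * n + j) 0 := by
  have ht' : t - 1 < l.length := by omega
  rw [encodeInput, show 2 + (t - 1) * n + j = (t - 1) * n + j + 1 + 1 by omega,
    List.getD_cons_succ, List.getD_cons_succ, getD_flatMap length_encode l _ ht' _ hj]
  have hno : ((⟨j, hj⟩ : Fin n), false) ∉ l[t - 1].1 := fun hmem =>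
    absurd (hm _ (by simp) _ hmem) (by simp)
  simp [Term.encode, matrix, ht', hj, hno]

theorem encodeInput_le (l : List (Term n)) {B : ℕ} (hB : 2 ≤ B) (hn : n ≤ B)
    (hl : l.length ≤ B) : ∀ x ∈ encodeInput l, x ≤ B := by
  intro x hx
  simp only [encodeInput, List.mem_cons, List.mem_flatMap] at hx
  rcases hx with rfl | rfl | ⟨T, -, hT⟩
  · exact hn
  · exact hl
  · simp only [Term.encode, List.mem_ofFn] at hT
    obtain ⟨i, rfl⟩ := hT
    split_ifs <;> omega

theorem input_env (hl : 1 ≤ l.length) : Input (env l) (encodeInput l) := by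
  refine ⟨fun j => rfl, ?_, rfl, rfl, fun j => ?_⟩
  · simp only [encodeInput, List.length_cons, length_flatMap length_encode, env]
    omega
  · have h1 := cap_big (env l) hl
    have h2 := cap_ge (env l)
    have h3 : (env l).nv = n := rfl
    have h4 : (env l).nt = l.length := rfl
    by_cases hj : j < (encodeInput l).length
    · rw [List.getD_eq_getElem _ _ hj]
      exact encodeInput_le l (by omega) (by omega) (by omega) _ (List.getElem_mem hj)
    · rw [List.getD_eq_default _ _ (by omega)]
      omega

theorem length_le_one_of_no_variables (hl : l.Nodup) (h0 : n = 0) : l.length ≤ 1 := by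
  subst h0
  have hsub : Subsingleton (Term 0) := ⟨fun S T => Subtype.ext (Finset.ext fun ⟨i, _⟩ => i.elim0)⟩
  rw [← List.toFinset_card_of_nodup hl]
  exact Finset.card_le_one.2 fun a _ b _ => Subsingleton.elim a b

/-- The words that the machine outputs before they are cut off. -/
def models (l : List (Term n)) : List (ℕ → ℕ) :=
  (fun _ => 1) :: words n l.length (matrix l) n 0 (Finset.Icc 1 l.length) fun _ => 1

/-- The recursion lists the models with a zero among the first `n` positions; the all-ones word is
the remaining one and needs a term. The value 1 beyond `n` makes `β` determined by its first `n`
values. -/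
theorem mem_models (hl : 1 ≤ l.length) (β : ℕ → ℕ) : β ∈ models l ↔
    (∀ j, n ≤ j → β j = 1) ∧ (∀ j < n, β j ≤ 1) ∧
      ∃ T ∈ l, ∀ i : Fin n, (i, true) ∈ T.1 → β i = 1 := by
  have hrow : (∃ t ∈ Finset.Icc 1 l.length, ∀ j, 0 ≤ j → j < n → matrix l t j ≠ 0 → β j = 1) ↔
      ∃ T ∈ l, ∀ i : Fin n, (i, true) ∈ T.1 → β i = 1 := by
    constructor
    · rintro ⟨t, ht, h⟩
      rw [Finset.mem_Icc] at ht
      have ht' : t - 1 < l.length := by omega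
      exact ⟨l[t - 1], by simp, fun i hi => h i (Nat.zero_le _) i.2
        ((matrix_ne_zero ht' i.2).2 hi)⟩
    · rintro ⟨T, hT, h⟩
      obtain ⟨k, hk, rfl⟩ := List.getElem_of_mem hT
      refine ⟨k + 1, by simpa using hk, fun j _ hj hne => h ⟨j, hj⟩ ?_⟩
      exact (matrix_ne_zero (t := k + 1) hk hj).1 hne
  rw [models, List.mem_cons, Monotone.mem_words n 0 _ _ (by omega) (fun _ _ _ => rfl), hrow]
  constructor
  · rintro (rfl | ⟨h1, h2, -, h4⟩)
    · exact ⟨fun _ _ => rfl, fun _ _ => le_rfl, l[0], by simp, fun _ _ => rfl⟩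
    · exact ⟨fun j hj => h1 j (.inr hj), fun j hj => h2 j (Nat.zero_le _) hj, h4⟩
  · rintro ⟨h1, h2, h3⟩
    by_cases hz : ∃ j, 0 ≤ j ∧ j < n ∧ β j = 0
    · exact .inr ⟨fun j hj => h1 j (by omega), fun j _ hj => h2 j hj, hz, h3⟩
    · refine .inl (funext fun j => ?_)
      by_cases hj : j < n
      · have := h2 j hj
        have : β j ≠ 0 := fun h => hz ⟨j, Nat.zero_le _, hj, h⟩
        omega
      · exact h1 j (by omega)

theorem nodup_models : (models l).Nodup := by
  refine List.nodup_cons.2 ⟨fun h => ?_, Monotone.nodup_words n 0 _ _ (by omega) fun _ _ _ => rfl⟩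
  rw [Monotone.mem_words n 0 _ _ (by omega) (fun _ _ _ => rfl)] at h
  obtain ⟨-, -, ⟨j, -, -, hj⟩, -⟩ := h
  exact absurd hj (by simp)

theorem nodup_output (hl : 1 ≤ l.length) :
    ((models l).map fun β => (List.range n).map β).Nodup := by
  refine nodup_models.map_on fun β hβ γ hγ h => funext fun j => ?_
  rw [mem_models hl] at hβ hγ
  by_cases hj : j < n
  · exact List.map_inj_left.1 h j (List.mem_range.2 hj)
  · rw [hβ.1 j (by omega), hγ.1 j (by omega)]

theorem encodeAssignment_eq {α : Fin n → Bool} {β : ℕ → ℕ} (h : ∀ i : Fin n, β i = (α i).toNat) :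
    encodeAssignment α = (List.range n).map β := by
  refine List.ext_getElem (by simp [encodeAssignment]) fun j h1 h2 => ?_
  have hj : j < n := by simpa [encodeAssignment] using h1
  simp [encodeAssignment, h ⟨j, hj⟩ |>.symm]

theorem mem_output (hl : 1 ≤ l.length) (hm : DNF.IsMonotone l.toFinset) :
    {y | y ∈ (models l).map fun β => (List.range n).map β} =
      encodeAssignment '' DNF.sat l.toFinset := by
  ext y
  simp only [Set.mem_ofPred_eq, List.mem_map, Set.mem_image]
  constructor
  · rintro ⟨β, hβ, rfl⟩
    obtain ⟨-, h2, T, hT, h3⟩ := (mem_models hl β).1 hβ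
    refine ⟨fun i => decide (β i = 1), ⟨T, by simpa using hT, fun ⟨i, v⟩ hi => ?_⟩,
      encodeAssignment_eq fun i => ?_⟩
    · obtain rfl : v = true := hm T (by simpa using hT) _ hi
      simp [Literal.value, h3 i hi]
    · have := h2 i i.2
      by_cases h : β i = 1
      · simp [h]
      · simp [h]
        omega
  · rintro ⟨α, ⟨T, hT, h⟩, rfl⟩
    refine ⟨fun j => if hj : j < n then (α ⟨j, hj⟩).toNat else 1, (mem_models hl _).2
      ⟨fun j hj => dif_neg (by omega), fun j hj => ?_, T, by simpa using hT, fun i hi => ?_⟩,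
      (encodeAssignment_eq fun i => ?_).symm⟩
    · simp only [hj, dite_true]
      exact Bool.toNat_le _
    · have := h _ hi
      simp only [Literal.value, if_true] at this
      simp [this]
    · simp

end formula

end While

/-! ### Correctness of the machine -/

namespace While

theorem run_of_steps {M : RAM} {P : (ℕ → ℕ) → Prop} {w : List ℕ} {c d : Config}
    (h : Steps M P (M.init w) c) (h' : Steps M P c d) :
    ∃ s t, s ≤ t ∧ M.run w s = c ∧ M.run w t = d := by
  obtain ⟨s, hs, -⟩ := h
  obtain ⟨t, ht, -⟩ := h'
  refine ⟨s, t + s, by omega, hs, ?_⟩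
  rw [RAM.run, Function.iterate_add_apply, hs, ht]

/-- There is no model, so no time at all is allowed after the precomputation: the whole run is
counted as precomputation. -/
theorem machine_correct_of_empty (n : ℕ) (d : ℝ) :
    machine.Enumerates [n, 0] ∅ ∧
      machine.HasAverageDelay [n, 0] (prePoly.eval (wordSize [n, 0])) d ∧
      machine.UsesSpace [n, 0] (spacePoly.eval (wordSize [n, 0])) := by
  obtain ⟨c, h1, h2, h3, h4⟩ := steps_empty n
  obtain ⟨T, hT⟩ : ∃ T, machine.run [n, 0] T = c := let ⟨T, hT, _⟩ := h1; ⟨T, hT⟩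
  refine ⟨⟨T, ?_, ?_, ?_⟩, ⟨T, T, le_rfl, ?_, ?_, ?_, ?_⟩, h1.usesSpace h2 fun c hc => ?_⟩
  · rwa [hT]
  · simp [hT, h3]
  · simp [hT, h3]
  · rw [hT, h3]
  · rw [hT]
    refine h4.trans ?_
    simp only [prePoly, Polynomial.eval_add]
    rw [Polynomial.eval_ofNat]
    omega
  · rwa [hT]
  · simp [hT, h3]
  · refine (space_le_of_support (fun a => (hc a).1) fun a => (hc a).2).trans ?_
    rw [Nat.cast_le]
    have h5 : (max 80 n).size ≤ wordSize [n, 0] + 7 := size_max_le (by simp [wordSize]; omega)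
    simp only [spacePoly, Polynomial.eval_add, Polynomial.eval_mul, Polynomial.eval_X,
      Polynomial.eval_ofNat]
    omega

/-- The number of outputs is `1 + count`, the all-ones word included, and this is the factor on the
right of `time_le`. -/
theorem machine_correct {n : ℕ} {l : List (Term n)} (hl : l.Nodup)
    (hm : DNF.IsMonotone l.toFinset) (hpos : 1 ≤ l.length) :
    machine.Enumerates (encodeInput l) (encodeAssignment '' DNF.sat l.toFinset) ∧
      machine.HasAverageDelay (encodeInput l) (prePoly.eval (wordSize (encodeInput l)))
        (20000 / Real.log 2 * Real.log ((l.length : ℝ) * n + 2)) ∧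
      machine.UsesSpace (encodeInput l) (spacePoly.eval (wordSize (encodeInput l))) := by
  have hR := rows_matrix hl hm
  have h0 : n = 0 → l.length ≤ 1 := length_le_one_of_no_variables hl
  have hlen : 2 + n * l.length ≤ wordSize (encodeInput l) := by
    refine le_trans (le_of_eq ?_) (length_le_wordSize _)
    simp only [encodeInput, List.length_cons, length_flatMap length_encode]
    omega
  have hn : n ≤ wordSize (encodeInput l) := by
    have : n * 1 ≤ n * l.length := Nat.mul_le_mul_left _ hpos
    omega
  have hml : l.length ≤ wordSize (encodeInput l) := by
    rcases Nat.eq_zero_or_pos n with h | h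
    · have := h0 h
      omega
    · have : 1 * l.length ≤ n * l.length := Nat.mul_le_mul_right _ h
      omega
  obtain ⟨c, d, h1, h2, h3, h4, h5, h6, h7⟩ := steps_phases (E := env l) (b := matrix l)
    (input_env hpos) hpos hR fun t ht ht' j hj => matrix_eq hm ht ht' hj
  have hout : d.out = (models l).map fun β => (List.range n).map β := h6
  obtain ⟨s, t, hst, hs, ht⟩ := run_of_steps h1 h2
  refine ⟨⟨t, ?_, ?_, ?_⟩, ⟨s, t, hst, ?_, ?_, ?_, ?_⟩, (h1.trans h2).usesSpace h5 fun c hc => ?_⟩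
  · rwa [ht]
  · rw [ht, hout]
    exact nodup_output hpos
  · rw [ht, hout]
    exact mem_output hpos hm
  · rw [hs, h3]
  · rw [hs]
    exact h4.trans (preTime_le (E := env l) hpos h0 hn hml)
  · rwa [ht]
  · rw [ht, hs, hout, List.length_map, models, List.length_cons, Monotone.length_words]
    have htime := time_le (E := env l) hR hpos h0
    have h8 : (d.clock : ℝ) ≤ c.clock + (50 * (env l).arith + 61 * (env l).opening *
        Monotone.count n l.length (matrix l) n 0 (Finset.Icc 1 l.length) + 40 *
        Monotone.work n l.length (matrix l) n 0 (Finset.Icc 1 l.length)) := by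
      rw [← add_assoc, ← add_assoc]
      exact_mod_cast h7
    have h9 := htime.trans (le_of_eq (by rw [add_comm (1 : ℝ)]))
    push_cast
    exact (sub_le_iff_le_add'.2 h8).trans h9
  · refine (space_le_of_support (fun a => (hc a).1) fun a => (hc a).2).trans ?_
    rw [Nat.cast_le]
    refine space_le ((cap_le (E := env l) hpos h0).trans ?_)
    show 128 * (l.length * n + 2) ^ 2 ≤ _
    gcongr

end While

theorem mainTheorem4 :
    ∃ (M : RAM) (C : ℝ) (pre space : Polynomial ℕ),
      ∀ (n : ℕ) (D : DNF n), D.IsMonotone →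
        ∀ l : List (Term n), l.Nodup → l.toFinset = D →
          M.Enumerates (encodeInput l) (encodeAssignment '' D.sat) ∧
          M.HasAverageDelay (encodeInput l) (pre.eval (wordSize (encodeInput l)))
            (C * Real.log ((D.card : ℝ) * (n : ℝ) + 2)) ∧
          M.UsesSpace (encodeInput l) (space.eval (wordSize (encodeInput l))) := by
  refine ⟨While.machine, 20000 / Real.log 2, While.prePoly, While.spacePoly,
    fun n D hD l hl hlD => ?_⟩
  subst hlD
  rw [List.toFinset_card_of_nodup hl]
  rcases Nat.eq_zero_or_pos l.length with h | h
  · obtain rfl := List.length_eq_zero_iff.1 h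
    have hsat : encodeAssignment '' DNF.sat (n := n) ([] : List (Term n)).toFinset = ∅ := by
      simp [DNF.sat]
    rw [hsat]
    exact While.machine_correct_of_empty n _
  · exact While.machine_correct hl hD h
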